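/- For $i=1,2$ let $\xi_i(t)=\sum_{k=1}^{N_i(t)}\xi^i_k-a_it$, $t\ge0$, where $a_i>0$, $N_i$ is a Poisson process with intensity $\lambda_i>0$, and the jumps $\xi^i_k>0$ are i.i.d. with distribution $F_i$ and independent of $N_i$. Put $k_i(z)=a_iz+\lambda_i\int_0^\infty(e^{-uz}-1)\,dF_i(u)$ for $\Re z\ge0$, so that $\mathbf E e^{-z\xi_i(t)}=e^{tk_i(z)}$ for $\Re z=0$; for $s\ge0$ let $c_i(s)$ be the largest root in $[0,\infty)$ of $k_i(c)=s$ (for $s>0$ it is the only positive root). Let $\tau_2^-(y)=\inf\{t:\xi_2(t)\le-y\}$, $\tau_1^+(y)=\inf\{t:\xi_1(t)>y\}$ and $T_1^+(y)=\xi_1(\tau_1^+(y))-y$ (with $\inf\emptyset=\infty$). Let $B>0$ and $x,b\in[0,B]$. The oscillating process $\xi(x,t)$ with switching level $b$ starts at $\xi(x,0)=x$ and is built in successive stages, each driven by a fresh independent copy of $\xi_1$ or $\xi_2$: a stage that begins at a position $y>b$ follows $y+\xi_2(\cdot)$ for the time $\tau_2^-(y-b)$, and the next stage begins at $b$; a stage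 that begins at $y\le b$ follows $y+\xi_1(\cdot)$ for the time $\tau_1^+(b-y)$, and the next stage begins at $b+T_1^+(b-y)$. Let $\chi_x(b)=\inf\{t:\xi(x,t)\notin[0,B]\}$, let $\overline A=\{\chi_x(b)<\infty,\ \xi(x,\chi_x(b))>B\}$ and $\underline A=\{\chi_x(b)<\infty,\ \xi(x,\chi_x(b))\le0\}$ be the events of exit through the upper and the lower boundary, and let $T(x)=(\xi(x,\chi_x(b))-B)\mathbf I_{\overline A}$ be the overshoot. Fix $s\ge0$. There is a unique function $R_1^s:\mathbb R\to\mathbb R$ that vanishes on $(-\infty,0)$, is right-continuous on $[0,\infty)$ and satisfies $$\int_0^\infty e^{-uz}R_1^s(u)\,du=\frac1{k_1(z)-s},\qquad \Re z>c_1(s),$$ and for each $y\in\mathbb R$ a unique function $u\mapsto K_y^s(u)$ that vanishes on $(-\infty,0)$, is right-continuous on $[0,\infty)$ and satisfies $$\int_0^\infty e^{-uz}K_y^s(u)\,du=\frac{k_1(z)-s}{k_2(z)-s}\int_0^\infty e^{-uz}R_1^s(y+u)\,du,\qquad \Re z>\max\{c_1(s),c_2(s)\}.$$ For $y\in\mathbb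 R$ and $u\ge0$ put $$\mathfrak K_y^u(s)=1+s\int_0^yR_1^s(v)\,dv+s\int_0^uK_y^s(v)\,dv,$$ $$\mathfrak K_y^u(z,s)=e^{uz}\Big(C_1^y(z,s)-(k_2(z)-s)\int_0^ue^{-vz}K_y^s(v)\,dv\Big),$$ where $C_1^y(z,s)=e^{zy}$ for $y<0$ and $C_1^y(z,s)=e^{zy}\big(1-(k_1(z)-s)\int_0^ye^{-uz}R_1^s(u)\,du\big)$ for $y\ge0$. Then $\chi_x(b)$ and $\xi(x,\chi_x(b))$ are (up to null sets) random variables, $K_b^s(B-b)\ne0$, $$\mathbf E\big[e^{-s\chi_x(b)};\underline A\big]=\frac{K_{b-x}^s(B-b)}{K_b^s(B-b)},$$ $$\mathbf E\big[e^{-s\chi_x(b)};\overline A\big]=\mathfrak K_{b-x}^{B-b}(s)-\frac{K_{b-x}^s(B-b)}{K_b^s(B-b)}\,\mathfrak K_b^{B-b}(s),$$ and, for all $z\in\mathbb C$ with $\Re z\ge0$, $$\mathbf E\big[e^{-s\chi_x(b)-zT(x)};\overline A\big]=\mathfrak K_{b-x}^{B-b}(z,s)-\frac{K_{b-x}^s(B-b)}{K_b^s(B-b)}\,\mathfrak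 K_b^{B-b}(z,s).$$ -/

import Mathlib

open MeasureTheory ProbabilityTheory Set
open scoped NNReal ENNReal

noncomputable section

/-! ### Compound Poisson processes with positive jumps and negative drift -/

/-- Parameters of a compound Poisson process `∑_{k ≤ N(t)} ξ_k - a t`: the drift coefficient
`a > 0`, the intensity `rate > 0` of the Poisson process `N`, and the common law `jumpLaw`
of the jumps `ξ_k > 0`. -/
structure CompoundPoisson where
  a : ℝ
  rate : ℝ
  jumpLaw : Measure ℝ
  a_pos : 0 < a
  rate_pos : 0 < rate
  isProbabilityMeasure_jumpLaw : IsProbabilityMeasure jumpLaw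
  jumpLaw_nonpos : jumpLaw (Iic 0) = 0

/-- The two regimes of the oscillating process: `lower` is in force at and below the switching
level (index 1), `upper` strictly above it (index 2). -/
inductive Regime where
  | lower
  | upper

/-- The value at time `t` of the counting process of a sequence `T` of interarrival times:
the number of partial sums `T 0 + ... + T k` that do not exceed `t`. -/
def countingPath (T : ℕ → ℝ) (t : ℝ≥0) : ℕ :=
  Set.ncard {k : ℕ | ∑ j ∈ Finset.range (k + 1), T j ≤ t}

/-- The path `∑_{k ≤ N(t)} ξ_k - a t` with interarrival times `T` and jumps `J`. -/
def compoundPath (a : ℝ) (T J : ℕ → ℝ) (t : ℝ≥0) : ℝ :=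
  ∑ k ∈ Finset.range (countingPath T t), J k - a * t

/-- `T i n` and `J i n` are the interarrival times and the jumps of the `n`-th copy of the
compound Poisson process with parameters `p i`; all these variables are independent,
the interarrival times are exponential, the jumps have the prescribed law. -/
structure IsDrivingNoise {Ω : Type*} [MeasurableSpace Ω] (P : Measure Ω)
    (p : Regime → CompoundPoisson) (T J : Regime → ℕ → ℕ → Ω → ℝ) : Prop where
  hasLaw_T : ∀ i n k, HasLaw (T i n k) (expMeasure (p i).rate) P
  hasLaw_J : ∀ i n k, HasLaw (J i n k) (p i).jumpLaw P
  indep : iIndepFun (fun q : (Regime × ℕ × ℕ) ⊕ (Regime × ℕ × ℕ) =>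
    Sum.elim (fun j => T j.1 j.2.1 j.2.2) (fun j => J j.1 j.2.1 j.2.2) q) P

/-! ### The oscillating process, path by path -/

/-- `inf {t ≥ 0 : w t ∈ A}`, with `inf ∅ = ∞`. -/
def hitTime (w : ℝ≥0 → ℝ) (A : Set ℝ) : ℝ≥0∞ :=
  ⨅ (t : ℝ≥0) (_ : w t ∈ A), (t : ℝ≥0∞)

/-- `τ⁻(y) = inf {t : w t ≤ -y}`. -/
def tauMinus (w : ℝ≥0 → ℝ) (y : ℝ) : ℝ≥0∞ := hitTime w (Iic (-y))

/-- `τ⁺(y) = inf {t : w t > y}`. -/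
def tauPlus (w : ℝ≥0 → ℝ) (y : ℝ) : ℝ≥0∞ := hitTime w (Ioi y)

/-- The overshoot `T⁺(y) = w (τ⁺(y)) - y` (used only where `τ⁺(y) < ∞`). -/
def overshootPlus (w : ℝ≥0 → ℝ) (y : ℝ) : ℝ := w (tauPlus w y).toNNReal - y

open Classical in
/-- The time at which the `n`-th stage of the oscillating path begins, and the position there.
The `n`-th stage is driven by the path `w i n`, `i` being the regime in force.
A stage that begins at `y > b` ends at `b`, after the time `τ₂⁻(y - b)`; a stage that begins at
`y ≤ b` ends at `b + T₁⁺(b - y)`, after the time `τ₁⁺(b - y)`. -/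
def stage (w : Regime → ℕ → ℝ≥0 → ℝ) (b x : ℝ) : ℕ → ℝ≥0∞ × ℝ
  | 0 => (0, x)
  | n + 1 =>
    let S := (stage w b x n).1
    let y := (stage w b x n).2
    if b < y then (S + tauMinus (w .upper n) (y - b), b)
    else (S + tauPlus (w .lower n) (b - y), b + overshootPlus (w .lower n) (b - y))

open Classical in
/-- The oscillating path `t ↦ ξ(x, t)` with switching level `b`, started at `x`: in the stage
`n` that contains `t`, begun at time `S` and position `y`, it is `y + w i n (t - S)`. -/
def oscPath (w : Regime → ℕ → ℝ≥0 → ℝ) (b x : ℝ) (t : ℝ≥0) : ℝ :=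
  let n := sInf {n : ℕ | (t : ℝ≥0∞) < (stage w b x (n + 1)).1}
  let S := (stage w b x n).1
  let y := (stage w b x n).2
  if b < y then y + w .upper n (t - S.toNNReal) else y + w .lower n (t - S.toNNReal)

/-- The oscillating process `ξ(x, t)` driven by the noise `T`, `J`: successive stages use
independent copies of the compound Poisson processes. -/
def oscProcess {Ω : Type*} (p : Regime → CompoundPoisson) (T J : Regime → ℕ → ℕ → Ω → ℝ)
    (b x : ℝ) (t : ℝ≥0) (ω : Ω) : ℝ :=
  oscPath (fun i n => compoundPath (p i).a (fun k => T i n k ω) (fun k => J i n k ω)) b x t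

/-! ### The first exit from `[0, B]` by a real process `X` -/

section Exit

variable {Ω : Type*} (X : ℝ≥0 → Ω → ℝ) (B : ℝ)

/-- The first exit time `χ = inf {t : X t ∉ [0, B]}`. -/
def exitTime (ω : Ω) : ℝ≥0∞ := hitTime (fun t => X t ω) (Icc 0 B)ᶜ

/-- The position `X χ` at the first exit time (used only where `χ < ∞`). -/
def exitPos (ω : Ω) : ℝ := X (exitTime X B ω).toNNReal ω

/-- The exit takes place through the lower boundary. -/
def exitLower : Set Ω := {ω | exitTime X B ω < ∞ ∧ exitPos X B ω ≤ 0}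

/-- The exit takes place through the upper boundary. -/
def exitUpper : Set Ω := {ω | exitTime X B ω < ∞ ∧ B < exitPos X B ω}

/-- The overshoot over `B` at the first exit time, `0` if the exit is not through `B`. -/
def exitOvershoot : Ω → ℝ := (exitUpper X B).indicator fun ω => exitPos X B ω - B

variable [MeasurableSpace Ω] (P : Measure Ω)

/-- `E[exp(-s χ); exit through the lower boundary]`. -/
def lowerTransform (s : ℝ) : ℝ :=
  ∫ ω, (exitLower X B).indicator (fun ω => Real.exp (-s * (exitTime X B ω).toReal)) ω ∂P

/-- `E[exp(-s χ); exit through the upper boundary]`. -/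
def upperTransform (s : ℝ) : ℝ :=
  ∫ ω, (exitUpper X B).indicator (fun ω => Real.exp (-s * (exitTime X B ω).toReal)) ω ∂P

/-- `E[exp(-s χ - z T); exit through the upper boundary]`, `T` being the overshoot. -/
def upperJointTransform (z : ℂ) (s : ℝ) : ℂ :=
  ∫ ω, (exitUpper X B).indicator (fun ω =>
    Complex.exp (-s * (exitTime X B ω).toReal - z * exitOvershoot X B ω)) ω ∂P

end Exit

/-! ### Laplace exponents, resolvents and the functions built from them -/

/-- `k(z) = a z + λ ∫ (exp(-u z) - 1) dF(u)`, for which `E exp(-z ξ(t)) = exp(t k(z))`. -/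
def CompoundPoisson.k (p : CompoundPoisson) (z : ℂ) : ℂ :=
  p.a * z + p.rate * ∫ u : ℝ, (Complex.exp (-u * z) - 1) ∂p.jumpLaw

/-- The largest root `c(s) ≥ 0` of `k(c) = s`; for `s > 0` it is the only positive one. -/
def CompoundPoisson.c (p : CompoundPoisson) (s : ℝ) : ℝ :=
  sSup {r : ℝ | 0 ≤ r ∧ p.k r = s}

/-- `f` vanishes on the negative half-line, is right-continuous on `[0, ∞)`, and its Laplace
transform exists and equals `L` on the half-plane `Re z > c`. -/
structure HasLaplaceTransform (f : ℝ → ℝ) (c : ℝ) (L : ℂ → ℂ) : Prop where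
  eq_zero : ∀ u < 0, f u = 0
  rightContinuous : ∀ u, 0 ≤ u → ContinuousWithinAt f (Ici u) u
  integrableOn : ∀ z : ℂ, c < z.re →
    IntegrableOn (fun u : ℝ => Complex.exp (-u * z) * f u) (Ioi 0)
  integral_eq : ∀ z : ℂ, c < z.re →
    ∫ u in Ioi (0 : ℝ), Complex.exp (-u * z) * f u = L z

/-- `R` is the resolvent of the process with parameters `p` at `s`. -/
def IsResolvent (p : CompoundPoisson) (s : ℝ) (R : ℝ → ℝ) : Prop :=
  HasLaplaceTransform R (p.c s) fun z => (p.k z - s)⁻¹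

/-- The resolvent `R^s`, determined by its Laplace transform `(k(z) - s)⁻¹`. -/
def scaleResolvent (p : CompoundPoisson) (s : ℝ) : ℝ → ℝ := Classical.epsilon (IsResolvent p s)

/-- `K` is the function `u ↦ K_x^s(u)`. -/
def IsKFunction (p : Regime → CompoundPoisson) (s x : ℝ) (K : ℝ → ℝ) : Prop :=
  HasLaplaceTransform K (max ((p .lower).c s) ((p .upper).c s)) fun z =>
    ((p .lower).k z - s) / ((p .upper).k z - s) *
      ∫ u in Ioi (0 : ℝ), Complex.exp (-u * z) * scaleResolvent (p .lower) s (x + u)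

/-- The function `u ↦ K_x^s(u)`, determined by its Laplace transform. -/
def kFunction (p : Regime → CompoundPoisson) (s x : ℝ) : ℝ → ℝ :=
  Classical.epsilon (IsKFunction p s x)

open Classical in
/-- `C^x(z, s)`: equal to `exp(z x)` for `x < 0` and to
`exp(z x) (1 - (k(z) - s) ∫_0^x exp(-u z) R^s(u) du)` for `x ≥ 0`. -/
def cFunction (p : CompoundPoisson) (x : ℝ) (z : ℂ) (s : ℝ) : ℂ :=
  if x < 0 then Complex.exp (z * x)
  else Complex.exp (z * x) *
    (1 - (p.k z - s) * ∫ u in (0 : ℝ)..x, Complex.exp (-u * z) * scaleResolvent p s u)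

/-- `𝔎_x^u(s) = 1 + s ∫_0^x R_1^s(v) dv + s ∫_0^u K_x^s(v) dv`. -/
def frakK (p : Regime → CompoundPoisson) (x u s : ℝ) : ℝ :=
  1 + s * (∫ v in (0 : ℝ)..x, scaleResolvent (p .lower) s v) + s * ∫ v in (0 : ℝ)..u, kFunction p s x v

/-- `𝔎_x^u(z, s) = exp(u z) (C_1^x(z, s) - (k_2(z) - s) ∫_0^u exp(-v z) K_x^s(v) dv)`. -/
def frakKJoint (p : Regime → CompoundPoisson) (x u : ℝ) (z : ℂ) (s : ℝ) : ℂ :=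
  Complex.exp (u * z) * (cFunction (p .lower) x z s -
    ((p .upper).k z - s) * ∫ v in (0 : ℝ)..u, Complex.exp (-v * z) * kFunction p s x v)

end

noncomputable section

open Filter Topology

/-! The core is one optional-stopping identity. Measured downwards from a level, each process drifts
up at speed `a` and jumps down. `Harmonic` is an integral equation for a function H of this
distance; by `Harmonic.integral_firstLaw` it makes H(y) the expected discounted value of H after the
first jump, or after a drift through a given distance if that ends sooner.

Let h be harmonic for the upper process in the variable B - x; its values on (-∞, 0) weigh the
overshoot. The function y ↦ h(B - b + y), y < 0, is continued across 0, with value h(B - b) at 0, to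
a function harmonic for the lower process in the variable b - x. This is `ext`, explicit in terms of
R_1. The two pieces glue to a function of x (`exitValue`) whose discounted expectation is preserved
by every move of the oscillating process inside (0, B]. The lower boundary is reached by drift,
hence exactly at 0, and stopping at the exit gives `exit_identity`: ext(b) E[e^{-sχ}; lower] +
E[e^{-sχ} h(B - ξ(χ)); upper] = ext(b - x).

Two choices of h suffice. The resolvent R_2 vanishes on (-∞, 0), which removes the upper term; the
function C_2^y(z, s) equals e^{zy} for y < 0, which produces the joint transform of time and
overshoot. Comparing Laplace transforms in the level u identifies the extension of R_2 with K
(`kFunction_eq_ext`), and linearity identifies the extension of C_2 with 𝔎(z, s)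
(`frakKJoint_eq_ext`). At x = B the first relation has right-hand side R_2(0) = 1/a_2, so K_b^s(B -
b) ≠ 0. The second formula of the theorem is the third at z = 0.

On the analytic side, R exists because k(z) - s = a (z - c)(1 - L(z)), where L is the transform of a
positive kernel of mass less than 1 for Re z > c, so that a Neumann series converges
(`exists_resolvent`). All convolution identities are checked on transforms
(`LaplaceClass.laplace_mixture`, `LaplaceClass.eq_of_laplace`).

On the probabilistic side, the path is observed only at jumps and at passages through the floor of
the current regime (b above, 0 below). This gives a chain carrying its unused noise; after a move
that noise is again fresh (`map_stepIn`). The chain stops almost surely (`ae_chain_stops`), and it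
then shows the exit time and position of the path (`exitAt_of_iterate_chainStep`). Bounded
convergence along the chain yields `integral_exit`. -/

/-! ### Injectivity of the Fourier and Laplace transforms -/

/-- A test function g is the Fourier transform of a Schwartz function K, and the Fourier transform
is self-adjoint for the bilinear pairing: ∫ g f = ∫ K · (transform of f) = 0 for every such g. -/
theorem ae_eq_zero_of_fourier_eq_zero {f : ℝ → ℂ} (hf : Integrable f)
    (h : ∀ t : ℝ, ∫ u : ℝ, Complex.exp (-(2 * Real.pi * t * u : ℝ) * Complex.I) * f u = 0) :
    f =ᵐ[volume] 0 := by
  have hF : FourierTransform.fourier f = (0 : ℝ → ℂ) := by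
    funext t
    rw [Real.fourier_real_eq_integral_exp_smul]
    rw [Pi.zero_apply, ← h t]
    congr 1; funext u
    rw [smul_eq_mul]
    congr 2
    push_cast; ring
  refine ae_eq_zero_of_integral_contDiff_smul_eq_zero hf.locallyIntegrable fun g hg hgs => ?_
  let G : SchwartzMap ℝ ℂ := HasCompactSupport.toSchwartzMap (f := fun x => (g x : ℂ))
    (hgs.comp_left (g := fun r : ℝ => (r : ℂ)) Complex.ofReal_zero)
    (Complex.ofRealCLM.contDiff.comp hg)
  have hG : ∀ x, G x = (g x : ℂ) := fun x => rfl
  let K : SchwartzMap ℝ ℂ := FourierTransformInv.fourierInv G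
  have hK : FourierTransform.fourier K = G := FourierTransform.fourier_fourierInv_eq G
  have key := VectorFourier.integral_fourierIntegral_smul_eq_flip (L := innerₗ ℝ)
      (μ := volume) (ν := volume) (f := (K : ℝ → ℂ)) (g := f)
      Real.continuous_fourierChar continuous_inner K.integrable hf
  have h1 : ∀ x, VectorFourier.fourierIntegral Real.fourierChar volume (innerₗ ℝ) (K : ℝ → ℂ) x
      = (g x : ℂ) := by
    intro x
    rw [← hG, ← hK]
    rfl
  have h2 : ∀ x, VectorFourier.fourierIntegral Real.fourierChar volume (innerₗ ℝ).flip f x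
      = 0 := by
    intro x
    have : VectorFourier.fourierIntegral Real.fourierChar volume (innerₗ ℝ).flip f x
      = FourierTransform.fourier f x := by
      rw [Real.fourier_eq]
      simp only [VectorFourier.fourierIntegral, LinearMap.flip_apply, innerₗ_apply_apply]
      congr 1; funext v; rw [real_inner_comm]
    rw [this, hF]; rfl
  simp only [h1, h2] at key
  simpa using key

/-- The Laplace transform of a function on `[0, ∞)`. -/
def laplace (f : ℝ → ℂ) (z : ℂ) : ℂ := ∫ u in Ioi (0 : ℝ), Complex.exp (-u * z) * f u

theorem eq_zero_of_ae_eq_zero_of_rightContinuous {f : ℝ → ℂ}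
    (hc : ∀ u, 0 ≤ u → ContinuousWithinAt f (Ici u) u)
    (h : ∀ᵐ u ∂volume.restrict (Ioi (0 : ℝ)), f u = 0) (u : ℝ) (hu : 0 ≤ u) : f u = 0 := by
  by_contra hne
  have h1 : ∀ᶠ v in 𝓝[≥] u, f v ≠ 0 := (hc u hu).eventually_ne hne
  obtain ⟨w, hw, hsub⟩ := (mem_nhdsGE_iff_exists_Ico_subset).1 h1
  have hw' : u < w := hw
  have h2 : volume (Ioo u w) = 0 := by
    rw [ae_restrict_iff' measurableSet_Ioi] at h
    refine measure_mono_null (fun v hv => ?_) (ae_iff.1 h)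
    simp only [mem_ofPred_eq, Classical.not_imp]
    exact ⟨lt_of_le_of_lt hu hv.1, hsub ⟨hv.1.le, hv.2⟩⟩
  rw [Real.volume_Ioo, ENNReal.ofReal_eq_zero] at h2
  linarith

/-- A single vertical line is enough: at z = σ + 2πit the Laplace transform of f - g is the Fourier
transform of e^{-σu}(f - g). Right-continuity upgrades almost everywhere equality to equality. -/
theorem eq_of_laplace_eq {f g : ℝ → ℂ} {σ : ℝ}
    (hf0 : ∀ u < 0, f u = 0) (hg0 : ∀ u < 0, g u = 0)
    (hfc : ∀ u, 0 ≤ u → ContinuousWithinAt f (Ici u) u)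
    (hgc : ∀ u, 0 ≤ u → ContinuousWithinAt g (Ici u) u)
    (hfi : ∀ z : ℂ, z.re = σ → IntegrableOn (fun u : ℝ => Complex.exp (-u * z) * f u) (Ioi 0))
    (hgi : ∀ z : ℂ, z.re = σ → IntegrableOn (fun u : ℝ => Complex.exp (-u * z) * g u) (Ioi 0))
    (h : ∀ z : ℂ, z.re = σ → laplace f z = laplace g z) : f = g := by
  let D : ℝ → ℂ := (Ioi (0 : ℝ)).indicator fun u => Complex.exp (-u * σ) * (f u - g u)
  have hD : Integrable D := by
    rw [integrable_indicator_iff measurableSet_Ioi]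
    refine ((hfi σ (by simp)).sub (hgi σ (by simp))).congr (ae_of_all _ fun u => ?_)
    simp only [Pi.sub_apply]; ring
  have hz : D =ᵐ[volume] 0 := by
    refine ae_eq_zero_of_fourier_eq_zero hD fun t => ?_
    have hre : ((σ : ℂ) + 2 * Real.pi * t * Complex.I).re = σ := by simp
    have := h (σ + 2 * Real.pi * t * Complex.I) hre
    rw [laplace, laplace, ← sub_eq_zero, ← integral_sub (hfi _ hre) (hgi _ hre)] at this
    rw [← this, ← integral_indicator measurableSet_Ioi]
    congr 1; funext u
    by_cases hu : u ∈ Ioi (0 : ℝ)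
    · simp only [D, indicator_of_mem hu]
      rw [← mul_assoc, ← Complex.exp_add, ← mul_sub]
      congr 2; push_cast; ring
    · simp only [D, indicator_of_notMem hu, mul_zero]
  have hae : ∀ᵐ u ∂volume.restrict (Ioi (0 : ℝ)), (f - g) u = 0 := by
    rw [ae_restrict_iff' measurableSet_Ioi]
    filter_upwards [hz] with u hu hu0
    simp only [D, indicator_of_mem hu0, Pi.zero_apply, mul_eq_zero, Complex.exp_ne_zero,
      false_or] at hu
    exact hu
  funext u
  rcases lt_or_ge u 0 with hu | hu
  · rw [hf0 u hu, hg0 u hu]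
  · exact sub_eq_zero.1 (eq_zero_of_ae_eq_zero_of_rightContinuous
      (fun u hu => (hfc u hu).sub (hgc u hu)) hae u hu)

/-! ### A class of functions closed under superpositions of delays -/

/-- Right-continuous functions that vanish on the negative half-line and grow at most like
`exp (σ u)` for each `σ > c`. -/
structure LaplaceClass (f : ℝ → ℂ) (c : ℝ) : Prop where
  measurable : Measurable f
  eq_zero : ∀ u < 0, f u = 0
  rightContinuous : ∀ u, ContinuousWithinAt f (Ici u) u
  bound : ∀ σ, c < σ → ∃ C, ∀ u, ‖f u‖ ≤ C * Real.exp (σ * u)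

theorem rightContinuous_of_nonneg {f : ℝ → ℂ} (h0 : ∀ u < 0, f u = 0)
    (h : ∀ u, 0 ≤ u → ContinuousWithinAt f (Ici u) u) (u : ℝ) :
    ContinuousWithinAt f (Ici u) u := by
  rcases lt_or_ge u 0 with hu | hu
  · have : f =ᶠ[𝓝 u] fun _ => 0 := by
      filter_upwards [Iio_mem_nhds hu] with v hv using h0 v hv
    exact (continuousAt_const.congr this.symm).continuousWithinAt
  · exact h u hu

theorem norm_cexp_neg_mul (u : ℝ) (z : ℂ) : ‖Complex.exp (-u * z)‖ = Real.exp (-(u * z.re)) := by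
  rw [Complex.norm_exp]; simp

namespace LaplaceClass

variable {f g : ℝ → ℂ} {c c' : ℝ}

theorem mono (hf : LaplaceClass f c) (h : c ≤ c') : LaplaceClass f c' :=
  ⟨hf.measurable, hf.eq_zero, hf.rightContinuous, fun σ hσ => hf.bound σ (h.trans_lt hσ)⟩

theorem add (hf : LaplaceClass f c) (hg : LaplaceClass g c) :
    LaplaceClass (fun u => f u + g u) c where
  measurable := hf.measurable.add hg.measurable
  eq_zero u hu := by rw [hf.eq_zero u hu, hg.eq_zero u hu, add_zero]
  rightContinuous u := (hf.rightContinuous u).add (hg.rightContinuous u)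
  bound σ hσ := by
    obtain ⟨C, hC⟩ := hf.bound σ hσ
    obtain ⟨D, hD⟩ := hg.bound σ hσ
    refine ⟨C + D, fun u => (norm_add_le _ _).trans ?_⟩
    rw [add_mul]; exact add_le_add (hC u) (hD u)

theorem const_mul (hf : LaplaceClass f c) (a : ℂ) : LaplaceClass (fun u => a * f u) c where
  measurable := hf.measurable.const_mul a
  eq_zero u hu := by rw [hf.eq_zero u hu, mul_zero]
  rightContinuous u := (hf.rightContinuous u).const_mul a
  bound σ hσ := by
    obtain ⟨C, hC⟩ := hf.bound σ hσ
    refine ⟨‖a‖ * C, fun u => ?_⟩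
    rw [norm_mul, mul_assoc]
    exact mul_le_mul_of_nonneg_left (hC u) (norm_nonneg _)

theorem integrableOn (hf : LaplaceClass f c) {z : ℂ} (hz : c < z.re) :
    IntegrableOn (fun u : ℝ => Complex.exp (-u * z) * f u) (Ioi 0) := by
  obtain ⟨σ, h1, h2⟩ := exists_between hz
  obtain ⟨C, hC⟩ := hf.bound σ h1
  have hg : IntegrableOn (fun u : ℝ => C * Real.exp (-(z.re - σ) * u)) (Ioi 0) :=
    (integrableOn_exp_mul_Ioi (by linarith) 0).const_mul C
  refine Integrable.mono' hg ?_ (ae_of_all _ fun u => ?_)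
  · exact (Measurable.mul (by fun_prop) hf.measurable).aestronglyMeasurable
  · rw [norm_mul, norm_cexp_neg_mul]
    calc Real.exp (-(u * z.re)) * ‖f u‖ ≤ Real.exp (-(u * z.re)) * (C * Real.exp (σ * u)) :=
          mul_le_mul_of_nonneg_left (hC u) (Real.exp_pos _).le
      _ = C * Real.exp (-(z.re - σ) * u) := by
          rw [mul_left_comm, ← Real.exp_add]; congr 2; ring

theorem laplace_add (hf : LaplaceClass f c) (hg : LaplaceClass g c) {z : ℂ} (hz : c < z.re) :
    laplace (fun u => f u + g u) z = laplace f z + laplace g z := by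
  rw [laplace, laplace, laplace, ← integral_add (hf.integrableOn hz) (hg.integrableOn hz)]
  simp only [mul_add]

theorem eq_of_laplace (hf : LaplaceClass f c) (hg : LaplaceClass g c)
    (h : ∀ z : ℂ, c < z.re → laplace f z = laplace g z) : f = g :=
  eq_of_laplace_eq (σ := c + 1) hf.eq_zero hg.eq_zero (fun u _ => hf.rightContinuous u)
    (fun u _ => hg.rightContinuous u) (fun z hz => hf.integrableOn (by linarith))
    (fun z hz => hg.integrableOn (by linarith)) (fun z hz => h z (by linarith))

end LaplaceClass

theorem laplace_const_mul (f : ℝ → ℂ) (a z : ℂ) :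
    laplace (fun u => a * f u) z = a * laplace f z := by
  rw [laplace, laplace, ← integral_const_mul]
  congr 1; funext u; ring

theorem laplace_delay {f : ℝ → ℂ} (hf : ∀ u < 0, f u = 0) {d : ℝ} (hd : 0 ≤ d) (z : ℂ) :
    laplace (fun u => f (u - d)) z = Complex.exp (-d * z) * laplace f z := by
  rw [laplace, laplace, ← integral_const_mul]
  have h1 : ∫ u in Ioi (0 : ℝ), Complex.exp (-u * z) * f (u - d)
      = ∫ u in Ioi d, Complex.exp (-u * z) * f (u - d) := by
    have : ∫ u in Ici d, Complex.exp (-u * z) * f (u - d)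
        = ∫ u in Ioi d, Complex.exp (-u * z) * f (u - d) := integral_Ici_eq_integral_Ioi
    rw [← this]
    rcases hd.eq_or_lt with rfl | hd
    · exact integral_Ici_eq_integral_Ioi.symm
    refine setIntegral_eq_of_subset_of_forall_sdiff_eq_zero measurableSet_Ioi
      (fun u hu => lt_of_lt_of_le hd hu) (fun u hu => ?_)
    rw [hf (u - d) (by have := hu.2; simp at this; linarith), mul_zero]
  rw [h1]
  have h3 : ∫ u in Ioi d, Complex.exp (-u * z) * f (u - d)
      = ∫ u in Ioi (0 : ℝ), Complex.exp (-((u + d : ℝ) : ℂ) * z) * f (u + d - d) := by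
    rw [← integral_indicator measurableSet_Ioi, ← integral_indicator measurableSet_Ioi,
      ← integral_add_right_eq_self _ d]
    congr 1; funext u
    by_cases hu : 0 < u
    · rw [indicator_of_mem (by simpa using hu), indicator_of_mem (by simpa using hu)]
    · rw [indicator_of_notMem (by simpa using hu), indicator_of_notMem (by simpa using hu)]
  rw [h3]
  congr 1; funext u
  rw [← mul_assoc, ← Complex.exp_add, add_sub_cancel_right]
  congr 2; push_cast; ring

section Mixture

variable {X : Type*} [MeasurableSpace X] {μ : Measure X} {d : X → ℝ} {w : X → ℂ}
  {f : ℝ → ℂ} {c c' : ℝ}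

theorem norm_mixture_le {C σ : ℝ} (hC : ∀ u, ‖f u‖ ≤ C * Real.exp (σ * u))
    (hint : Integrable (fun x => Real.exp (-(d x * σ)) * ‖w x‖) μ) (u : ℝ) :
    ‖∫ x, w x * f (u - d x) ∂μ‖ ≤
      C * (∫ x, Real.exp (-(d x * σ)) * ‖w x‖ ∂μ) * Real.exp (σ * u) := by
  rw [mul_right_comm, ← integral_const_mul]
  refine norm_integral_le_of_norm_le (hint.const_mul _) (ae_of_all _ fun x => ?_)
  rw [norm_mul]
  calc ‖w x‖ * ‖f (u - d x)‖ ≤ ‖w x‖ * (C * Real.exp (σ * (u - d x))) :=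
        mul_le_mul_of_nonneg_left (hC _) (norm_nonneg _)
    _ = C * Real.exp (σ * u) * (Real.exp (-(d x * σ)) * ‖w x‖) := by
        rw [show σ * (u - d x) = σ * u + -(d x * σ) by ring, Real.exp_add]; ring

variable [SFinite μ]

/-- Delays are nonnegative, so the superposition still vanishes on the negative half-line; the
discounted mass of the weights controls its growth and dominates the integrand locally, which gives
right-continuity. -/
theorem LaplaceClass.mixture (hf : LaplaceClass f c) (hd : Measurable d) (hw : Measurable w)
    (hd0 : ∀ᵐ x ∂μ, 0 ≤ d x) (hcc : c ≤ c')
    (hint : ∀ σ, c' < σ → Integrable (fun x => Real.exp (-(d x * σ)) * ‖w x‖) μ) :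
    LaplaceClass (fun u => ∫ x, w x * f (u - d x) ∂μ) c' where
  measurable := by
    have : StronglyMeasurable fun q : ℝ × X => w q.2 * f (q.1 - d q.2) :=
      ((hw.comp measurable_snd).mul (hf.measurable.comp
        (measurable_fst.sub (hd.comp measurable_snd)))).stronglyMeasurable
    exact (this.integral_prod_right').measurable
  eq_zero u hu := by
    refine integral_eq_zero_of_ae ?_
    filter_upwards [hd0] with x hx
    rw [hf.eq_zero _ (by linarith), mul_zero]; rfl
  rightContinuous u := by
    obtain ⟨C, hC⟩ := hf.bound (c' + 1) (by linarith)
    have hC0 : 0 ≤ C := by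
      have := (norm_nonneg _).trans (hC 0); simpa using this
    refine continuousWithinAt_of_dominated
      (bound := fun x => C * Real.exp (|c' + 1| * (|u| + 1)) *
        (Real.exp (-(d x * (c' + 1))) * ‖w x‖)) ?_ ?_ ?_ ?_
    · exact Eventually.of_forall fun v => (hw.mul (hf.measurable.comp
        (measurable_const.sub hd))).aestronglyMeasurable
    · have : ∀ᶠ v in 𝓝[≥] u, v < u + 1 :=
        eventually_nhdsWithin_of_eventually_nhds (Iio_mem_nhds (by linarith))
      filter_upwards [this, self_mem_nhdsWithin] with v hv hv'
      refine ae_of_all _ fun x => ?_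
      have hv' : u ≤ v := hv'
      have hva : |v| ≤ |u| + 1 := by
        rw [abs_le]; constructor <;> cases abs_cases u <;> linarith
      rw [norm_mul]
      calc ‖w x‖ * ‖f (v - d x)‖ ≤ ‖w x‖ * (C * Real.exp ((c' + 1) * (v - d x))) :=
            mul_le_mul_of_nonneg_left (hC _) (norm_nonneg _)
        _ = C * Real.exp ((c' + 1) * v) * (Real.exp (-(d x * (c' + 1))) * ‖w x‖) := by
            rw [show (c' + 1) * (v - d x) = (c' + 1) * v + -(d x * (c' + 1)) by ring,
              Real.exp_add]
            ring
        _ ≤ _ := by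
            have : (c' + 1) * v ≤ |c' + 1| * (|u| + 1) := by
              calc (c' + 1) * v ≤ |(c' + 1) * v| := le_abs_self _
                _ = |c' + 1| * |v| := abs_mul _ _
                _ ≤ _ := mul_le_mul_of_nonneg_left hva (abs_nonneg _)
            gcongr
    · exact (hint _ (by linarith)).const_mul _
    · refine ae_of_all _ fun x => ?_
      refine ContinuousWithinAt.mul continuousWithinAt_const ?_
      refine (hf.rightContinuous (u - d x)).comp (t := Ici (u - d x))
        (by fun_prop) fun v hv => ?_
      exact sub_le_sub_right (show u ≤ v from hv) _
  bound σ hσ := by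
    obtain ⟨C, hC⟩ := hf.bound σ (hcc.trans_lt hσ)
    exact ⟨_, norm_mixture_le hC (hint σ hσ)⟩

/-- By Fubini, since each delay d multiplies the transform by e^{-dz}. Every convolution with a
kernel on ℝ or ℝ² below is an instance. -/
theorem LaplaceClass.laplace_mixture (hf : LaplaceClass f c) (hd : Measurable d)
    (hw : Measurable w) (hd0 : ∀ᵐ x ∂μ, 0 ≤ d x) (hcc : c ≤ c')
    (hint : ∀ σ, c' < σ → Integrable (fun x => Real.exp (-(d x * σ)) * ‖w x‖) μ)
    {z : ℂ} (hz : c' < z.re) :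
    laplace (fun u => ∫ x, w x * f (u - d x) ∂μ) z =
      laplace f z * ∫ x, w x * Complex.exp (-d x * z) ∂μ := by
  obtain ⟨σ, h1, h2⟩ := exists_between hz
  obtain ⟨C, hC⟩ := hf.bound σ (hcc.trans_lt h1)
  have hI : Integrable (Function.uncurry fun (u : ℝ) (x : X) =>
      Complex.exp (-u * z) * (w x * f (u - d x))) ((volume.restrict (Ioi 0)).prod μ) := by
    have hg : IntegrableOn (fun u : ℝ => C * Real.exp (-(z.re - σ) * u)) (Ioi 0) :=
      (integrableOn_exp_mul_Ioi (by linarith) 0).const_mul C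
    refine Integrable.mono' (Integrable.mul_prod hg (hint σ h1)) ?_ (ae_of_all _ ?_)
    · refine Measurable.aestronglyMeasurable ?_
      refine Measurable.mul (by fun_prop) ((hw.comp measurable_snd).mul (hf.measurable.comp
        (measurable_fst.sub (hd.comp measurable_snd))))
    · rintro ⟨u, x⟩
      simp only [Function.uncurry]
      rw [norm_mul, norm_mul, norm_cexp_neg_mul]
      calc Real.exp (-(u * z.re)) * (‖w x‖ * ‖f (u - d x)‖)
          ≤ Real.exp (-(u * z.re)) * (‖w x‖ * (C * Real.exp (σ * (u - d x)))) := by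
            gcongr; exact hC _
        _ = C * Real.exp (-(z.re - σ) * u) * (Real.exp (-(d x * σ)) * ‖w x‖) := by
            rw [show -(z.re - σ) * u = -(u * z.re) + σ * u by ring,
              show σ * (u - d x) = σ * u + -(d x * σ) by ring, Real.exp_add, Real.exp_add]
            ring
  rw [laplace]
  simp_rw [← integral_const_mul]
  rw [integral_integral_swap hI]
  refine integral_congr_ae ?_
  filter_upwards [hd0] with x hx
  have := laplace_delay hf.eq_zero hx z
  rw [laplace] at this
  calc ∫ u in Ioi (0 : ℝ), Complex.exp (-u * z) * (w x * f (u - d x))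
      = ∫ u in Ioi (0 : ℝ), w x * (Complex.exp (-u * z) * f (u - d x)) := by
        congr 1; funext u; ring
    _ = _ := by rw [integral_const_mul, this]; ring

end Mixture

/-! ### The Laplace exponent, its largest root, and split jumps -/

namespace CompoundPoisson

variable (p : CompoundPoisson) {s : ℝ}

instance : IsProbabilityMeasure p.jumpLaw := p.isProbabilityMeasure_jumpLaw

theorem ae_jump_pos : ∀ᵐ u ∂p.jumpLaw, 0 < u := by
  rw [ae_iff]; simpa [Iic] using p.jumpLaw_nonpos

/-- The Laplace transform of the jump law. -/
def phi (z : ℂ) : ℂ := ∫ u : ℝ, Complex.exp (-u * z) ∂p.jumpLaw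

theorem integrable_cexp_jump {z : ℂ} (hz : 0 ≤ z.re) :
    Integrable (fun u : ℝ => Complex.exp (-u * z)) p.jumpLaw := by
  refine Integrable.of_bound (C := 1) (by fun_prop) ?_
  filter_upwards [p.ae_jump_pos] with u hu
  rw [norm_cexp_neg_mul, Real.exp_le_one_iff]
  nlinarith [mul_nonneg hu.le hz]

theorem k_eq {z : ℂ} (hz : 0 ≤ z.re) : p.k z = p.a * z + p.rate * (p.phi z - 1) := by
  rw [k, phi, integral_sub (p.integrable_cexp_jump hz) (integrable_const _)]
  simp

/-- The restriction of the Laplace exponent to the real line. -/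
def psi (σ : ℝ) : ℝ := p.a * σ + p.rate * ((∫ u : ℝ, Real.exp (-u * σ) ∂p.jumpLaw) - 1)

theorem phi_ofReal (σ : ℝ) : p.phi σ = (∫ u : ℝ, Real.exp (-u * σ) ∂p.jumpLaw : ℝ) := by
  rw [phi, ← integral_complex_ofReal]; congr 1; funext u; push_cast; rfl

theorem k_ofReal {σ : ℝ} (hσ : 0 ≤ σ) : p.k σ = (p.psi σ : ℝ) := by
  rw [k_eq _ (by simpa using hσ), phi_ofReal, psi]; push_cast; rfl

theorem k_zero : p.k 0 = 0 := by simp [k]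

theorem continuousOn_psi : ContinuousOn p.psi (Ici 0) := by
  refine (continuousOn_const.mul continuousOn_id).add (continuousOn_const.mul
    (ContinuousOn.sub ?_ continuousOn_const))
  refine continuousOn_of_dominated (bound := fun _ => 1) (fun σ hσ => by fun_prop) ?_
    (integrable_const _) (ae_of_all _ fun u => by fun_prop)
  intro σ hσ
  filter_upwards [p.ae_jump_pos] with u hu
  rw [Real.norm_eq_abs, Real.abs_exp, Real.exp_le_one_iff]
  nlinarith [mul_nonneg hu.le (show (0 : ℝ) ≤ σ from hσ)]

theorem le_psi (σ : ℝ) : p.a * σ - p.rate ≤ p.psi σ := by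
  have : 0 ≤ ∫ u : ℝ, Real.exp (-u * σ) ∂p.jumpLaw :=
    integral_nonneg fun u => (Real.exp_pos _).le
  rw [psi]; nlinarith [p.rate_pos]

theorem psi_zero : p.psi 0 = 0 := by simp [psi]

theorem lt_psi_of_gt {σ : ℝ} (h : (s + p.rate) / p.a < σ) : s < p.psi σ := by
  have := p.le_psi σ
  rw [div_lt_iff₀ p.a_pos] at h
  nlinarith

theorem c_set_eq : {r : ℝ | 0 ≤ r ∧ p.k r = s} = {r : ℝ | 0 ≤ r ∧ p.psi r = s} := by
  ext r
  simp only [mem_ofPred_eq, and_congr_right_iff]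
  intro hr
  rw [p.k_ofReal hr]; exact Complex.ofReal_inj

theorem bddAbove_c_set : BddAbove {r : ℝ | 0 ≤ r ∧ p.psi r = s} := by
  refine ⟨(s + p.rate) / p.a, fun r hr => ?_⟩
  by_contra h
  exact (p.lt_psi_of_gt (not_le.1 h)).ne' hr.2

theorem exists_root {σ : ℝ} (h0 : 0 ≤ σ) (hσ : p.psi σ ≤ s) : ∃ r, σ ≤ r ∧ p.psi r = s := by
  let m := max σ ((s + p.rate) / p.a + 1)
  have hm : s < p.psi m := p.lt_psi_of_gt (lt_of_lt_of_le (by linarith) (le_max_right _ _))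
  have hc : ContinuousOn p.psi (Icc σ m) :=
    p.continuousOn_psi.mono fun x hx => h0.trans hx.1
  obtain ⟨r, hr, hrs⟩ := intermediate_value_Icc (le_max_left _ _) hc ⟨hσ, hm.le⟩
  exact ⟨r, hr.1, hrs⟩

/-- The set of roots is closed by continuity, bounded since ψ(σ) ≥ aσ - λ, and nonempty since ψ(0) =
0 ≤ s; hence its supremum is a root. -/
theorem c_mem (hs : 0 ≤ s) : 0 ≤ p.c s ∧ p.psi (p.c s) = s := by
  have hcl : IsClosed {r : ℝ | 0 ≤ r ∧ p.psi r = s} := by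
    have := p.continuousOn_psi.preimage_isClosed_of_isClosed isClosed_Ici
      (isClosed_singleton (x := s))
    exact this
  obtain ⟨r, hr, hrs⟩ := p.exists_root le_rfl (s := s) (by rw [psi_zero]; exact hs)
  have := hcl.csSup_mem ⟨r, hr, hrs⟩ p.bddAbove_c_set
  rw [c, c_set_eq]; exact this

theorem c_nonneg (hs : 0 ≤ s) : 0 ≤ p.c s := (p.c_mem hs).1

theorem psi_c (hs : 0 ≤ s) : p.psi (p.c s) = s := (p.c_mem hs).2

/-- Otherwise the intermediate value theorem would give a root beyond the largest one. Convexity is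
not needed. -/
theorem lt_psi (hs : 0 ≤ s) {σ : ℝ} (hσ : p.c s < σ) : s < p.psi σ := by
  by_contra h
  have h0 := (p.c_nonneg hs).trans hσ.le
  obtain ⟨r, hr, hrs⟩ := p.exists_root h0 (not_lt.1 h)
  have : r ≤ p.c s := by
    rw [c, c_set_eq]; exact le_csSup p.bddAbove_c_set ⟨h0.trans hr, hrs⟩
  linarith

/-- The rate at which the discounted process leaves a point, relative to its speed. -/
def kappa (s : ℝ) : ℝ := (p.rate + s) / p.a

theorem a_mul_kappa (s : ℝ) : p.a * p.kappa s = p.rate + s := by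
  rw [kappa, mul_div_cancel₀ _ p.a_pos.ne']

theorem kappa_pos (hs : 0 ≤ s) : 0 < p.kappa s :=
  div_pos (by linarith [p.rate_pos]) p.a_pos

/-- Places the half-plane Re z > κ, on which the renewal equation is transformed, inside the
half-plane of convergence of the resolvent. -/
theorem c_le_kappa (hs : 0 ≤ s) : p.c s ≤ p.kappa s := by
  by_contra h
  have := p.lt_psi_of_gt (s := s) (σ := p.c s) (by rw [kappa, add_comm] at h; exact not_le.1 h)
  exact this.ne' (p.psi_c hs)

/-- The law (up to normalization) of the split of a jump `j` into a part `v` and the rest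
`j - v > 0`: the measure `1_{0 < v < j} dv dF(j)`. -/
def splitMeasure : Measure (ℝ × ℝ) :=
  ((volume.restrict (Ioi (0 : ℝ))).prod p.jumpLaw).restrict {q | q.1 < q.2}

instance : SFinite p.splitMeasure := by unfold splitMeasure; infer_instance

theorem measurableSet_split : MeasurableSet {q : ℝ × ℝ | q.1 < q.2} :=
  measurableSet_lt measurable_fst measurable_snd

theorem ae_splitMeasure : ∀ᵐ q ∂p.splitMeasure, 0 < q.1 ∧ q.1 < q.2 := by
  rw [splitMeasure, ae_restrict_iff' measurableSet_split]
  have : ∀ᵐ q ∂((volume.restrict (Ioi (0 : ℝ))).prod p.jumpLaw), 0 < q.1 :=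
    Measure.quasiMeasurePreserving_fst.ae (ae_restrict_mem measurableSet_Ioi)
  filter_upwards [this] with q hq hq' using ⟨hq, hq'⟩

theorem integrable_split {ζ z : ℂ} (hζ : 0 < ζ.re) (hz : 0 ≤ z.re) :
    Integrable (fun q : ℝ × ℝ => Complex.exp (-q.1 * ζ) * Complex.exp (-(q.2 - q.1 : ℝ) * z))
      p.splitMeasure := by
  have h1 : Integrable (fun q : ℝ × ℝ => Real.exp (-ζ.re * q.1) * 1)
      ((volume.restrict (Ioi (0 : ℝ))).prod p.jumpLaw) :=
    Integrable.mul_prod (f := fun v : ℝ => Real.exp (-ζ.re * v)) (g := fun _ => (1 : ℝ))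
      (integrableOn_exp_mul_Ioi (by linarith) 0) (integrable_const _)
  refine Integrable.mono' h1.restrict (by fun_prop) ?_
  filter_upwards [p.ae_splitMeasure] with q hq
  rw [norm_mul, norm_cexp_neg_mul, norm_cexp_neg_mul, mul_one]
  have : Real.exp (-((q.2 - q.1) * z.re)) ≤ 1 := by
    rw [Real.exp_le_one_iff]; nlinarith [mul_nonneg (sub_nonneg.2 hq.2.le) hz]
  calc _ ≤ Real.exp (-(q.1 * ζ.re)) * 1 := by gcongr
    _ = _ := by rw [mul_one]; congr 1; ring

/-- For a fixed jump j the integral of e^{-vζ - (j-v)z} over 0 < v < j is (e^{-jz} - e^{-jζ})/(ζ -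
z). Difference quotients of the jump transform thus become transforms of positive kernels. -/
theorem integral_split {ζ z : ℂ} (hζ : 0 < ζ.re) (hz : 0 ≤ z.re) (hne : ζ ≠ z) :
    ∫ q : ℝ × ℝ, Complex.exp (-q.1 * ζ) * Complex.exp (-(q.2 - q.1 : ℝ) * z) ∂p.splitMeasure =
      (p.phi z - p.phi ζ) / (ζ - z) := by
  have hI := p.integrable_split hζ hz
  rw [splitMeasure] at hI ⊢
  rw [← IntegrableOn, ← integrable_indicator_iff measurableSet_split] at hI
  rw [← integral_indicator measurableSet_split, integral_prod_symm _ hI, phi, phi,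
    ← integral_sub (p.integrable_cexp_jump hz) (p.integrable_cexp_jump hζ.le),
    ← integral_div]
  refine integral_congr_ae ?_
  filter_upwards [p.ae_jump_pos] with j hj
  have hne' : z - ζ ≠ 0 := sub_ne_zero.2 hne.symm
  calc ∫ v in Ioi (0 : ℝ), ({q : ℝ × ℝ | q.1 < q.2}).indicator
        (fun q : ℝ × ℝ => Complex.exp (-q.1 * ζ) * Complex.exp (-(q.2 - q.1 : ℝ) * z)) (v, j)
      = ∫ v in Ioo 0 j, Complex.exp (-j * z) * Complex.exp ((z - ζ) * v) := by
        rw [← integral_indicator measurableSet_Ioi, ← integral_indicator measurableSet_Ioo]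
        congr 1; funext v
        by_cases h0 : 0 < v <;> by_cases h1 : v < j <;> simp [indicator, h0, h1]
        rw [← Complex.exp_add, ← Complex.exp_add]; congr 1; ring
    _ = ∫ v in (0 : ℝ)..j, Complex.exp (-j * z) * Complex.exp ((z - ζ) * v) := by
        rw [intervalIntegral.integral_of_le hj.le, integral_Ioc_eq_integral_Ioo]
    _ = (Complex.exp (-j * z) - Complex.exp (-j * ζ)) / (ζ - z) := by
        rw [intervalIntegral.integral_const_mul, integral_exp_mul_complex hne',
          Complex.ofReal_zero, mul_zero, Complex.exp_zero, mul_div_assoc', mul_sub,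
          ← Complex.exp_add, mul_one, ← neg_sub z ζ, div_neg, ← neg_div, neg_sub]
        congr 3; ring

end CompoundPoisson

/-! ### Series and exponential functions in the class -/

/-- Geometric decay in n, uniform up to the factor e^{σu}, allows dominated convergence for the
limit from the right. -/
theorem LaplaceClass.tsum {r : ℕ → ℝ → ℂ} {c : ℝ} (hr : ∀ n, LaplaceClass (r n) c)
    (hb : ∀ σ, c < σ → ∃ C q, 0 ≤ q ∧ q < 1 ∧ ∀ n u, ‖r n u‖ ≤ C * q ^ n * Real.exp (σ * u)) :
    LaplaceClass (fun u => ∑' n, r n u) c where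
  measurable := by
    obtain ⟨C, q, hq0, hq1, h⟩ := hb (c + 1) (by linarith)
    refine measurable_of_tendsto_metrizable
      (f := fun N u => ∑ n ∈ Finset.range N, r n u)
      (fun N => Finset.measurable_fun_sum _ fun n _ => (hr n).measurable) ?_
    rw [tendsto_pi_nhds]
    intro u
    refine HasSum.tendsto_sum_nat (Summable.hasSum ?_)
    refine Summable.of_norm_bounded (g := fun n => C * q ^ n * Real.exp ((c + 1) * u)) ?_
      (fun n => h n u)
    exact ((summable_geometric_of_lt_one hq0 hq1).mul_left C).mul_right _
  eq_zero u hu := by simp [(hr _).eq_zero u hu]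
  rightContinuous u := by
    obtain ⟨C, q, hq0, hq1, h⟩ := hb (c + 1) (by linarith)
    have hC0 : 0 ≤ C := by
      have := (norm_nonneg _).trans (h 0 0); simpa using this
    refine tendsto_tsum_of_dominated_convergence
      (bound := fun n => C * q ^ n * Real.exp (|c + 1| * (|u| + 1)))
      (((summable_geometric_of_lt_one hq0 hq1).mul_left C).mul_right _)
      (fun n => (hr n).rightContinuous u) ?_
    have : ∀ᶠ v in 𝓝[≥] u, v < u + 1 :=
      eventually_nhdsWithin_of_eventually_nhds (Iio_mem_nhds (by linarith))
    filter_upwards [this, self_mem_nhdsWithin] with v hv hv' n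
    have hv' : u ≤ v := hv'
    have hva : |v| ≤ |u| + 1 := by
      rw [abs_le]; constructor <;> cases abs_cases u <;> linarith
    refine (h n v).trans ?_
    have : (c + 1) * v ≤ |c + 1| * (|u| + 1) := by
      calc (c + 1) * v ≤ |(c + 1) * v| := le_abs_self _
        _ = |c + 1| * |v| := abs_mul _ _
        _ ≤ _ := mul_le_mul_of_nonneg_left hva (abs_nonneg _)
    gcongr
  bound σ hσ := by
    obtain ⟨C, q, hq0, hq1, h⟩ := hb σ hσ
    refine ⟨∑' n, C * q ^ n, fun u => ?_⟩
    rw [← tsum_mul_right]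
    exact tsum_of_norm_bounded
      (((summable_geometric_of_lt_one hq0 hq1).mul_left C).mul_right _).hasSum (fun n => h n u)

theorem LaplaceClass.laplace_tsum {r : ℕ → ℝ → ℂ} {c : ℝ} (hr : ∀ n, LaplaceClass (r n) c)
    (hb : ∀ σ, c < σ → ∃ C q, 0 ≤ q ∧ q < 1 ∧ ∀ n u, ‖r n u‖ ≤ C * q ^ n * Real.exp (σ * u))
    {z : ℂ} (hz : c < z.re) :
    laplace (fun u => ∑' n, r n u) z = ∑' n, laplace (r n) z := by
  obtain ⟨σ, h1, h2⟩ := exists_between hz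
  obtain ⟨C, q, hq0, hq1, h⟩ := hb σ h1
  have hgeo := (summable_geometric_of_lt_one hq0 hq1).mul_left C
  have hE : IntegrableOn (fun u : ℝ => Real.exp (-(z.re - σ) * u)) (Ioi 0) :=
    integrableOn_exp_mul_Ioi (by linarith) 0
  have hle : ∀ n (u : ℝ), ‖Complex.exp (-u * z) * r n u‖ ≤
      C * q ^ n * Real.exp (-(z.re - σ) * u) := fun n u => by
    rw [norm_mul, norm_cexp_neg_mul]
    calc Real.exp (-(u * z.re)) * ‖r n u‖
        ≤ Real.exp (-(u * z.re)) * (C * q ^ n * Real.exp (σ * u)) :=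
          mul_le_mul_of_nonneg_left (h n u) (Real.exp_pos _).le
      _ = _ := by rw [mul_left_comm, ← Real.exp_add]; congr 2; ring
  have := integral_tsum_of_summable_integral_norm (μ := volume.restrict (Ioi (0 : ℝ)))
    (F := fun n (u : ℝ) => Complex.exp (-u * z) * r n u) (fun n => (hr n).integrableOn hz) (by
      refine Summable.of_nonneg_of_le (fun n => integral_nonneg fun u => norm_nonneg _)
        (fun n => ?_) (hgeo.mul_right (∫ u in Ioi (0 : ℝ), Real.exp (-(z.re - σ) * u)))
      rw [← integral_const_mul]
      exact integral_mono ((hr n).integrableOn hz).norm (hE.const_mul _) (hle n))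
  simp only [laplace, ← tsum_mul_left]
  exact this.symm

/-- The exponential function `exp (z u)` on `[0, ∞)`, zero on the negative half-line. -/
def expStep (z : ℂ) : ℝ → ℂ := (Ici (0 : ℝ)).indicator fun u => Complex.exp (z * u)

theorem expStep_of_nonneg (z : ℂ) {u : ℝ} (hu : 0 ≤ u) : expStep z u = Complex.exp (z * u) :=
  indicator_of_mem hu _

theorem expStep_of_neg (z : ℂ) {u : ℝ} (hu : u < 0) : expStep z u = 0 :=
  indicator_of_notMem (by simpa using hu) _

theorem norm_expStep_le {z : ℂ} {σ : ℝ} (hσ : z.re ≤ σ) (u : ℝ) :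
    ‖expStep z u‖ ≤ Real.exp (σ * u) := by
  rcases lt_or_ge u 0 with hu | hu
  · rw [expStep_of_neg z hu, norm_zero]; exact (Real.exp_pos _).le
  · rw [expStep_of_nonneg z hu, Complex.norm_exp]
    have : (z * u).re = z.re * u := by simp
    rw [this]; gcongr

theorem laplaceClass_expStep (z : ℂ) : LaplaceClass (expStep z) z.re where
  measurable := Measurable.indicator (by fun_prop) measurableSet_Ici
  eq_zero u hu := expStep_of_neg z hu
  rightContinuous := rightContinuous_of_nonneg (fun u hu => expStep_of_neg z hu) fun u hu => by
    have : ContinuousWithinAt (fun v : ℝ => Complex.exp (z * v)) (Ici u) u := by fun_prop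
    exact this.congr (fun v hv => expStep_of_nonneg z (le_trans hu hv)) (expStep_of_nonneg z hu)
  bound σ hσ := ⟨1, fun u => by rw [one_mul]; exact norm_expStep_le hσ.le u⟩

theorem integral_cexp_neg_Ioi {z : ℂ} (hz : 0 < z.re) :
    ∫ u in Ioi (0 : ℝ), Complex.exp (-u * z) = 1 / z := by
  have h := integral_exp_mul_complex_Ioi (a := -z) (by simpa using hz) 0
  rw [show (fun u : ℝ => Complex.exp (-u * z)) = fun u : ℝ => Complex.exp (-z * u) from
    funext fun u => by congr 1; ring, h]
  simp

theorem laplace_expStep {z ζ : ℂ} (h : z.re < ζ.re) : laplace (expStep z) ζ = 1 / (ζ - z) := by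
  rw [← integral_cexp_neg_Ioi (z := ζ - z) (by simpa using h), laplace]
  refine setIntegral_congr_fun measurableSet_Ioi fun u hu => ?_
  rw [expStep_of_nonneg z (le_of_lt hu), ← Complex.exp_add]
  congr 1; ring

/-! ### Existence of the resolvent by a Neumann series -/

namespace CompoundPoisson

variable (p : CompoundPoisson) {s : ℝ}

/-- The weight of the ladder kernel of the process. -/
def ladderWeight (s : ℝ) (q : ℝ × ℝ) : ℝ :=
  p.rate / p.a * Real.exp (-((q.2 - q.1) * p.c s))

/-- The terms of the Neumann series for the resolvent. -/
def neumannTerm (s : ℝ) : ℕ → ℝ → ℂ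
  | 0 => fun u => (1 / p.a : ℝ) * expStep (p.c s) u
  | n + 1 => fun u => ∫ q, (p.ladderWeight s q : ℂ) * neumannTerm s n (u - q.1) ∂p.splitMeasure

/-- The Laplace transform of the ladder kernel. -/
def ladderTransform (s : ℝ) (z : ℂ) : ℂ :=
  p.rate / p.a * ((p.phi (p.c s) - p.phi z) / (z - p.c s))

theorem measurable_ladderWeight : Measurable fun q => (p.ladderWeight s q : ℂ) := by
  unfold ladderWeight; fun_prop

theorem ladderWeight_nonneg (q : ℝ × ℝ) : 0 ≤ p.ladderWeight s q :=
  mul_nonneg (div_nonneg p.rate_pos.le p.a_pos.le) (Real.exp_pos _).le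

theorem integral_ladderWeight (hs : 0 ≤ s) {z : ℂ} (hz : p.c s < z.re) :
    ∫ q, (p.ladderWeight s q : ℂ) * Complex.exp (-q.1 * z) ∂p.splitMeasure =
      p.ladderTransform s z := by
  have hne : z ≠ p.c s := by rintro rfl; simp at hz
  rw [ladderTransform, ← p.integral_split ((p.c_nonneg hs).trans_lt hz)
    (by simpa using p.c_nonneg hs) hne, ← integral_const_mul]
  congr 1; funext q
  rw [ladderWeight]; push_cast
  rw [show Complex.exp (-((q.2 - q.1 : ℂ) * p.c s)) = Complex.exp (-(q.2 - q.1 : ℂ) * p.c s) by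
    congr 1; ring]
  ring

theorem integrable_ladderWeight (hs : 0 ≤ s) {σ : ℝ} (hσ : p.c s < σ) :
    Integrable (fun q : ℝ × ℝ => Real.exp (-(q.1 * σ)) * ‖(p.ladderWeight s q : ℂ)‖)
      p.splitMeasure := by
  have h := ((p.integrable_split (ζ := σ) (z := p.c s)
    (by simpa using (p.c_nonneg hs).trans_lt hσ)
    (by simpa using p.c_nonneg hs)).norm).const_mul (p.rate / p.a)
  refine h.congr (ae_of_all _ fun q => ?_)
  simp only [norm_mul, norm_cexp_neg_mul, Complex.ofReal_re, Complex.norm_real]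
  rw [Real.norm_of_nonneg (p.ladderWeight_nonneg q), ladderWeight]
  ring

/-- Splits off the root c: with s = k(c), the difference k(z) - k(c) is a(z - c) + λ(φ(z) - φ(c)),
and the last term is -a(z - c) times the ladder transform. -/
theorem ladderTransform_eq (hs : 0 ≤ s) {z : ℂ} (hz : p.c s < z.re) :
    p.k z - s = p.a * (z - p.c s) * (1 - p.ladderTransform s z) := by
  have hne : z - p.c s ≠ 0 := sub_ne_zero.2 (by rintro rfl; simp at hz)
  have ha : (p.a : ℂ) ≠ 0 := by exact_mod_cast p.a_pos.ne'
  have h1 : (s : ℂ) = p.a * (p.c s) + p.rate * (p.phi (p.c s) - 1) := by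
    rw [← p.k_eq (z := p.c s) (by simpa using p.c_nonneg hs), p.k_ofReal (p.c_nonneg hs),
      p.psi_c hs]
  rw [p.k_eq ((p.c_nonneg hs).trans hz.le), h1, ladderTransform]
  field_simp
  ring

/-- The total mass of the ladder kernel, discounted at rate `σ`. -/
def ladderMass (s σ : ℝ) : ℝ :=
  ∫ q : ℝ × ℝ, Real.exp (-(q.1 * σ)) * ‖(p.ladderWeight s q : ℂ)‖ ∂p.splitMeasure

theorem ladderMass_nonneg (σ : ℝ) : 0 ≤ p.ladderMass s σ :=
  integral_nonneg fun _ => mul_nonneg (Real.exp_pos _).le (norm_nonneg _)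

theorem ladderMass_eq (hs : 0 ≤ s) {σ : ℝ} (hσ : p.c s < σ) :
    (p.ladderMass s σ : ℂ) = p.ladderTransform s σ := by
  rw [← p.integral_ladderWeight hs (by simpa using hσ), ladderMass, ← integral_complex_ofReal]
  congr 1; funext q
  rw [Complex.norm_real, Real.norm_of_nonneg (p.ladderWeight_nonneg q)]
  push_cast
  rw [mul_comm]; congr 2; ring

/-- On the real axis the factorization reads ψ(σ) - s = a(σ - c)(1 - mass), and the left-hand side
is positive for σ > c. -/
theorem ladderMass_lt_one (hs : 0 ≤ s) {σ : ℝ} (hσ : p.c s < σ) : p.ladderMass s σ < 1 := by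
  have h := p.ladderTransform_eq hs (z := σ) (by simpa using hσ)
  rw [← p.ladderMass_eq hs hσ, p.k_ofReal ((p.c_nonneg hs).trans hσ.le)] at h
  have h' : p.psi σ - s = p.a * (σ - p.c s) * (1 - p.ladderMass s σ) := by exact_mod_cast h
  have h1 := p.lt_psi hs hσ
  have h2 : 0 < p.a * (σ - p.c s) := mul_pos p.a_pos (by linarith)
  have h3 : 0 < p.a * (σ - p.c s) * (1 - p.ladderMass s σ) := by linarith
  have := (mul_pos_iff_of_pos_left h2).1 h3
  linarith

theorem norm_ladderTransform_lt_one (hs : 0 ≤ s) {z : ℂ} (hz : p.c s < z.re) :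
    ‖p.ladderTransform s z‖ < 1 := by
  refine lt_of_le_of_lt ?_ (p.ladderMass_lt_one hs hz)
  rw [← p.integral_ladderWeight hs hz, ladderMass]
  refine norm_integral_le_of_norm_le (p.integrable_ladderWeight hs hz) (ae_of_all _ fun q => ?_)
  rw [norm_mul, norm_cexp_neg_mul, mul_comm]

theorem k_sub_ne_zero (hs : 0 ≤ s) {z : ℂ} (hz : p.c s < z.re) : p.k z - s ≠ 0 := by
  rw [p.ladderTransform_eq hs hz]
  refine mul_ne_zero (mul_ne_zero (by exact_mod_cast p.a_pos.ne')
    (sub_ne_zero.2 (by rintro rfl; simp at hz))) (sub_ne_zero.2 fun h => ?_)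
  have := p.norm_ladderTransform_lt_one hs hz
  rw [← h, norm_one] at this
  exact lt_irrefl _ this

theorem laplaceClass_neumannTerm (hs : 0 ≤ s) (n : ℕ) :
    LaplaceClass (p.neumannTerm s n) (p.c s) := by
  induction n with
  | zero =>
    have := (laplaceClass_expStep (p.c s)).const_mul (1 / p.a : ℝ)
    rwa [Complex.ofReal_re] at this
  | succ n ih =>
    exact ih.mixture measurable_fst p.measurable_ladderWeight
      (p.ae_splitMeasure.mono fun q hq => hq.1.le) le_rfl fun σ hσ => p.integrable_ladderWeight hs hσ

theorem norm_neumannTerm_le (hs : 0 ≤ s) {σ : ℝ} (hσ : p.c s < σ) (n : ℕ) (u : ℝ) :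
    ‖p.neumannTerm s n u‖ ≤ 1 / p.a * p.ladderMass s σ ^ n * Real.exp (σ * u) := by
  induction n generalizing u with
  | zero =>
    rw [neumannTerm, norm_mul, pow_zero, mul_one, Complex.norm_real,
      Real.norm_of_nonneg (one_div_pos.2 p.a_pos).le]
    exact mul_le_mul_of_nonneg_left (norm_expStep_le (by simpa using hσ.le) u)
      (one_div_pos.2 p.a_pos).le
  | succ n ih =>
    rw [pow_succ, ← mul_assoc]
    exact norm_mixture_le ih (p.integrable_ladderWeight hs hσ) u

theorem laplace_neumannTerm (hs : 0 ≤ s) {z : ℂ} (hz : p.c s < z.re) (n : ℕ) :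
    laplace (p.neumannTerm s n) z =
      1 / (p.a * (z - p.c s)) * p.ladderTransform s z ^ n := by
  induction n with
  | zero =>
    rw [neumannTerm, laplace_const_mul, laplace_expStep (by simpa using hz), pow_zero, mul_one]
    push_cast; rw [one_div_mul_one_div]
  | succ n ih =>
    rw [neumannTerm, (p.laplaceClass_neumannTerm hs n).laplace_mixture measurable_fst
      p.measurable_ladderWeight (p.ae_splitMeasure.mono fun q hq => hq.1.le) le_rfl
      (fun σ hσ => p.integrable_ladderWeight hs hσ) hz, ih, p.integral_ladderWeight hs hz,
      pow_succ, mul_assoc]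

/-- The series is summed among complex functions, while the resolvent must be a real function. -/
theorem neumannTerm_real (n : ℕ) : ∃ g : ℝ → ℝ, ∀ u, p.neumannTerm s n u = g u := by
  induction n with
  | zero =>
    refine ⟨fun u => 1 / p.a * (Ici (0 : ℝ)).indicator (fun u => Real.exp (p.c s * u)) u,
      fun u => ?_⟩
    rw [neumannTerm, expStep]
    by_cases hu : u ∈ Ici (0 : ℝ) <;> simp [hu]
  | succ n ih =>
    obtain ⟨g, hg⟩ := ih
    refine ⟨fun u => ∫ q, p.ladderWeight s q * g (u - q.1) ∂p.splitMeasure, fun u => ?_⟩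
    rw [neumannTerm, ← integral_complex_ofReal]
    simp only [hg]; push_cast; rfl

theorem neumann_bound (hs : 0 ≤ s) (σ : ℝ) (hσ : p.c s < σ) :
    ∃ C q, 0 ≤ q ∧ q < 1 ∧ ∀ n u, ‖p.neumannTerm s n u‖ ≤ C * q ^ n * Real.exp (σ * u) :=
  ⟨1 / p.a, p.ladderMass s σ, p.ladderMass_nonneg σ, p.ladderMass_lt_one hs hσ,
    p.norm_neumannTerm_le hs hσ⟩

/-- The n-th term has transform L(z)^n / (a(z - c)), L being the ladder transform; the geometric
series sums to 1/(a(z - c)(1 - L(z))) = 1/(k(z) - s). -/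
theorem exists_resolvent (hs : 0 ≤ s) : ∃ R : ℝ → ℝ, LaplaceClass (fun u => (R u : ℂ)) (p.c s) ∧
    ∀ z : ℂ, p.c s < z.re → laplace (fun u => (R u : ℂ)) z = (p.k z - s)⁻¹ := by
  choose g hg using fun n => p.neumannTerm_real (s := s) n
  have hR : (fun u => ((∑' n, g n u : ℝ) : ℂ)) = fun u => ∑' n, p.neumannTerm s n u := by
    funext u; rw [Complex.ofReal_tsum]; simp only [hg]
  refine ⟨fun u => ∑' n, g n u, ?_, fun z hz => ?_⟩
  · rw [hR]
    exact LaplaceClass.tsum (p.laplaceClass_neumannTerm hs) (p.neumann_bound hs)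
  · rw [hR, LaplaceClass.laplace_tsum (p.laplaceClass_neumannTerm hs) (p.neumann_bound hs) hz]
    simp only [p.laplace_neumannTerm hs hz]
    rw [tsum_mul_left, tsum_geometric_of_norm_lt_one (p.norm_ladderTransform_lt_one hs hz),
      p.ladderTransform_eq hs hz, mul_inv, one_div]

end CompoundPoisson

/-! ### Identification of the resolvent by its transform -/

theorem LaplaceClass.hasLaplaceTransform {f : ℝ → ℝ} {c : ℝ} {L : ℂ → ℂ}
    (hf : LaplaceClass (fun u => (f u : ℂ)) c)
    (h : ∀ z : ℂ, c < z.re → laplace (fun u => (f u : ℂ)) z = L z) :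
    HasLaplaceTransform f c L where
  eq_zero u hu := by exact_mod_cast hf.eq_zero u hu
  rightContinuous u _ := by
    have := Complex.continuous_re.continuousAt.comp_continuousWithinAt (hf.rightContinuous u)
    exact this
  integrableOn z hz := hf.integrableOn hz
  integral_eq z hz := h z hz

theorem HasLaplaceTransform.unique {f g : ℝ → ℝ} {c : ℝ} {L : ℂ → ℂ}
    (hf : HasLaplaceTransform f c L) (hg : HasLaplaceTransform g c L) : f = g := by
  have hc {h : ℝ → ℝ} (hh : HasLaplaceTransform h c L) (u : ℝ) (hu : 0 ≤ u) :
      ContinuousWithinAt (fun u => (h u : ℂ)) (Ici u) u :=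
    Complex.continuous_ofReal.continuousAt.comp_continuousWithinAt (hh.rightContinuous u hu)
  have := eq_of_laplace_eq (f := fun u => (f u : ℂ)) (g := fun u => (g u : ℂ)) (σ := c + 1)
    (fun u hu => by rw [hf.eq_zero u hu, Complex.ofReal_zero])
    (fun u hu => by rw [hg.eq_zero u hu, Complex.ofReal_zero]) (hc hf) (hc hg)
    (fun z hz => hf.integrableOn z (by linarith)) (fun z hz => hg.integrableOn z (by linarith))
    (fun z hz => (hf.integral_eq z (by linarith)).trans (hg.integral_eq z (by linarith)).symm)
  funext u
  exact_mod_cast congrFun this u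

namespace CompoundPoisson

variable (p : CompoundPoisson) {s : ℝ}

theorem existsUnique_isResolvent (hs : 0 ≤ s) : ∃! R, IsResolvent p s R := by
  obtain ⟨R, hR, hL⟩ := p.exists_resolvent hs
  exact ⟨R, hR.hasLaplaceTransform hL, fun R' hR' => hR'.unique (hR.hasLaplaceTransform hL)⟩

theorem laplaceClass_scaleResolvent (hs : 0 ≤ s) :
    LaplaceClass (fun u => (scaleResolvent p s u : ℂ)) (p.c s) := by
  obtain ⟨R, hR, hL⟩ := p.exists_resolvent hs
  have h : IsResolvent p s (scaleResolvent p s) :=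
    Classical.epsilon_spec ⟨R, hR.hasLaplaceTransform hL⟩
  rwa [h.unique (hR.hasLaplaceTransform hL)]

theorem laplace_scaleResolvent (hs : 0 ≤ s) {z : ℂ} (hz : p.c s < z.re) :
    laplace (fun u => (scaleResolvent p s u : ℂ)) z = (p.k z - s)⁻¹ :=
  (Classical.epsilon_spec (p.existsUnique_isResolvent hs).exists).integral_eq z hz

end CompoundPoisson

namespace LaplaceClass

variable {f : ℝ → ℂ} {c : ℝ}

theorem bounded (hf : LaplaceClass f c) (Y : ℝ) : ∃ M, ∀ y ≤ Y, ‖f y‖ ≤ M := by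
  -- The exponent |c| + 1 exceeds c and is nonnegative, so the exponential bound is monotone in y.
  obtain ⟨C, hC⟩ := hf.bound (|c| + 1) (by linarith [le_abs_self c])
  have hC0 : 0 ≤ C := by have := (norm_nonneg _).trans (hC 0); simpa using this
  refine ⟨C * Real.exp ((|c| + 1) * Y), fun y hy => (hC y).trans ?_⟩
  have : (0 : ℝ) ≤ |c| + 1 := by positivity
  gcongr

theorem delay (hf : LaplaceClass f c) {d : ℝ} (hd : 0 ≤ d) :
    LaplaceClass (fun u => f (u - d)) c := by
  have := hf.mixture (μ := Measure.dirac ()) (d := fun _ => d) (w := fun _ => 1)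
    measurable_const measurable_const (ae_of_all _ fun _ => hd) le_rfl
    (fun σ _ => integrable_const _)
  simpa using this

end LaplaceClass

/-! ### Renewal equation of the resolvent and representations of C^y(z, s) -/

namespace CompoundPoisson

variable (p : CompoundPoisson) {s : ℝ}

/-- The resolvent as a complex-valued function. -/
def res (s : ℝ) (u : ℝ) : ℂ := (scaleResolvent p s u : ℂ)

theorem laplaceClass_res (hs : 0 ≤ s) : LaplaceClass (p.res s) (p.c s) :=
  p.laplaceClass_scaleResolvent hs

theorem laplace_res (hs : 0 ≤ s) {z : ℂ} (hz : p.c s < z.re) :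
    laplace (p.res s) z = (p.k z - s)⁻¹ :=
  p.laplace_scaleResolvent hs hz

/-- The product of Lebesgue measure on `(0, ∞)` and the jump law. -/
def clockMeasure : Measure (ℝ × ℝ) := (volume.restrict (Ioi (0 : ℝ))).prod p.jumpLaw

instance : SFinite p.clockMeasure := by unfold clockMeasure; infer_instance

theorem ae_clockMeasure : ∀ᵐ q ∂p.clockMeasure, 0 < q.1 ∧ 0 < q.2 := by
  have h1 : ∀ᵐ q ∂((volume.restrict (Ioi (0 : ℝ))).prod p.jumpLaw), 0 < q.1 :=
    Measure.quasiMeasurePreserving_fst.ae (ae_restrict_mem measurableSet_Ioi)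
  have h2 : ∀ᵐ q ∂((volume.restrict (Ioi (0 : ℝ))).prod p.jumpLaw), 0 < q.2 :=
    Measure.quasiMeasurePreserving_snd.ae p.ae_jump_pos
  exact h1.and h2

theorem integrable_clock {δ : ℝ} (hδ : 0 < δ) :
    Integrable (fun q : ℝ × ℝ => Real.exp (-δ * q.1)) p.clockMeasure := by
  have := Integrable.mul_prod (f := fun v : ℝ => Real.exp (-δ * v)) (g := fun _ : ℝ => (1 : ℝ))
      (μ := volume.restrict (Ioi (0 : ℝ))) (ν := p.jumpLaw)
      (integrableOn_exp_mul_Ioi (by linarith) 0) (integrable_const _)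
  simpa [clockMeasure] using this

/-- The jump rate per unit length, discounted at rate `κ`. -/
def clockWeight (s : ℝ) (q : ℝ × ℝ) : ℂ := p.rate / p.a * Complex.exp (p.kappa s * q.1)

theorem measurable_clockWeight : Measurable (p.clockWeight s) := by
  unfold clockWeight; fun_prop

theorem norm_clockWeight (q : ℝ × ℝ) :
    ‖p.clockWeight s q‖ = p.rate / p.a * Real.exp (p.kappa s * q.1) := by
  rw [clockWeight, norm_mul, norm_div, Complex.norm_real, Complex.norm_real, Complex.norm_exp,
    Real.norm_of_nonneg p.rate_pos.le, Real.norm_of_nonneg p.a_pos.le]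
  congr 2; simp

theorem integrable_clockWeight (hs : 0 ≤ s) {σ : ℝ} (hσ : p.kappa s < σ) :
    Integrable (fun q : ℝ × ℝ => Real.exp (-((q.1 + q.2) * σ)) * ‖p.clockWeight s q‖)
      p.clockMeasure := by
  have hσ0 := (p.kappa_pos hs).trans hσ
  have := (p.integrable_clock (δ := σ - p.kappa s) (by linarith)).const_mul (p.rate / p.a)
  refine this.mono' ((Measurable.mul (by fun_prop)
    p.measurable_clockWeight.norm).aestronglyMeasurable) ?_
  filter_upwards [p.ae_clockMeasure] with q hq
  rw [norm_mul, norm_norm, norm_clockWeight, Real.norm_of_nonneg (Real.exp_pos _).le,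
    mul_left_comm, ← Real.exp_add]
  have h0 := p.rate_pos
  have h1 := p.a_pos
  gcongr
  nlinarith [mul_pos hq.2 hσ0]

theorem integral_clockWeight {z : ℂ} (hz : p.kappa s < z.re) :
    ∫ q, p.clockWeight s q * Complex.exp (-(q.1 + q.2 : ℝ) * z) ∂p.clockMeasure =
      p.rate / p.a * p.phi z / (z - p.kappa s) := by
  have h := integral_prod_mul (μ := volume.restrict (Ioi (0 : ℝ))) (ν := p.jumpLaw)
    (fun t : ℝ => Complex.exp (-t * (z - p.kappa s))) (fun j : ℝ => Complex.exp (-j * z))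
  rw [integral_cexp_neg_Ioi (by simpa using hz)] at h
  rw [mul_div_assoc, div_eq_mul_one_div (p.phi z), mul_comm (p.phi z), phi, ← h,
    ← integral_const_mul, clockMeasure]
  congr 1; funext q
  rw [clockWeight, mul_assoc, ← Complex.exp_add, ← Complex.exp_add]
  congr 2; push_cast; ring

/-- The renewal equation of the resolvent. -/
theorem res_renewal (hs : 0 ≤ s) (u : ℝ) :
    p.res s u + ∫ q, p.clockWeight s q * p.res s (u - (q.1 + q.2)) ∂p.clockMeasure =
      1 / p.a * expStep (p.kappa s) u := by
  have hd : Measurable fun q : ℝ × ℝ => q.1 + q.2 := by fun_prop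
  have hd0 : ∀ᵐ q ∂p.clockMeasure, 0 ≤ q.1 + q.2 :=
    p.ae_clockMeasure.mono fun q hq => (add_pos hq.1 hq.2).le
  have hR := p.laplaceClass_res hs
  have hmix := hR.mixture hd p.measurable_clockWeight hd0 (p.c_le_kappa hs)
    (fun σ hσ => p.integrable_clockWeight hs hσ)
  have hE : LaplaceClass (fun u => 1 / (p.a : ℂ) * expStep (p.kappa s) u) (p.kappa s) := by
    have := (laplaceClass_expStep (p.kappa s)).const_mul (1 / p.a)
    rwa [Complex.ofReal_re] at this
  -- On transforms the equation is (k(z) - s)⁻¹ (1 + λφ(z)/(a(z - κ))) = 1/(a(z - κ)), which holds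
  -- because aκ = λ + s gives a(z - κ) + λφ(z) = k(z) - s.
  refine congrFun (((hR.mono (p.c_le_kappa hs)).add hmix).eq_of_laplace hE fun z hz => ?_) u
  rw [(hR.mono (p.c_le_kappa hs)).laplace_add hmix hz,
    hR.laplace_mixture hd p.measurable_clockWeight hd0 (p.c_le_kappa hs)
    (fun σ hσ => p.integrable_clockWeight hs hσ) hz, p.integral_clockWeight hz,
    laplace_const_mul, laplace_expStep (by simpa using hz),
    p.laplace_res hs ((p.c_le_kappa hs).trans_lt hz)]
  have hne := p.k_sub_ne_zero hs ((p.c_le_kappa hs).trans_lt hz)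
  have ha : (p.a : ℂ) ≠ 0 := by exact_mod_cast p.a_pos.ne'
  have hk : z - p.kappa s ≠ 0 := sub_ne_zero.2 (by rintro rfl; simp at hz)
  have hkap : (p.a : ℂ) * p.kappa s = p.rate + s := by exact_mod_cast p.a_mul_kappa s
  rw [p.k_eq ((p.kappa_pos hs).le.trans hz.le)] at hne ⊢
  field_simp
  linear_combination -hkap

theorem res_zero (hs : 0 ≤ s) : p.res s 0 = 1 / p.a := by
  have h := p.res_renewal hs 0
  rw [expStep_of_nonneg _ le_rfl] at h
  rw [integral_eq_zero_of_ae, add_zero] at h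
  · simpa using h
  · filter_upwards [p.ae_clockMeasure] with q hq
    rw [(p.laplaceClass_res hs).eq_zero _ (by linarith [hq.1, hq.2]), mul_zero]; rfl

theorem integrable_res_split (hs : 0 ≤ s) (y : ℝ) {z : ℂ} (hz : 0 ≤ z.re) :
    Integrable (fun q : ℝ × ℝ => p.res s (y - q.1) * Complex.exp (-(q.2 - q.1 : ℝ) * z))
      p.splitMeasure := by
  have hR := p.laplaceClass_res hs
  have hc := p.c_nonneg hs
  obtain ⟨C, hC⟩ := hR.bound (p.c s + 1) (by linarith)
  have h := (p.integrable_split (ζ := (p.c s + 1 : ℝ)) (z := z)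
    (by rw [Complex.ofReal_re]; linarith) hz).norm.const_mul (C * Real.exp ((p.c s + 1) * y))
  refine h.mono' ?_ (ae_of_all _ fun q => ?_)
  · exact ((hR.measurable.comp (by fun_prop)).mul (by fun_prop)).aestronglyMeasurable
  · rw [norm_mul, norm_mul, norm_cexp_neg_mul, norm_cexp_neg_mul, ← mul_assoc,
      Complex.ofReal_re, mul_assoc C, ← Real.exp_add]
    gcongr
    refine (hC _).trans (le_of_eq ?_)
    congr 2; ring

/-- The convolution of the resolvent with an exponential function. -/
def resConv (s : ℝ) (z : ℂ) (y : ℝ) : ℂ := ∫ t in Ioi (0 : ℝ), Complex.exp (t * z) * p.res s (y - t)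

/-- The identity that expresses `C^y(z, s)` through the resolvent and the jumps over zero. -/
theorem res_sub_split (hs : 0 ≤ s) {z : ℂ} (hz : 0 ≤ z.re) (y : ℝ) :
    p.a * p.res s y - p.rate * ∫ q : ℝ × ℝ, p.res s (y - q.1) *
      Complex.exp (-(q.2 - q.1 : ℝ) * z) ∂p.splitMeasure =
      expStep z y - (p.k z - s) * p.resConv s z y := by
  set c' := max (p.c s) z.re with hc'
  have hcc : p.c s ≤ c' := le_max_left _ _
  have hzc : z.re ≤ c' := le_max_right _ _
  have hR := p.laplaceClass_res hs
  have hw1 : Measurable fun q : ℝ × ℝ => Complex.exp (-(q.2 - q.1 : ℝ) * z) := by fun_prop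
  have hd1 : ∀ᵐ q ∂p.splitMeasure, 0 ≤ q.1 := p.ae_splitMeasure.mono fun q hq => hq.1.le
  have hi1 : ∀ σ, c' < σ → Integrable (fun q : ℝ × ℝ => Real.exp (-(q.1 * σ)) *
      ‖Complex.exp (-(q.2 - q.1 : ℝ) * z)‖) p.splitMeasure := fun σ hσ => by
    refine ((p.integrable_split (ζ := σ) (z := z) ?_ hz).norm).congr (ae_of_all _ fun q => ?_)
    · rw [Complex.ofReal_re]; linarith
    · simp only [norm_mul, norm_cexp_neg_mul, Complex.ofReal_re]
  have hw2 : Measurable fun t : ℝ => Complex.exp (t * z) := by fun_prop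
  have hd2 : ∀ᵐ t ∂volume.restrict (Ioi (0 : ℝ)), 0 ≤ t :=
    (ae_restrict_mem measurableSet_Ioi).mono fun t ht => le_of_lt ht
  have hi2 : ∀ σ, c' < σ → Integrable (fun t : ℝ => Real.exp (-(t * σ)) *
      ‖Complex.exp (t * z)‖) (volume.restrict (Ioi (0 : ℝ))) := fun σ hσ => by
    have : IntegrableOn (fun t : ℝ => Real.exp (-(σ - z.re) * t)) (Ioi 0) :=
      integrableOn_exp_mul_Ioi (by linarith) 0
    refine this.congr (ae_of_all _ fun t => ?_)
    beta_reduce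
    rw [Complex.norm_exp, ← Real.exp_add]; congr 1; simp; ring
  have hm1 := hR.mixture measurable_fst hw1 hd1 hcc hi1
  have hm2 := hR.mixture measurable_id hw2 hd2 hcc hi2
  have hL := ((hR.mono hcc).const_mul p.a).add (hm1.const_mul (-p.rate))
  have hRt := ((laplaceClass_expStep z).mono hzc).add (hm2.const_mul (-(p.k z - s)))
  -- Both sides have the transform (k(ζ) - k(z)) / ((ζ - z)(k(ζ) - s)) in y, since a(ζ - z) - λ(φ(z)
  -- - φ(ζ)) = k(ζ) - k(z).
  have key := congrFun (hL.eq_of_laplace hRt fun ζ hζ => ?_) y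
  · simp only [resConv]
    simp only [id] at key
    rw [sub_eq_add_neg, ← neg_mul, sub_eq_add_neg, ← neg_mul, ← key]
    congr 3; funext q; ring
  · rw [((hR.mono hcc).const_mul p.a).laplace_add (hm1.const_mul (-p.rate)) hζ,
      ((laplaceClass_expStep z).mono hzc).laplace_add (hm2.const_mul (-(p.k z - s))) hζ,
      laplace_const_mul, laplace_const_mul, laplace_const_mul,
      hR.laplace_mixture measurable_fst hw1 hd1 hcc hi1 hζ,
      hR.laplace_mixture measurable_id hw2 hd2 hcc hi2 hζ,
      laplace_expStep (hzc.trans_lt hζ), p.laplace_res hs (hcc.trans_lt hζ)]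
    have h0 : 0 < (ζ - z).re := by rw [Complex.sub_re]; linarith
    have hne : ζ ≠ z := by rintro rfl; simp at h0
    have e1 : ∫ t in Ioi (0 : ℝ), Complex.exp (t * z) * Complex.exp (-(id t : ℝ) * ζ) =
        1 / (ζ - z) := by
      rw [← integral_cexp_neg_Ioi h0]
      congr 1; funext t; rw [← Complex.exp_add, id]; congr 1; ring
    have e2 : ∫ q : ℝ × ℝ, Complex.exp (-(q.2 - q.1 : ℝ) * z) * Complex.exp (-q.1 * ζ)
        ∂p.splitMeasure = (p.phi z - p.phi ζ) / (ζ - z) := by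
      rw [← p.integral_split (by linarith) hz hne]
      congr 1; funext q; ring
    rw [e1, e2]
    have hk := p.k_sub_ne_zero hs (hcc.trans_lt hζ)
    have hk1 := p.k_eq (z := ζ) (by linarith)
    have hk2 := p.k_eq hz
    have hne' : ζ - z ≠ 0 := sub_ne_zero.2 hne
    rw [hk1] at hk ⊢
    rw [hk2]
    field_simp
    ring

theorem resConv_of_neg (hs : 0 ≤ s) (z : ℂ) {y : ℝ} (hy : y < 0) : p.resConv s z y = 0 := by
  refine setIntegral_eq_zero_of_forall_eq_zero fun t ht => ?_
  rw [(p.laplaceClass_res hs).eq_zero _ (by linarith [show (0 : ℝ) < t from ht]), mul_zero]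

theorem setIntegral_Ioi_eq_interval {f : ℝ → ℂ} {y Y : ℝ} (hY : 0 ≤ Y) (hy : y ≤ Y)
    (hf : ∀ u < 0, f u = 0) (w : ℝ → ℂ) :
    ∫ t in Ioi (0 : ℝ), w t * f (y - t) = ∫ t in (0 : ℝ)..Y, w t * f (y - t) := by
  rw [intervalIntegral.integral_of_le hY]
  refine (setIntegral_eq_of_subset_of_forall_sdiff_eq_zero measurableSet_Ioi
    (fun t ht => ht.1) fun t ht => ?_)
  have h1 : 0 < t := ht.1
  have h2 : Y < t := by by_contra h; exact ht.2 ⟨h1, not_lt.1 h⟩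
  rw [hf _ (by linarith), mul_zero]

theorem resConv_eq_interval (hs : 0 ≤ s) (z : ℂ) {y Y : ℝ} (hY : 0 ≤ Y) (hy : y ≤ Y) :
    p.resConv s z y = ∫ t in (0 : ℝ)..Y, Complex.exp (t * z) * p.res s (y - t) :=
  setIntegral_Ioi_eq_interval hY hy (p.laplaceClass_res hs).eq_zero _

theorem exp_mul_integral_eq (z : ℂ) (f : ℝ → ℂ) (y : ℝ) :
    Complex.exp (z * y) * ∫ u in (0 : ℝ)..y, Complex.exp (-u * z) * f u =
      ∫ t in (0 : ℝ)..y, Complex.exp (t * z) * f (y - t) := by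
  rw [← intervalIntegral.integral_const_mul]
  have := intervalIntegral.integral_comp_sub_left (a := 0) (b := y)
    (fun u : ℝ => Complex.exp (z * y) * (Complex.exp (-u * z) * f u)) y
  rw [sub_self, sub_zero] at this
  rw [← this]
  congr 1; funext t
  rw [← mul_assoc, ← Complex.exp_add]
  congr 2; push_cast; ring

theorem cFunction_eq (hs : 0 ≤ s) (z : ℂ) (y : ℝ) :
    cFunction p y z s = Complex.exp (z * y) - (p.k z - s) * p.resConv s z y := by
  rw [cFunction]
  split_ifs with hy
  · rw [p.resConv_of_neg hs z hy]; simp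
  · rw [p.resConv_eq_interval hs z (not_lt.1 hy) le_rfl, mul_sub, mul_one, mul_left_comm]
    congr 2
    exact exp_mul_integral_eq z (p.res s) y

/-- The transform of R(y + ·) is e^{zy} times the tail of the transform of R beyond y. This shows
that the transform defining K is C_1^y(z, s) / (k_2(z) - s). -/
theorem laplace_shift_res (hs : 0 ≤ s) {z : ℂ} (hz : p.c s < z.re) (y : ℝ) :
    (p.k z - s) * ∫ u in Ioi (0 : ℝ), Complex.exp (-u * z) * p.res s (y + u) =
      cFunction p y z s := by
  have hR := p.laplaceClass_res hs
  have hk := p.k_sub_ne_zero hs hz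
  rcases lt_or_ge y 0 with hy | hy
  · have := laplace_delay hR.eq_zero (d := -y) (by linarith) z
    rw [laplace, p.laplace_res hs hz] at this
    rw [cFunction, if_pos hy]
    rw [show (fun u : ℝ => Complex.exp (-u * z) * p.res s (y + u)) =
      fun u : ℝ => Complex.exp (-u * z) * p.res s (u - -y) from
        funext fun u => by rw [sub_neg_eq_add, add_comm], this]
    field_simp
    congr 1; push_cast; ring
  · rw [cFunction, if_neg (not_lt.2 hy)]
    have hI := hR.integrableOn hz
    have h1 : ∫ u in Ioi (0 : ℝ), Complex.exp (-u * z) * p.res s (y + u) =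
        Complex.exp (z * y) * ∫ u in Ioi y, Complex.exp (-u * z) * p.res s u := by
      symm
      rw [← integral_const_mul, ← integral_indicator measurableSet_Ioi,
        ← integral_indicator measurableSet_Ioi, ← integral_add_right_eq_self _ y]
      congr 1; funext u
      by_cases hu : 0 < u
      · rw [indicator_of_mem (by simpa using hu), indicator_of_mem (by simpa using hu), ← mul_assoc,
          ← Complex.exp_add, add_comm u y]
        congr 2; push_cast; ring
      · rw [indicator_of_notMem (by simpa using hu), indicator_of_notMem (by simpa using hu)]
    have h2 : laplace (p.res s) z = (∫ u in (0 : ℝ)..y, Complex.exp (-u * z) * p.res s u) +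
        ∫ u in Ioi y, Complex.exp (-u * z) * p.res s u := by
      rw [laplace, intervalIntegral.integral_of_le hy, ← setIntegral_union
        (Ioc_disjoint_Ioi le_rfl) measurableSet_Ioi (hI.mono_set fun u hu => hu.1)
        (hI.mono_set fun u hu => lt_of_le_of_lt hy hu), Ioc_union_Ioi_eq_Ioi hy]
    rw [p.laplace_res hs hz] at h2
    rw [h1, ← sub_eq_iff_eq_add'.2 h2]
    change _ = _ * (1 - _ * ∫ u in (0 : ℝ)..y, Complex.exp (-u * z) * p.res s u)
    field_simp

end CompoundPoisson

/-! ### Harmonic functions and harmonic extension -/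

namespace CompoundPoisson

variable (p : CompoundPoisson) {s : ℝ}

/-- Functions that are harmonic, up to the killing rate `s`, for the process moving against
its jumps: `exp (-κ y) H y` changes along the drift by what the jumps contribute. -/
structure Harmonic (s : ℝ) (H : ℝ → ℂ) : Prop where
  measurable : Measurable H
  bounded : ∀ Y, ∃ M, ∀ y ≤ Y, ‖H y‖ ≤ M
  eq : ∀ y : ℝ, 0 ≤ y → Complex.exp (-(p.kappa s * y)) * H y + p.rate / p.a *
    (∫ v in (0 : ℝ)..y, Complex.exp (-(p.kappa s * v)) * ∫ j, H (v - j) ∂p.jumpLaw) = H 0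

theorem measurable_integral_sub {H : ℝ → ℂ} (hH : Measurable H) :
    Measurable fun v => ∫ j, H (v - j) ∂p.jumpLaw := by
  have : StronglyMeasurable fun q : ℝ × ℝ => H (q.1 - q.2) :=
    (hH.comp (measurable_fst.sub measurable_snd)).stronglyMeasurable
  exact this.integral_prod_right'.measurable

theorem norm_integral_sub_le {H : ℝ → ℂ} {Y M : ℝ} (hM : ∀ y ≤ Y, ‖H y‖ ≤ M) {v : ℝ}
    (hv : v ≤ Y) : ‖∫ j, H (v - j) ∂p.jumpLaw‖ ≤ M := by
  have := norm_integral_le_of_norm_le_const (μ := p.jumpLaw) (C := M)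
    (f := fun j => H (v - j)) (by
      filter_upwards [p.ae_jump_pos] with j hj using hM _ (by linarith))
  simpa using this

theorem integrable_sub_jump {H : ℝ → ℂ} (hH : Measurable H) {Y M : ℝ}
    (hM : ∀ y ≤ Y, ‖H y‖ ≤ M) {v : ℝ} (hv : v ≤ Y) :
    Integrable (fun j => H (v - j)) p.jumpLaw :=
  Integrable.of_bound (C := M) (hH.comp (by fun_prop)).aestronglyMeasurable
    (by filter_upwards [p.ae_jump_pos] with j hj using hM _ (by linarith))

theorem intervalIntegrable_exp_mul {f : ℝ → ℂ} (hf : Measurable f) {x y M : ℝ}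
    (hM : ∀ v ≤ max x y, ‖f v‖ ≤ M) (z : ℂ) :
    IntervalIntegrable (fun v : ℝ => Complex.exp (z * v) * f v) volume x y := by
  have h1 : IntervalIntegrable f volume x y := by
    rw [intervalIntegrable_iff]
    refine Measure.integrableOn_of_bounded (M := M) (by simp) hf.aestronglyMeasurable ?_
    rw [ae_restrict_iff' measurableSet_uIoc]
    refine ae_of_all _ fun v hv => hM v ?_
    rw [uIoc, mem_Ioc] at hv; exact hv.2
  exact h1.continuousOn_mul (by fun_prop)

theorem intervalIntegrable_exp_mul_integral {H : ℝ → ℂ} (hH : Measurable H)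
    (hb : ∀ Y, ∃ M, ∀ y ≤ Y, ‖H y‖ ≤ M) (κ x y : ℝ) :
    IntervalIntegrable (fun v : ℝ => Complex.exp (-(κ * v)) * ∫ j, H (v - j) ∂p.jumpLaw)
      volume x y := by
  obtain ⟨M, hM⟩ := hb (max x y)
  have := intervalIntegrable_exp_mul (x := x) (y := y) (p.measurable_integral_sub hH)
    (fun v hv => p.norm_integral_sub_le hM hv) (-κ)
  simpa only [neg_mul] using this

theorem integrable_clockWeight_mul (hs : 0 ≤ s) {G : ℝ → ℂ} (hG : LaplaceClass G (p.c s))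
    (y : ℝ) : Integrable (fun q : ℝ × ℝ => p.clockWeight s q * G (y - (q.1 + q.2)))
      p.clockMeasure := by
  obtain ⟨C, hC⟩ := hG.bound (p.kappa s + 1) (by linarith [p.c_le_kappa hs])
  refine ((p.integrable_clockWeight hs (lt_add_one _)).const_mul
    (C * Real.exp ((p.kappa s + 1) * y))).mono' ?_ (ae_of_all _ fun q => ?_)
  · exact (p.measurable_clockWeight.mul (hG.measurable.comp
      (by fun_prop))).aestronglyMeasurable
  · rw [norm_mul]
    calc ‖p.clockWeight s q‖ * ‖G (y - (q.1 + q.2))‖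
        ≤ ‖p.clockWeight s q‖ * (C * Real.exp ((p.kappa s + 1) * (y - (q.1 + q.2)))) := by
          gcongr; exact hC _
      _ = _ := by
          rw [show (p.kappa s + 1) * (y - (q.1 + q.2)) = (p.kappa s + 1) * y +
            -((q.1 + q.2) * (p.kappa s + 1)) by ring, Real.exp_add]; ring

/-- Passes from the renewal form, a double integral over waiting distance and jump, to the form used
in `Harmonic`: substitute v = y - t and pull out the jump integral. -/
theorem integral_clock_eq (hs : 0 ≤ s) {G : ℝ → ℂ} (hG : LaplaceClass G (p.c s)) {y : ℝ}
    (hy : 0 ≤ y) :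
    Complex.exp (-(p.kappa s * y)) *
      ∫ q, p.clockWeight s q * G (y - (q.1 + q.2)) ∂p.clockMeasure =
    p.rate / p.a *
      ∫ v in (0 : ℝ)..y, Complex.exp (-(p.kappa s * v)) * ∫ j, G (v - j) ∂p.jumpLaw := by
  have hI := p.integrable_clockWeight_mul hs hG y
  have hg0 : ∀ v < 0, ∫ j, G (v - j) ∂p.jumpLaw = 0 := fun v hv => by
    refine integral_eq_zero_of_ae ?_
    filter_upwards [p.ae_jump_pos] with j hj
    exact hG.eq_zero _ (by linarith)
  rw [clockMeasure] at hI ⊢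
  rw [integral_prod _ hI]
  have h1 : ∀ t : ℝ, ∫ j, p.clockWeight s (t, j) * G (y - (t + j)) ∂p.jumpLaw =
      (p.rate / p.a * Complex.exp (p.kappa s * t)) * ∫ j, G (y - t - j) ∂p.jumpLaw := fun t => by
    rw [← integral_const_mul]
    congr 1; funext j
    rw [clockWeight, sub_sub]
  simp only [h1]
  rw [setIntegral_Ioi_eq_interval (f := fun v => ∫ j, G (v - j) ∂p.jumpLaw) hy le_rfl hg0
    (fun t => p.rate / p.a * Complex.exp (p.kappa s * t))]
  have h2 := intervalIntegral.integral_comp_sub_left (a := 0) (b := y)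
    (fun v : ℝ => Complex.exp (-(p.kappa s * v)) * ∫ j, G (v - j) ∂p.jumpLaw) y
  rw [sub_self, sub_zero] at h2
  rw [← h2, ← intervalIntegral.integral_const_mul, ← intervalIntegral.integral_const_mul]
  congr 1; funext t
  rw [show Complex.exp (-(p.kappa s * (y - t : ℝ))) =
    Complex.exp (-(p.kappa s * y)) * Complex.exp (p.kappa s * t) by
      rw [← Complex.exp_add]; congr 1; push_cast; ring]
  ring

theorem harmonic_res (hs : 0 ≤ s) : p.Harmonic s (p.res s) where
  measurable := (p.laplaceClass_res hs).measurable
  bounded := (p.laplaceClass_res hs).bounded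
  eq y hy := by
    rw [← p.integral_clock_eq hs (p.laplaceClass_res hs) hy, ← mul_add, p.res_renewal hs,
      expStep_of_nonneg _ hy, mul_left_comm, ← Complex.exp_add, p.res_zero hs]
    simp

section Ext

variable {h : ℝ → ℂ} {u M : ℝ}

theorem integrable_split_weight (hh : Measurable h) (hM : ∀ w ≤ u, ‖h w‖ ≤ M) {σ : ℝ}
    (hσ : 0 < σ) :
    Integrable (fun q : ℝ × ℝ => Real.exp (-(q.1 * σ)) * ‖h (u - (q.2 - q.1))‖)
      p.splitMeasure := by
  have h1 := (p.integrable_split (ζ := σ) (z := 0) (by simpa using hσ) le_rfl).norm.const_mul M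
  refine h1.mono' ?_ ?_
  · exact (Measurable.mul (by fun_prop) (hh.comp (by fun_prop)).norm).aestronglyMeasurable
  · filter_upwards [p.ae_splitMeasure] with q hq
    rw [norm_mul, norm_norm, norm_mul, norm_cexp_neg_mul, norm_cexp_neg_mul,
      Real.norm_of_nonneg (Real.exp_pos _).le, mul_comm M]
    simp only [Complex.ofReal_re, Complex.zero_re, mul_zero, neg_zero, Real.exp_zero, mul_one]
    gcongr
    exact hM _ (by linarith [hq.2])

theorem integrable_split_mul {f : ℝ → ℂ} {c : ℝ} (hf : LaplaceClass f c) (hh : Measurable h)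
    (hM : ∀ w ≤ u, ‖h w‖ ≤ M) (y : ℝ) :
    Integrable (fun q : ℝ × ℝ => f (y - q.1) * h (u - (q.2 - q.1))) p.splitMeasure := by
  obtain ⟨C, hC⟩ := hf.bound (|c| + 1) (by linarith [le_abs_self c])
  refine ((p.integrable_split_weight hh hM (σ := |c| + 1) (by positivity)).const_mul
    (C * Real.exp ((|c| + 1) * y))).mono' ?_ (ae_of_all _ fun q => ?_)
  · exact ((hf.measurable.comp (by fun_prop)).mul (hh.comp (by fun_prop))).aestronglyMeasurable
  · rw [norm_mul]
    calc ‖f (y - q.1)‖ * ‖h (u - (q.2 - q.1))‖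
        ≤ C * Real.exp ((|c| + 1) * (y - q.1)) * ‖h (u - (q.2 - q.1))‖ := by
          gcongr; exact hC _
      _ = _ := by
          rw [show (|c| + 1) * (y - q.1) = (|c| + 1) * y + -(q.1 * (|c| + 1)) by ring,
            Real.exp_add]; ring

/-- The harmonic extension to `[0, ∞)` of the function `y ↦ h (u + y)` on `(-∞, 0)`, with the
value `h u` at `0`; it vanishes on the negative half-line. -/
def extPos (s : ℝ) (h : ℝ → ℂ) (u y : ℝ) : ℂ :=
  p.a * h u * p.res s y +
    -p.rate * ∫ q, h (u - (q.2 - q.1)) * p.res s (y - q.1) ∂p.splitMeasure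

/-- The function equal to `h (u + y)` for `y < 0` and extended harmonically to `[0, ∞)`. -/
def ext (s : ℝ) (h : ℝ → ℂ) (u y : ℝ) : ℂ := if y < 0 then h (u + y) else p.extPos s h u y

theorem laplaceClass_split (hs : 0 ≤ s) (hh : Measurable h) (hM : ∀ w ≤ u, ‖h w‖ ≤ M) :
    LaplaceClass (fun y => ∫ q, h (u - (q.2 - q.1)) * p.res s (y - q.1) ∂p.splitMeasure)
      (p.c s) :=
  (p.laplaceClass_res hs).mixture measurable_fst (hh.comp (by fun_prop))
    (p.ae_splitMeasure.mono fun q hq => hq.1.le) le_rfl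
    fun _ hσ => p.integrable_split_weight hh hM ((p.c_nonneg hs).trans_lt hσ)

theorem laplaceClass_extPos (hs : 0 ≤ s) (hh : Measurable h) (hM : ∀ w ≤ u, ‖h w‖ ≤ M) :
    LaplaceClass (p.extPos s h u) (p.c s) :=
  ((p.laplaceClass_res hs).const_mul _).add ((p.laplaceClass_split hs hh hM).const_mul _)

/-- The renewal equation of R, translated by the first part of a split jump and integrated against
h. The bound on h below u suffices because the remainder of the jump is positive. -/
theorem split_renewal (hs : 0 ≤ s) (hh : Measurable h) (hM : ∀ w ≤ u, ‖h w‖ ≤ M) (y : ℝ) :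
    (∫ q, h (u - (q.2 - q.1)) * p.res s (y - q.1) ∂p.splitMeasure) +
      ∫ r, p.clockWeight s r * (∫ q, h (u - (q.2 - q.1)) * p.res s (y - (r.1 + r.2) - q.1)
        ∂p.splitMeasure) ∂p.clockMeasure =
    1 / p.a * ∫ q, expStep (p.kappa s) (y - q.1) * h (u - (q.2 - q.1)) ∂p.splitMeasure := by
  have hR := p.laplaceClass_res hs
  have hI : Integrable (Function.uncurry fun (r q : ℝ × ℝ) => p.clockWeight s r *
      (h (u - (q.2 - q.1)) * p.res s (y - (r.1 + r.2) - q.1)))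
      (p.clockMeasure.prod p.splitMeasure) := by
    obtain ⟨C, hC⟩ := hR.bound (p.kappa s + 1) (by linarith [p.c_le_kappa hs])
    have hk := p.kappa_pos hs
    refine (((p.integrable_clockWeight hs (lt_add_one _)).mul_prod
      (p.integrable_split_weight hh hM (σ := p.kappa s + 1) (by linarith))).const_mul
      (C * Real.exp ((p.kappa s + 1) * y))).mono' ?_ (ae_of_all _ ?_)
    · refine Measurable.aestronglyMeasurable ?_
      refine (p.measurable_clockWeight.comp measurable_fst).mul
        ((hh.comp (by fun_prop)).mul (hR.measurable.comp (by fun_prop)))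
    · rintro ⟨r, q⟩
      simp only [Function.uncurry]
      rw [norm_mul, norm_mul]
      calc _ ≤ ‖p.clockWeight s r‖ * (‖h (u - (q.2 - q.1))‖ *
            (C * Real.exp ((p.kappa s + 1) * (y - (r.1 + r.2) - q.1)))) := by
            gcongr; exact hC _
        _ = _ := by
            rw [show (p.kappa s + 1) * (y - (r.1 + r.2) - q.1) = (p.kappa s + 1) * y +
              -((r.1 + r.2) * (p.kappa s + 1)) + -(q.1 * (p.kappa s + 1)) by ring,
              Real.exp_add, Real.exp_add]
            ring
  simp_rw [← integral_const_mul]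
  rw [integral_integral_swap hI, ← integral_add]
  · congr 1; funext q
    have := p.res_renewal hs (y - q.1)
    have e : ∫ r, p.clockWeight s r * (h (u - (q.2 - q.1)) * p.res s (y - (r.1 + r.2) - q.1))
        ∂p.clockMeasure = h (u - (q.2 - q.1)) *
        ∫ r, p.clockWeight s r * p.res s (y - q.1 - (r.1 + r.2)) ∂p.clockMeasure := by
      rw [← integral_const_mul]
      congr 1; funext r
      rw [sub_right_comm]; ring
    rw [e, ← mul_add, this]; ring
  · exact (p.integrable_split_mul hR hh hM y).congr (ae_of_all _ fun q => mul_comm _ _)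
  · exact hI.swap.integral_prod_left

/-- The inner integral on the right collects the jumps from v that land below 0, weighted by the
boundary values there. These are the split jumps v < j. -/
theorem integral_split_expStep (hh : Measurable h) (hM : ∀ w ≤ u, ‖h w‖ ≤ M)
    {y : ℝ} (hy : 0 ≤ y) :
    Complex.exp (-(p.kappa s * y)) *
      ∫ q, expStep (p.kappa s) (y - q.1) * h (u - (q.2 - q.1)) ∂p.splitMeasure =
    ∫ v in (0 : ℝ)..y, Complex.exp (-(p.kappa s * v)) *
      ∫ j, (Iio (0 : ℝ)).indicator (fun x => h (u + x)) (v - j) ∂p.jumpLaw := by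
  have hE := laplaceClass_expStep (p.kappa s)
  have hI := p.integrable_split_mul hE hh hM y
  rw [splitMeasure] at hI ⊢
  rw [← IntegrableOn, ← integrable_indicator_iff measurableSet_split] at hI
  rw [← integral_indicator measurableSet_split, integral_prod _ hI]
  have h1 : ∀ v : ℝ, ∫ j, ({q : ℝ × ℝ | q.1 < q.2}).indicator (fun q : ℝ × ℝ =>
      expStep (p.kappa s) (y - q.1) * h (u - (q.2 - q.1))) (v, j) ∂p.jumpLaw =
      (∫ j, (Iio (0 : ℝ)).indicator (fun x => h (u + x)) (v - j) ∂p.jumpLaw) *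
        expStep (p.kappa s) (y - v) := fun v => by
    rw [mul_comm, ← integral_const_mul]
    congr 1; funext j
    by_cases hvj : v < j
    · rw [indicator_of_mem (by exact hvj), indicator_of_mem (by simpa using hvj)]
      congr 2; ring
    · rw [indicator_of_notMem (by exact hvj), indicator_of_notMem (by simpa using hvj), mul_zero]
  simp only [h1]
  rw [setIntegral_Ioi_eq_interval hy le_rfl (fun u hu => expStep_of_neg _ hu),
    ← intervalIntegral.integral_const_mul]
  refine intervalIntegral.integral_congr fun v hv => ?_
  rw [uIcc_of_le hy] at hv
  rw [expStep_of_nonneg _ (by linarith [hv.2]), mul_left_comm, ← Complex.exp_add, mul_comm]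
  congr 2; push_cast; ring

theorem extPos_zero (hs : 0 ≤ s) : p.extPos s h u 0 = h u := by
  rw [extPos, p.res_zero hs, integral_eq_zero_of_ae]
  · have : (p.a : ℂ) ≠ 0 := by exact_mod_cast p.a_pos.ne'
    field_simp; simp
  · filter_upwards [p.ae_splitMeasure] with q hq
    rw [(p.laplaceClass_res hs).eq_zero _ (by linarith [hq.1]), mul_zero]; rfl

theorem ext_zero (hs : 0 ≤ s) : p.ext s h u 0 = h u := by
  rw [ext, if_neg (lt_irrefl _), p.extPos_zero hs]

theorem ext_eq_add (hs : 0 ≤ s) (hh : Measurable h) (hM : ∀ w ≤ u, ‖h w‖ ≤ M) (y : ℝ) :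
    p.ext s h u y = p.extPos s h u y + (Iio (0 : ℝ)).indicator (fun x => h (u + x)) y := by
  rw [ext]
  split_ifs with hy
  · rw [(p.laplaceClass_extPos hs hh hM).eq_zero y hy, zero_add, indicator_of_mem (by exact hy)]
  · rw [indicator_of_notMem (by exact hy), add_zero]

/-- The function is `extPos` plus its boundary values on (-∞, 0). By the renewal equations the term
a h(u) R contributes the constant h(u), and the split term of `extPos` contributes exactly the
negative of what jumps onto the boundary values contribute. -/
theorem harmonic_ext (hs : 0 ≤ s) (hh : Measurable h) (hM : ∀ w ≤ u, ‖h w‖ ≤ M) :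
    p.Harmonic s (p.ext s h u) := by
  have hG := p.laplaceClass_extPos hs hh hM
  have hN : Measurable ((Iio (0 : ℝ)).indicator (fun x => h (u + x))) :=
    (hh.comp (by fun_prop)).indicator measurableSet_Iio
  have hNb : ∀ y, ‖(Iio (0 : ℝ)).indicator (fun x => h (u + x)) y‖ ≤ M := fun y => by
    by_cases hy : y < 0
    · rw [indicator_of_mem (by exact hy)]; exact hM _ (by linarith)
    · rw [indicator_of_notMem (by exact hy), norm_zero]
      exact (norm_nonneg _).trans (hM u le_rfl)
  have hE := funext (p.ext_eq_add hs hh hM)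
  refine ⟨?_, fun Y => ?_, fun y hy => ?_⟩
  · rw [hE]; exact hG.measurable.add hN
  · obtain ⟨D, hD⟩ := hG.bounded Y
    exact ⟨D + M, fun y hy => by
      rw [p.ext_eq_add hs hh hM]; exact (norm_add_le _ _).trans (add_le_add (hD y hy) (hNb y))⟩
  · rw [p.ext_zero hs, ext, if_neg (not_lt.2 hy)]
    have h1 : ∀ v : ℝ, ∫ j, p.ext s h u (v - j) ∂p.jumpLaw = (∫ j, p.extPos s h u (v - j)
        ∂p.jumpLaw) + ∫ j, (Iio (0 : ℝ)).indicator (fun x => h (u + x)) (v - j) ∂p.jumpLaw := by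
      intro v
      obtain ⟨D, hD⟩ := hG.bounded v
      rw [← integral_add (p.integrable_sub_jump hG.measurable hD le_rfl)
        (p.integrable_sub_jump hN (Y := v) (fun y _ => hNb y) le_rfl)]
      simp only [p.ext_eq_add hs hh hM]
    simp only [h1, mul_add]
    rw [intervalIntegral.integral_add
      (p.intervalIntegrable_exp_mul_integral hG.measurable hG.bounded _ _ _)
      (p.intervalIntegrable_exp_mul_integral hN (fun _ => ⟨M, fun y _ => hNb y⟩) _ _ _),
      mul_add, ← p.integral_clock_eq hs hG hy, ← p.integral_split_expStep hh hM hy]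
    have hR := p.laplaceClass_res hs
    have hsp := p.laplaceClass_split hs hh hM
    have h2 : ∫ q, p.clockWeight s q * p.extPos s h u (y - (q.1 + q.2)) ∂p.clockMeasure =
        p.a * h u * (∫ q, p.clockWeight s q * p.res s (y - (q.1 + q.2)) ∂p.clockMeasure) +
        -p.rate * ∫ r, p.clockWeight s r * (∫ q, h (u - (q.2 - q.1)) *
          p.res s (y - (r.1 + r.2) - q.1) ∂p.splitMeasure) ∂p.clockMeasure := by
      rw [← integral_const_mul, ← integral_const_mul,
        ← integral_add ((p.integrable_clockWeight_mul hs hR y).const_mul _)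
          ((p.integrable_clockWeight_mul hs hsp y).const_mul _)]
      congr 1; funext q
      rw [extPos]; ring
    have h3 := p.res_renewal hs y
    have h4 := p.split_renewal hs hh hM y
    rw [expStep_of_nonneg _ hy] at h3
    rw [h2, extPos]
    have ha : (p.a : ℂ) ≠ 0 := by exact_mod_cast p.a_pos.ne'
    have hexp : Complex.exp (-(p.kappa s * y)) * Complex.exp (p.kappa s * y) = 1 := by
      rw [← Complex.exp_add]; simp
    have h5 : p.a * h u * (1 / p.a * Complex.exp (p.kappa s * y)) =
      h u * Complex.exp (p.kappa s * y) := by field_simp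
    linear_combination Complex.exp (-(p.kappa s * y)) * (p.a * h u) * h3 -
      Complex.exp (-(p.kappa s * y)) * p.rate * h4 + Complex.exp (-(p.kappa s * y)) * h5 +
      h u * hexp

end Ext

end CompoundPoisson

/-! ### Extension as a function of the level u -/

namespace CompoundPoisson

variable (p : CompoundPoisson) {s : ℝ}

/-- Rewrites C^y as a R(y) minus an integral over split jumps, that is, in the shape of `extPos` for
an exponential function. -/
theorem cFunction_of_nonneg (hs : 0 ≤ s) {z : ℂ} (hz : 0 ≤ z.re) {y : ℝ} (hy : 0 ≤ y) :
    cFunction p y z s = p.a * p.res s y - p.rate * ∫ q : ℝ × ℝ, p.res s (y - q.1) *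
      Complex.exp (-(q.2 - q.1 : ℝ) * z) ∂p.splitMeasure := by
  rw [p.cFunction_eq hs, p.res_sub_split hs hz, expStep_of_nonneg z hy]

theorem laplaceClass_ext (hs : 0 ≤ s) {h : ℝ → ℂ} {c : ℝ} (hc : 0 ≤ c) (hh : LaplaceClass h c)
    (y : ℝ) : LaplaceClass (fun u => p.ext s h u y) c := by
  by_cases hy : y < 0
  · simp only [ext, if_pos hy]
    simpa using hh.delay (d := -y) (by linarith)
  · simp only [ext, if_neg hy, extPos]
    have hm := hh.mixture (μ := p.splitMeasure) (d := fun q => q.2 - q.1)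
      (w := fun q => p.res s (y - q.1)) (by fun_prop)
      ((p.laplaceClass_res hs).measurable.comp (by fun_prop))
      (p.ae_splitMeasure.mono fun q hq => by linarith [hq.2]) le_rfl (fun σ hσ => by
        refine (p.integrable_res_split hs y (z := σ) (by simpa using hc.trans hσ.le)).norm.congr
          (ae_of_all _ fun q => ?_)
        simp only [norm_mul, norm_cexp_neg_mul, Complex.ofReal_re]
        rw [mul_comm])
    have := (hh.const_mul (p.a * p.res s y)).add (hm.const_mul (-p.rate))
    convert this using 2 with u
    rw [mul_right_comm]
    congr 2; congr 1; funext q; rw [mul_comm]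

/-- For fixed y the extension is, in u, a superposition of delays of h; the weights and delays
transform into the representation of C^y(z, s) through split jumps. -/
theorem laplace_ext (hs : 0 ≤ s) {h : ℝ → ℂ} {c : ℝ} (hc : 0 ≤ c) (hh : LaplaceClass h c)
    (y : ℝ) {z : ℂ} (hz : c < z.re) :
    laplace (fun u => p.ext s h u y) z = laplace h z * cFunction p y z s := by
  have hz0 := hc.trans hz.le
  by_cases hy : y < 0
  · have := laplace_delay hh.eq_zero (d := -y) (by linarith) z
    simp only [ext, if_pos hy, cFunction]
    simp only [sub_neg_eq_add] at this
    rw [this, mul_comm]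
    congr 2; push_cast; ring
  · simp only [ext, if_neg hy, extPos]
    have hw : Measurable fun q : ℝ × ℝ => p.res s (y - q.1) :=
      (p.laplaceClass_res hs).measurable.comp (by fun_prop)
    have hd : Measurable fun q : ℝ × ℝ => q.2 - q.1 := by fun_prop
    have hd0 : ∀ᵐ q ∂p.splitMeasure, 0 ≤ q.2 - q.1 :=
      p.ae_splitMeasure.mono fun q hq => by linarith [hq.2]
    have hi : ∀ σ, c < σ → Integrable (fun q : ℝ × ℝ => Real.exp (-((q.2 - q.1) * σ)) *
        ‖p.res s (y - q.1)‖) p.splitMeasure := fun σ hσ => by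
      refine (p.integrable_res_split hs y (z := σ) (by simpa using hc.trans hσ.le)).norm.congr
        (ae_of_all _ fun q => ?_)
      simp only [norm_mul, norm_cexp_neg_mul, Complex.ofReal_re]
      rw [mul_comm]
    have hm := hh.mixture hd hw hd0 le_rfl hi
    have e : (fun u => p.a * h u * p.res s y + -p.rate *
        ∫ q, h (u - (q.2 - q.1)) * p.res s (y - q.1) ∂p.splitMeasure) =
        fun u => p.a * p.res s y * h u + -p.rate *
          ∫ q, p.res s (y - q.1) * h (u - (q.2 - q.1)) ∂p.splitMeasure := by
      funext u
      rw [mul_right_comm]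
      congr 2; congr 1; funext q; rw [mul_comm]
    rw [e, (hh.const_mul _).laplace_add (hm.const_mul _) hz, laplace_const_mul, laplace_const_mul,
      hh.laplace_mixture hd hw hd0 le_rfl hi hz,
      p.cFunction_of_nonneg hs hz0 (not_lt.1 hy)]
    ring

/-- Makes the extension of the real resolvent R_2 eligible to be the real function K. -/
theorem ext_real {g : ℝ → ℝ} (u y : ℝ) :
    ∃ r : ℝ, p.ext s (fun w => (g w : ℂ)) u y = r := by
  rw [ext]
  split_ifs with hy
  · exact ⟨_, rfl⟩
  · refine ⟨p.a * g u * scaleResolvent p s y + -p.rate *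
      ∫ q, g (u - (q.2 - q.1)) * scaleResolvent p s (y - q.1) ∂p.splitMeasure, ?_⟩
    rw [extPos]
    push_cast
    rw [← integral_complex_ofReal]
    push_cast; rfl

theorem measurable_cexp_mul (z : ℂ) : Measurable fun w : ℝ => Complex.exp (z * w) := by fun_prop

theorem norm_cexp_mul_le {z : ℂ} (hz : 0 ≤ z.re) {u w : ℝ} (hw : w ≤ u) :
    ‖Complex.exp (z * w)‖ ≤ Real.exp (z.re * u) := by
  rw [Complex.norm_exp]
  have : (z * w).re = z.re * w := by simp
  rw [this]; gcongr

/-- A shift of the level multiplies an exponential by a constant, so only the level 0 matters. In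
particular C^y is itself a harmonic extension, which is why it is harmonic. -/
theorem ext_cexp (hs : 0 ≤ s) {z : ℂ} (hz : 0 ≤ z.re) (u y : ℝ) :
    p.ext s (fun w => Complex.exp (z * w)) u y = Complex.exp (u * z) * cFunction p y z s := by
  rw [ext]
  split_ifs with hy
  · rw [cFunction, if_pos hy, ← Complex.exp_add]
    congr 1; push_cast; ring
  · rw [p.cFunction_of_nonneg hs hz (not_lt.1 hy), extPos]
    have : ∫ q : ℝ × ℝ, Complex.exp (z * (u - (q.2 - q.1) : ℝ)) * p.res s (y - q.1)
        ∂p.splitMeasure = Complex.exp (u * z) * ∫ q : ℝ × ℝ, p.res s (y - q.1) *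
          Complex.exp (-(q.2 - q.1 : ℝ) * z) ∂p.splitMeasure := by
      rw [← integral_const_mul]
      congr 1; funext q
      rw [mul_comm (p.res s (y - q.1)), ← mul_assoc, ← Complex.exp_add]
      congr 2; push_cast; ring
    rw [this, mul_comm z u]; ring

theorem cFunction_eq_ext (hs : 0 ≤ s) {z : ℂ} (hz : 0 ≤ z.re) (y : ℝ) :
    cFunction p y z s = p.ext s (fun w => Complex.exp (z * w)) 0 y := by
  rw [p.ext_cexp hs hz]; simp

theorem harmonic_cFunction (hs : 0 ≤ s) {z : ℂ} (hz : 0 ≤ z.re) :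
    p.Harmonic s (fun y => cFunction p y z s) := by
  rw [funext (p.cFunction_eq_ext hs hz)]
  exact p.harmonic_ext hs (measurable_cexp_mul z) fun w hw => norm_cexp_mul_le hz hw

theorem ext_sub (hs : 0 ≤ s) {h g : ℝ → ℂ} {u M N : ℝ} (hh : Measurable h)
    (hM : ∀ w ≤ u, ‖h w‖ ≤ M) (hg : Measurable g) (hN : ∀ w ≤ u, ‖g w‖ ≤ N) (a : ℂ) (y : ℝ) :
    p.ext s (fun w => h w - a * g w) u y = p.ext s h u y - a * p.ext s g u y := by
  simp only [ext]
  split_ifs with hy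
  · rfl
  · simp only [extPos]
    have h1 := p.integrable_split_mul (p.laplaceClass_res hs) hh hM y
    have h2 := p.integrable_split_mul (p.laplaceClass_res hs) hg hN y
    have : ∫ q, (h (u - (q.2 - q.1)) - a * g (u - (q.2 - q.1))) * p.res s (y - q.1)
        ∂p.splitMeasure = (∫ q, h (u - (q.2 - q.1)) * p.res s (y - q.1) ∂p.splitMeasure) -
          a * ∫ q, g (u - (q.2 - q.1)) * p.res s (y - q.1) ∂p.splitMeasure := by
      rw [← integral_const_mul, ← integral_sub]
      · congr 1; funext q; ring
      · exact h1.congr (ae_of_all _ fun q => mul_comm _ _)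
      · exact (h2.congr (ae_of_all _ fun q => mul_comm _ _)).const_mul a
    rw [this]; ring

/-- Averaging over the level commutes with the harmonic extension. -/
theorem integral_ext {h : ℝ → ℂ} (hs : 0 ≤ s) {c : ℝ} (hh : LaplaceClass h c) (z : ℂ)
    {u : ℝ} (hu : 0 ≤ u) (y : ℝ) :
    ∫ t in (0 : ℝ)..u, Complex.exp (t * z) * p.ext s h (u - t) y =
      p.ext s (fun w => ∫ t in Ioi (0 : ℝ), Complex.exp (t * z) * h (w - t)) u y := by
  have hc : ∀ w ≤ u, ∫ t in Ioi (0 : ℝ), Complex.exp (t * z) * h (w - t) =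
      ∫ t in (0 : ℝ)..u, Complex.exp (t * z) * h (w - t) := fun w hw =>
    setIntegral_Ioi_eq_interval hu hw hh.eq_zero _
  by_cases hy : y < 0
  · simp only [ext, if_pos hy]
    rw [hc _ (by linarith)]
    congr 1; funext t
    rw [sub_add_eq_add_sub]
  · simp only [ext, if_neg hy, extPos]
    have hR := p.laplaceClass_res hs
    obtain ⟨M, hM⟩ := hh.bounded u
    have hE : Integrable (fun t : ℝ => ‖Complex.exp (t * z)‖ * M)
        (volume.restrict (Ioc 0 u)) := by
      have : Continuous fun t : ℝ => ‖Complex.exp (t * z)‖ * M := by fun_prop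
      exact (this.integrableOn_Icc).mono_set Ioc_subset_Icc_self
    have hI : Integrable (Function.uncurry fun (t : ℝ) (q : ℝ × ℝ) => Complex.exp (t * z) *
        (h (u - t - (q.2 - q.1)) * p.res s (y - q.1)))
        ((volume.restrict (Ioc 0 u)).prod p.splitMeasure) := by
      have hr := (p.integrable_res_split hs y (z := 0) le_rfl).norm
      simp only [mul_zero, Complex.exp_zero, mul_one] at hr
      refine (hE.mul_prod hr).mono' ?_ ?_
      · refine Measurable.aestronglyMeasurable (Measurable.mul (by fun_prop)
          ((hh.measurable.comp (by fun_prop)).mul (hR.measurable.comp (by fun_prop))))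
      · have h1 : ∀ᵐ r ∂(volume.restrict (Ioc 0 u)).prod p.splitMeasure, r.1 ∈ Ioc 0 u :=
          Measure.quasiMeasurePreserving_fst.ae (ae_restrict_mem measurableSet_Ioc)
        have h2 : ∀ᵐ r ∂(volume.restrict (Ioc 0 u)).prod p.splitMeasure,
            0 < r.2.1 ∧ r.2.1 < r.2.2 :=
          Measure.quasiMeasurePreserving_snd.ae p.ae_splitMeasure
        filter_upwards [h1, h2] with r hr1 hr2
        simp only [Function.uncurry]
        rw [norm_mul, norm_mul, mul_assoc]
        gcongr
        exact hM _ (by linarith [hr1.1])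
    have hi1 : IntervalIntegrable (fun t : ℝ => Complex.exp (t * z) * h (u - t)) volume 0 u := by
      rw [intervalIntegrable_iff, uIoc_of_le hu]
      refine hE.mono' (Measurable.mul (by fun_prop)
        (hh.measurable.comp (by fun_prop))).aestronglyMeasurable ?_
      rw [ae_restrict_iff' measurableSet_Ioc]
      refine ae_of_all _ fun t ht => ?_
      rw [norm_mul]; gcongr; exact hM _ (by linarith [ht.1])
    have hi2 : IntervalIntegrable (fun t : ℝ => ∫ q, Complex.exp (t * z) *
        (h (u - t - (q.2 - q.1)) * p.res s (y - q.1)) ∂p.splitMeasure) volume 0 u := by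
      rw [intervalIntegrable_iff, uIoc_of_le hu]
      exact hI.integral_prod_left
    have e : (fun t : ℝ => Complex.exp (t * z) * (p.a * h (u - t) * p.res s y + -p.rate *
        ∫ q, h (u - t - (q.2 - q.1)) * p.res s (y - q.1) ∂p.splitMeasure)) =
        fun t : ℝ => (p.a * p.res s y) * (Complex.exp (t * z) * h (u - t)) + -p.rate *
          ∫ q, Complex.exp (t * z) * (h (u - t - (q.2 - q.1)) * p.res s (y - q.1))
            ∂p.splitMeasure := by
      funext t
      rw [integral_const_mul]; ring
    rw [e, intervalIntegral.integral_add (hi1.const_mul _) (hi2.const_mul _),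
      intervalIntegral.integral_const_mul, intervalIntegral.integral_const_mul, hc u le_rfl,
      mul_right_comm]
    congr 2
    rw [intervalIntegral.integral_of_le hu, integral_integral_swap hI]
    refine integral_congr_ae ?_
    filter_upwards [p.ae_splitMeasure] with q hq
    rw [hc _ (by linarith [hq.2]), intervalIntegral.integral_of_le hu, ← integral_mul_const]
    congr 1; funext t
    rw [sub_right_comm]; ring

end CompoundPoisson

/-! ### K and 𝔎 as harmonic extensions -/

section KFunction

variable (p : Regime → CompoundPoisson) {s : ℝ}

theorem exists_isKFunction (hs : 0 ≤ s) (y : ℝ) : ∃ K : ℝ → ℝ, IsKFunction p s y K ∧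
    ∀ u, (K u : ℂ) = (p .lower).ext s ((p .upper).res s) u y := by
  choose g hg using fun u => (p .lower).ext_real (s := s) (g := scaleResolvent (p .upper) s) u y
  have hc2 := (p .upper).c_nonneg hs
  have hR2 := (p .upper).laplaceClass_res hs
  have hE := ((p .lower).laplaceClass_ext hs hc2 hR2 y)
  have he : (fun u => (g u : ℂ)) = fun u => (p .lower).ext s ((p .upper).res s) u y :=
    funext fun u => (hg u).symm
  refine ⟨g, LaplaceClass.hasLaplaceTransform ?_ fun z hz => ?_, fun u => (hg u).symm⟩
  · rw [he]; exact hE.mono (le_max_right _ _)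
  · rw [he, (p .lower).laplace_ext hs hc2 hR2 y (lt_of_le_of_lt (le_max_right _ _) hz),
      (p .upper).laplace_res hs (lt_of_le_of_lt (le_max_right _ _) hz),
      ← (p .lower).laplace_shift_res hs (lt_of_le_of_lt (le_max_left _ _) hz) y]
    change _ = _ * ∫ u in Ioi (0 : ℝ), Complex.exp (-u * z) * (p .lower).res s (y + u)
    ring

theorem existsUnique_isKFunction (hs : 0 ≤ s) (y : ℝ) : ∃! K, IsKFunction p s y K := by
  obtain ⟨K, hK, -⟩ := exists_isKFunction p hs y
  exact ⟨K, hK, fun K' hK' => HasLaplaceTransform.unique hK' hK⟩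

theorem kFunction_eq_ext (hs : 0 ≤ s) (y u : ℝ) :
    (kFunction p s y u : ℂ) = (p .lower).ext s ((p .upper).res s) u y := by
  obtain ⟨K, hK, hu⟩ := exists_isKFunction p hs y
  have : kFunction p s y = K :=
    HasLaplaceTransform.unique (Classical.epsilon_spec ⟨K, hK⟩) hK
  rw [this, hu]

/-- C_2^w is e^{zw} minus (k_2(z) - s) times the convolution of R_2 with an exponential. The
extension of the exponential is e^{uz} C_1^y, and that of the convolution is the convolution of K,
because averaging over the level commutes with extension. -/
theorem frakKJoint_eq_ext (hs : 0 ≤ s) {z : ℂ} (hz : 0 ≤ z.re) {u : ℝ} (hu : 0 ≤ u) (y : ℝ) :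
    frakKJoint p y u z s =
      (p .lower).ext s (fun w => cFunction (p .upper) w z s) u y := by
  have hR2 := (p .upper).laplaceClass_res hs
  have hmb : ∃ N, ∀ w ≤ u, ‖(p .upper).resConv s z w‖ ≤ N := by
    obtain ⟨M, hM⟩ := hR2.bounded u
    refine ⟨∫ t in (0 : ℝ)..u, ‖Complex.exp (t * z)‖ * M, fun w hw => ?_⟩
    rw [(p .upper).resConv_eq_interval hs z hu hw]
    refine intervalIntegral.norm_integral_le_of_norm_le hu (ae_of_all _ fun t ht => ?_)
      (Continuous.intervalIntegrable (by fun_prop) _ _)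
    rw [norm_mul]; gcongr; exact hM _ (by linarith [ht.1])
  obtain ⟨N, hN⟩ := hmb
  have hm : Measurable ((p .upper).resConv s z) := by
    have : StronglyMeasurable fun q : ℝ × ℝ => Complex.exp (q.2 * z) *
        (p .upper).res s (q.1 - q.2) :=
      (Measurable.mul (by fun_prop) (hR2.measurable.comp (by fun_prop))).stronglyMeasurable
    exact this.integral_prod_right'.measurable
  have e : (fun w => cFunction (p .upper) w z s) = fun w : ℝ => Complex.exp (z * w) -
      ((p .upper).k z - s) * (p .upper).resConv s z w :=
    funext fun w => (p .upper).cFunction_eq hs z w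
  rw [e, (p .lower).ext_sub hs (CompoundPoisson.measurable_cexp_mul z)
    (fun w hw => CompoundPoisson.norm_cexp_mul_le hz hw) hm hN,
    (p .lower).ext_cexp hs hz, frakKJoint, mul_sub]
  have h1 := (p .lower).integral_ext hs hR2 z hu y
  have h2 := CompoundPoisson.exp_mul_integral_eq z (fun v => (kFunction p s y v : ℂ)) u
  simp only [kFunction_eq_ext p hs] at h2 ⊢
  rw [h1, mul_comm z] at h2
  rw [mul_left_comm, h2]
  rfl

/-- Since k_i(0) = 0, the factors -(k_i(0) - s) become s. For y < 0 the integral of R_1 vanishes, in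
accordance with the case distinction in C_1^y. -/
theorem frakKJoint_zero (hs : 0 ≤ s) (y u : ℝ) : frakKJoint p y u 0 s = frakK p y u s := by
  have hI (f : ℝ → ℝ) (x : ℝ) : ∫ v in (0 : ℝ)..x, Complex.exp (-v * 0) * f v =
      ((∫ v in (0 : ℝ)..x, f v : ℝ) : ℂ) := by
    rw [← intervalIntegral.integral_ofReal]; simp
  rw [frakKJoint, cFunction, frakK, hI, CompoundPoisson.k_zero, CompoundPoisson.k_zero]
  have hneg : y < 0 → ∫ v in (0 : ℝ)..y, scaleResolvent (p .lower) s v = 0 := fun hy => by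
    rw [intervalIntegral.integral_symm, intervalIntegral.integral_of_le hy.le,
      integral_Ioc_eq_integral_Ioo, neg_eq_zero]
    refine setIntegral_eq_zero_of_forall_eq_zero fun v hv => ?_
    exact Complex.ofReal_eq_zero.1 (((p .lower).laplaceClass_res hs).eq_zero v hv.2)
  split_ifs with hy
  · rw [hneg hy]; simp
    exact Or.inl intervalIntegral.integral_ofReal
  · rw [hI]; simp

end KFunction

/-! ### Exponential waiting times and the first-step identity -/

section Exponential

variable {r : ℝ}

theorem integral_expMeasure (hr : 0 < r) (f : ℝ → ℂ) :
    ∫ t, f t ∂expMeasure r = ∫ t in Ioi (0 : ℝ), (r * Complex.exp (-(r * t))) * f t := by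
  have hm : Measurable (gammaPDF 1 r) := (measurable_gammaPDFReal 1 r).ennreal_ofReal
  rw [expMeasure, gammaMeasure, ← integral_Ici_eq_integral_Ioi]
  rw [integral_withDensity_eq_integral_toReal_smul hm
    (ae_of_all _ fun t => ENNReal.ofReal_lt_top), ← integral_indicator measurableSet_Ici]
  congr 1; funext t
  have h1 : (gammaPDF 1 r t).toReal = if 0 ≤ t then r * Real.exp (-(r * t)) else 0 := by
    have := exponentialPDF_eq r t
    rw [exponentialPDF, exponentialPDFReal] at this
    rw [gammaPDF, this, ENNReal.toReal_ofReal]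
    split_ifs <;> positivity
  rw [h1]
  by_cases ht : 0 ≤ t
  · rw [if_pos ht, indicator_of_mem (by exact ht), Complex.real_smul]; push_cast; rfl
  · rw [if_neg ht, indicator_of_notMem (by exact ht), zero_smul]

theorem ae_expMeasure_pos (hr : 0 < r) : ∀ᵐ t ∂expMeasure r, 0 < t := by
  have := isProbabilityMeasure_expMeasure hr
  rw [ae_iff]
  have h := cdf_expMeasure_eq hr 0
  have h2 : {t : ℝ | ¬ 0 < t} = Iic 0 := by ext; simp
  rw [h2]
  rw [cdf_eq_real] at h
  simpa [measureReal_eq_zero_iff] using h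

theorem expMeasure_real_Iic (hr : 0 < r) {t : ℝ} (ht : 0 ≤ t) :
    (expMeasure r).real (Iic t) = 1 - Real.exp (-(r * t)) := by
  have := isProbabilityMeasure_expMeasure hr
  have h := cdf_expMeasure_eq hr t
  rwa [cdf_eq_real, if_pos ht] at h

end Exponential

namespace CompoundPoisson

variable (p : CompoundPoisson) {s : ℝ}

instance : IsProbabilityMeasure (expMeasure p.rate) := isProbabilityMeasure_expMeasure p.rate_pos

/-- The joint law of the first interarrival time and the first jump. -/
def firstLaw : Measure (ℝ × ℝ) := (expMeasure p.rate).prod p.jumpLaw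

instance : IsProbabilityMeasure p.firstLaw := by unfold firstLaw; infer_instance

theorem ae_firstLaw_pos : ∀ᵐ r ∂p.firstLaw, 0 < r.1 ∧ 0 < r.2 := by
  have h1 : ∀ᵐ r ∂p.firstLaw, 0 < r.1 :=
    Measure.quasiMeasurePreserving_fst.ae (ae_expMeasure_pos p.rate_pos)
  have h2 : ∀ᵐ r ∂p.firstLaw, 0 < r.2 :=
    Measure.quasiMeasurePreserving_snd.ae p.ae_jump_pos
  exact h1.and h2

/-- The value after the first jump, or at the first passage of the distance `d` downwards if
that comes first, of a function of the distance from a level. -/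
theorem Harmonic.integral_firstLaw {H : ℝ → ℂ} (hH : p.Harmonic s H) (hs : 0 ≤ s) {y d : ℝ}
    (hy : 0 ≤ y) (hd : 0 ≤ d) :
    ∫ r, (if d < p.a * r.1 then Complex.exp (-s * (d / p.a : ℝ)) * H (y + d)
      else Complex.exp (-s * r.1) * H (y + p.a * r.1 - r.2)) ∂p.firstLaw = H y := by
  have ha := p.a_pos
  have hac : (p.a : ℂ) ≠ 0 := by exact_mod_cast ha.ne'
  set t₀ := d / p.a with ht₀
  have ht0 : 0 ≤ t₀ := div_nonneg hd ha.le
  have hlt : ∀ t, d < p.a * t ↔ t₀ < t := fun t => by rw [ht₀, div_lt_iff₀' ha]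
  obtain ⟨M, hM⟩ := hH.bounded (y + d)
  have hM0 : 0 ≤ M := (norm_nonneg _).trans (hM _ le_rfl)
  have hI : Integrable (fun r : ℝ × ℝ => if d < p.a * r.1 then
      Complex.exp (-s * t₀) * H (y + d)
      else Complex.exp (-s * r.1) * H (y + p.a * r.1 - r.2)) p.firstLaw := by
    refine Integrable.of_bound (C := M) (Measurable.aestronglyMeasurable ?_) ?_
    · refine Measurable.ite (measurableSet_lt measurable_const (by fun_prop)) (by fun_prop) ?_
      exact Measurable.mul (by fun_prop) (hH.measurable.comp (by fun_prop))
    · filter_upwards [p.ae_firstLaw_pos] with r hr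
      have hexp : ∀ t : ℝ, 0 ≤ t → ‖Complex.exp (-s * t)‖ ≤ 1 := fun t ht => by
        rw [Complex.norm_exp]; simp; positivity
      split_ifs with h
      · rw [norm_mul]
        calc _ ≤ 1 * M := mul_le_mul (hexp _ ht0) (hM _ le_rfl) (norm_nonneg _) zero_le_one
          _ = M := one_mul M
      · rw [norm_mul]
        calc _ ≤ 1 * M := mul_le_mul (hexp _ hr.1.le) (hM _ (by linarith [hr.2]))
              (norm_nonneg _) zero_le_one
          _ = M := one_mul M
  rw [firstLaw] at hI ⊢
  rw [integral_prod _ hI, integral_expMeasure p.rate_pos]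
  have hg : ∀ t : ℝ, (∫ j, (if d < p.a * t then Complex.exp (-s * t₀) * H (y + d)
      else Complex.exp (-s * t) * H (y + p.a * t - j)) ∂p.jumpLaw) =
      if t₀ < t then Complex.exp (-s * t₀) * H (y + d)
      else Complex.exp (-s * t) * ∫ j, H (y + p.a * t - j) ∂p.jumpLaw := fun t => by
    simp only [hlt]
    split_ifs with h
    · simp
    · rw [integral_const_mul]
  simp only [hg]
  have hexpI : IntegrableOn (fun t : ℝ => (p.rate * Complex.exp (-(p.rate * t)) : ℂ) *
      (Complex.exp (-s * t₀) * H (y + d))) (Ioi t₀) := by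
    have : IntegrableOn (fun t : ℝ => Complex.exp (-p.rate * t)) (Ioi t₀) :=
      integrableOn_exp_mul_complex_Ioi (by simpa using p.rate_pos) _
    simp only [neg_mul] at this
    exact (this.const_mul _).mul_const _
  have hsub : IntegrableOn (fun t : ℝ => (p.rate * Complex.exp (-(p.rate * t)) : ℂ) *
      (Complex.exp (-s * t) * ∫ j, H (y + p.a * t - j) ∂p.jumpLaw)) (Ioc 0 t₀) := by
    have hm : Measurable fun t : ℝ => ∫ j, H (y + p.a * t - j) ∂p.jumpLaw :=
      (p.measurable_integral_sub hH.measurable).comp (by fun_prop)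
    have h1 := intervalIntegrable_exp_mul (x := 0) (y := t₀) (M := M) hm (fun t ht => by
      rw [max_eq_right ht0] at ht
      refine p.norm_integral_sub_le hM ?_
      have : p.a * t ≤ p.a * t₀ := by gcongr
      rw [ht₀, mul_div_cancel₀ _ ha.ne'] at this
      linarith) (-(p.rate + s))
    rw [intervalIntegrable_iff, uIoc_of_le ht0] at h1
    refine (h1.const_mul p.rate).congr (ae_of_all _ fun t => ?_)
    simp only
    rw [mul_assoc, ← mul_assoc (Complex.exp _) (Complex.exp _), ← Complex.exp_add]
    congr 3; ring
  -- The drift through the distance d takes the time t₀ = d/a: a jump up to t₀ comes first, later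
  -- ones come after the passage.
  rw [← Ioc_union_Ioi_eq_Ioi ht0, setIntegral_union (Ioc_disjoint_Ioi le_rfl) measurableSet_Ioi]
  rotate_left
  · refine hsub.congr_fun (fun t ht => ?_) measurableSet_Ioc
    simp only [if_neg (not_lt.2 ht.2)]
  · refine hexpI.congr_fun (fun t ht => ?_) measurableSet_Ioi
    simp only [if_pos (show t₀ < t from ht)]
  have e1 : ∫ t in Ioi t₀, (p.rate * Complex.exp (-(p.rate * t)) : ℂ) *
      (if t₀ < t then Complex.exp (-s * t₀) * H (y + d)
      else Complex.exp (-s * t) * ∫ j, H (y + p.a * t - j) ∂p.jumpLaw) =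
      Complex.exp (-(p.kappa s * d)) * H (y + d) := by
    rw [setIntegral_congr_fun (g := fun t : ℝ => (p.rate : ℂ) *
      (Complex.exp (-s * t₀) * H (y + d)) * Complex.exp (-p.rate * t)) measurableSet_Ioi]
    · rw [integral_const_mul, integral_exp_mul_complex_Ioi (by simpa using p.rate_pos)]
      have hrc : (p.rate : ℂ) ≠ 0 := by exact_mod_cast p.rate_pos.ne'
      have : Complex.exp (-(p.kappa s * d)) =
          Complex.exp (-s * t₀) * Complex.exp (-p.rate * t₀) := by
        rw [← Complex.exp_add]; congr 1
        rw [kappa, ht₀]; push_cast; field_simp; ring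
      rw [this]; field_simp
    · intro t ht
      simp only [if_pos (show t₀ < t from ht)]
      rw [neg_mul (p.rate : ℂ)]; ring
  have e2 : ∫ t in Ioc 0 t₀, (p.rate * Complex.exp (-(p.rate * t)) : ℂ) *
      (if t₀ < t then Complex.exp (-s * t₀) * H (y + d)
      else Complex.exp (-s * t) * ∫ j, H (y + p.a * t - j) ∂p.jumpLaw) =
      p.rate / p.a * Complex.exp (p.kappa s * y) * ∫ v in y..y + d,
        Complex.exp (-(p.kappa s * v)) * ∫ j, H (v - j) ∂p.jumpLaw := by
    have hc := intervalIntegral.integral_comp_add_mul (a := 0) (b := t₀) (fun v : ℝ =>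
      (p.rate : ℂ) * Complex.exp (p.kappa s * y) *
        (Complex.exp (-(p.kappa s * v)) * ∫ j, H (v - j) ∂p.jumpLaw)) ha.ne' y
    rw [mul_zero, add_zero, ht₀, mul_div_cancel₀ _ ha.ne', ← ht₀] at hc
    rw [div_mul_eq_mul_div, div_mul_eq_mul_div, div_eq_inv_mul, ← Complex.ofReal_inv,
      ← Complex.real_smul, ← intervalIntegral.integral_const_mul, ← hc, intervalIntegral.integral_of_le ht0]
    refine setIntegral_congr_fun measurableSet_Ioc fun t ht => ?_
    simp only [if_neg (not_lt.2 ht.2)]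
    rw [mul_assoc, mul_assoc, ← mul_assoc (Complex.exp _) (Complex.exp _), ← Complex.exp_add,
      ← mul_assoc (Complex.exp (_ * _)) (Complex.exp _), ← Complex.exp_add]
    congr 3
    rw [kappa]; push_cast; field_simp; ring
  rw [e1, e2]
  have hEy := hH.eq y hy
  have hEd := hH.eq (y + d) (by linarith)
  have hadd := intervalIntegral.integral_add_adjacent_intervals
    (p.intervalIntegrable_exp_mul_integral hH.measurable hH.bounded (p.kappa s) 0 y)
    (p.intervalIntegrable_exp_mul_integral hH.measurable hH.bounded (p.kappa s) y (y + d))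
  -- The claim is the harmonic equation at y + d minus the one at y, multiplied by e^{κy}.
  rw [← hadd, ← hEy, mul_add, ← add_assoc, add_right_comm, add_left_inj] at hEd
  have h1 : Complex.exp (-(p.kappa s * d)) =
      Complex.exp (p.kappa s * y) * Complex.exp (-(p.kappa s * (y + d : ℝ))) := by
    rw [← Complex.exp_add]; congr 1; push_cast; ring
  have h2 : Complex.exp (p.kappa s * y) * Complex.exp (-(p.kappa s * y)) = 1 := by
    rw [← Complex.exp_add]; simp
  rw [h1]
  linear_combination Complex.exp (p.kappa s * y) * hEd + H y * h2

end CompoundPoisson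

/-! ### Product noise and its reindexings -/

section Noise

/-- The index set of the noise: interarrival times on the left, jumps on the right. -/
abbrev NoiseIndex : Type := (Regime × ℕ × ℕ) ⊕ (Regime × ℕ × ℕ)

/-- The space of values of the noise. -/
abbrev Noise : Type := NoiseIndex → ℝ

/-- The laws of the coordinates of the noise. -/
def noiseLaw (p : Regime → CompoundPoisson) : NoiseIndex → Measure ℝ :=
  Sum.elim (fun j => expMeasure (p j.1).rate) (fun j => (p j.1).jumpLaw)

instance (p : Regime → CompoundPoisson) (i : NoiseIndex) :
    IsProbabilityMeasure (noiseLaw p i) := by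
  cases i <;> simp only [noiseLaw, Sum.elim_inl, Sum.elim_inr] <;> infer_instance

/-- The law of the noise. -/
def noiseMeasure (p : Regime → CompoundPoisson) : Measure Noise :=
  Measure.infinitePi (noiseLaw p)

instance (p : Regime → CompoundPoisson) : IsProbabilityMeasure (noiseMeasure p) := by
  unfold noiseMeasure; infer_instance

/-- Independent coordinates off the range of an injection `e` are jointly independent of the
reindexed family. -/
theorem map_infinitePi_pair_comp {ι : Type*} {ν : ι → Measure ℝ} [∀ i, IsProbabilityMeasure (ν i)]
    {e : ι → ι} (he : Function.Injective e) (hν : ∀ i, ν (e i) = ν i) {q₁ q₂ : ι} (hq : q₁ ≠ q₂)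
    (h₁ : q₁ ∉ range e) (h₂ : q₂ ∉ range e) :
    (Measure.infinitePi ν).map (fun ω => ((ω q₁, ω q₂), fun i => ω (e i))) =
      ((ν q₁).prod (ν q₂)).prod (Measure.infinitePi ν) := by
  have hind : iIndepFun (fun (i : ι) (ω : ι → ℝ) => ω i) (Measure.infinitePi ν) :=
    iIndepFun_infinitePi (X := fun _ ω => ω) (by fun_prop)
  have hd : Disjoint ({q₁, q₂} : Set ι) (range e) := by
    rw [disjoint_left]
    rintro i (rfl | rfl)
    · exact h₁
    · exact h₂
  have h := indep_iSup_of_disjoint (m := fun i : ι => MeasurableSpace.comap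
    (fun ω : ι → ℝ => ω i) inferInstance) (fun i => (measurable_pi_apply i).comap_le) hind.iIndep hd
  have hI : IndepFun (fun ω : ι → ℝ => (ω q₁, ω q₂)) (fun ω i => ω (e i))
      (Measure.infinitePi ν) := by
    refine indep_of_indep_of_le_left (indep_of_indep_of_le_right h ?_) ?_
    · rw [MeasurableSpace.pi, MeasurableSpace.comap_iSup]
      refine iSup_le fun i => ?_
      rw [MeasurableSpace.comap_comp]
      exact le_iSup₂_of_le (e i) (mem_range_self i) le_rfl
    · rw [Prod.instMeasurableSpace, MeasurableSpace.prod, MeasurableSpace.comap_sup, MeasurableSpace.comap_comp, MeasurableSpace.comap_comp]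
      exact sup_le (le_iSup₂_of_le q₁ (Or.inl rfl) le_rfl)
        (le_iSup₂_of_le q₂ (Or.inr rfl) le_rfl)
  rw [(indepFun_iff_map_prod_eq_prod_map_map (Measurable.aemeasurable (by fun_prop))
    (Measurable.aemeasurable (by fun_prop))).1 hI,
    Measure.map_infinitePi_infinitePi_of_inj he]
  congr 1
  · rw [(indepFun_iff_map_prod_eq_prod_map_map (measurable_pi_apply _).aemeasurable
      (measurable_pi_apply _).aemeasurable).1 (hind.indepFun hq),
      Measure.infinitePi_map_eval, Measure.infinitePi_map_eval]
  · simp only [hν]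

/-- The reindexing that drops the first interarrival time and jump of the copy `0` of the process
with index `i`. -/
def dropJump : Regime → Regime × ℕ × ℕ → Regime × ℕ × ℕ
  | .lower, (.lower, 0, k) => (.lower, 0, k + 1)
  | .upper, (.upper, 0, k) => (.upper, 0, k + 1)
  | _, q => q

/-- The reindexing that drops the copies `0` of both processes. -/
def dropStage (q : Regime × ℕ × ℕ) : Regime × ℕ × ℕ := (q.1, q.2.1 + 1, q.2.2)

theorem dropJump_injective (i : Regime) : Function.Injective (dropJump i) := by
  rintro ⟨i₁, n₁, k₁⟩ ⟨i₂, n₂, k₂⟩ h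
  cases i <;> cases i₁ <;> cases i₂ <;> cases n₁ <;> cases n₂ <;> simp_all [dropJump]

theorem dropStage_injective : Function.Injective dropStage := by
  rintro ⟨i₁, n₁, k₁⟩ ⟨i₂, n₂, k₂⟩ h
  simpa [dropStage] using h

theorem dropJump_fst (i : Regime) (q : Regime × ℕ × ℕ) : (dropJump i q).1 = q.1 := by
  obtain ⟨i₁, n₁, k₁⟩ := q
  cases i <;> cases i₁ <;> cases n₁ <;> rfl

theorem dropJump_ne (i : Regime) (q : Regime × ℕ × ℕ) : dropJump i q ≠ (i, 0, 0) := by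
  obtain ⟨i₁, n₁, k₁⟩ := q
  cases i <;> cases i₁ <;> cases n₁ <;> simp [dropJump]

theorem dropJump_succ (i i' : Regime) (n k : ℕ) :
    dropJump i (i', n + 1, k) = (i', n + 1, k) := by
  cases i <;> cases i' <;> rfl

theorem dropJump_zero (i : Regime) (k : ℕ) : dropJump i (i, 0, k) = (i, 0, k + 1) := by
  cases i <;> rfl

/-- The noise reindexed by `f`, for the interarrival times and the jumps alike. -/
def Noise.reindex (f : Regime × ℕ × ℕ → Regime × ℕ × ℕ) (ω : Noise) : Noise :=
  fun q => ω (Sum.map f f q)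

theorem Noise.measurable_reindex (f : Regime × ℕ × ℕ → Regime × ℕ × ℕ) :
    Measurable (Noise.reindex f) :=
  measurable_pi_lambda _ fun _ => measurable_pi_apply _

/-- The first interarrival time and the first jump of the copy `0` of the process `i`. -/
def Noise.first (i : Regime) (ω : Noise) : ℝ × ℝ := (ω (.inl (i, 0, 0)), ω (.inr (i, 0, 0)))

theorem Noise.measurable_first (i : Regime) : Measurable (Noise.first i) := by
  unfold Noise.first; fun_prop

/-- The reindexing is injective, respects the regimes and misses the first pair; hence the reindexed
noise has the law of the whole noise and is independent of that pair. -/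
theorem map_first_reindex (p : Regime → CompoundPoisson) (i : Regime)
    {f : Regime × ℕ × ℕ → Regime × ℕ × ℕ} (hf : Function.Injective f) (hf1 : ∀ q, (f q).1 = q.1)
    (hf0 : ∀ q, f q ≠ (i, 0, 0)) :
    (noiseMeasure p).map (fun ω => (ω.first i, ω.reindex f)) =
      (p i).firstLaw.prod (noiseMeasure p) := by
  refine map_infinitePi_pair_comp (ν := noiseLaw p) (e := Sum.map f f) (q₁ := .inl (i, 0, 0))
    (q₂ := .inr (i, 0, 0)) (Sum.map_injective.2 ⟨hf, hf⟩) ?_ (by simp) ?_ ?_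
  · rintro (q | q) <;> simp [noiseLaw, hf1]
  · rintro ⟨q | q, hq⟩
    · exact hf0 q (Sum.inl.inj hq)
    · cases hq
  · rintro ⟨q | q, hq⟩
    · cases hq
    · exact hf0 q (Sum.inr.inj hq)

end Noise

/-! ### The embedded chain of jumps and passages -/

section Chain

variable (p : Regime → CompoundPoisson) (B b : ℝ)

/-- The states of the chain: the clock, the position, and the noise still to be used. -/
abbrev ChainState : Type := (ℝ≥0 × ℝ) × Noise

/-- The level at which a passage downwards in the given regime ends. -/
def floorLevel : Regime → ℝ
  | .lower => 0
  | .upper => b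

open Classical in
/-- The regime in force at a position. -/
def sideOf (x : ℝ) : Regime := if x ≤ b then .lower else .upper

open Classical in
/-- The duration of a move from `x` and the position after it, when the next jump `r.2` is to
come after the time `r.1`: the move ends at the floor or with the jump. -/
def move (i : Regime) (x : ℝ) (r : ℝ × ℝ) : ℝ≥0 × ℝ :=
  if x - floorLevel b i < (p i).a * r.1 then
    (((x - floorLevel b i) / (p i).a).toNNReal, floorLevel b i)
  else (r.1.toNNReal, x - (p i).a * r.1 + r.2)

/-- The noise in use is kept when the move ends with a jump that does not change the side. -/
def keepsCopy (i : Regime) (x : ℝ) : Set (ℝ × ℝ) :=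
  {r | ¬ x - floorLevel b i < (p i).a * r.1 ∧
    (x ≤ b ↔ x - (p i).a * r.1 + r.2 ≤ b)}

open Classical in
/-- A move of the chain in the regime `i`. -/
def stepIn (i : Regime) (σ : ChainState) : ChainState :=
  ((σ.1.1 + (move p b i σ.1.2 (σ.2.first i)).1, (move p b i σ.1.2 (σ.2.first i)).2),
    if σ.2.first i ∈ keepsCopy p b i σ.1.2 then σ.2.reindex (dropJump i)
    else σ.2.reindex dropStage)

open Classical in
/-- A move of the chain; the chain stops when it leaves `(0, B]`. -/
def chainStep (σ : ChainState) : ChainState :=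
  if σ.1.2 ∈ Ioc 0 B then stepIn p b (sideOf b σ.1.2) σ else σ

theorem measurable_move_aux (i : Regime) :
    Measurable fun q : ℝ × (ℝ × ℝ) => move p b i q.1 q.2 := by
  unfold move
  refine Measurable.ite (measurableSet_lt (by fun_prop) (by fun_prop)) ?_ ?_
  · exact (measurable_real_toNNReal.comp (by fun_prop)).prodMk measurable_const
  · exact (measurable_real_toNNReal.comp (by fun_prop)).prodMk (by fun_prop)

theorem measurableSet_keepsCopy_aux (i : Regime) :
    MeasurableSet {q : ℝ × (ℝ × ℝ) | q.2 ∈ keepsCopy p b i q.1} := by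
  unfold keepsCopy
  simp only [mem_ofPred_eq]
  have h0 : MeasurableSet {q : ℝ × (ℝ × ℝ) | q.1 - floorLevel b i < (p i).a * q.2.1} :=
    measurableSet_lt (by fun_prop) (by fun_prop)
  have h1 : MeasurableSet {q : ℝ × (ℝ × ℝ) | q.1 ≤ b} :=
    measurableSet_le (by fun_prop) (by fun_prop)
  have h2 : MeasurableSet {q : ℝ × (ℝ × ℝ) | q.1 - (p i).a * q.2.1 + q.2.2 ≤ b} :=
    measurableSet_le (by fun_prop) (by fun_prop)
  have h3 : {q : ℝ × (ℝ × ℝ) | q.1 ≤ b ↔ q.1 - (p i).a * q.2.1 + q.2.2 ≤ b} =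
      ({q | q.1 ≤ b} ∩ {q | q.1 - (p i).a * q.2.1 + q.2.2 ≤ b}) ∪
      ({q | q.1 ≤ b}ᶜ ∩ {q | q.1 - (p i).a * q.2.1 + q.2.2 ≤ b}ᶜ) := by
    ext q; simp only [mem_ofPred_eq, mem_union, mem_inter_iff, mem_compl_iff]; tauto
  have h4 := (h1.inter h2).union (h1.compl.inter h2.compl)
  rw [← h3] at h4
  exact h0.compl.inter h4

theorem measurable_stepIn (i : Regime) : Measurable (stepIn p b i) := by
  have hq : Measurable fun σ : ChainState => (σ.1.2, σ.2.first i) :=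
    (measurable_snd.comp measurable_fst).prodMk ((Noise.measurable_first i).comp measurable_snd)
  have hm := (measurable_move_aux p b i).comp hq
  refine Measurable.prodMk (Measurable.prodMk ?_ (measurable_snd.comp hm)) ?_
  · exact (measurable_fst.comp measurable_fst).add (measurable_fst.comp hm)
  · refine Measurable.ite (hq (measurableSet_keepsCopy_aux p b i)) ?_ ?_
    · exact (Noise.measurable_reindex _).comp measurable_snd
    · exact (Noise.measurable_reindex _).comp measurable_snd

theorem measurable_chainStep : Measurable (chainStep p B b) := by
  unfold chainStep
  have h2 : Measurable fun σ : ChainState => σ.1.2 := measurable_snd.comp measurable_fst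
  refine Measurable.ite (h2 measurableSet_Ioc) ?_ measurable_id
  have : (fun σ : ChainState => stepIn p b (sideOf b σ.1.2) σ) = fun σ =>
      if σ.1.2 ≤ b then stepIn p b .lower σ else stepIn p b .upper σ := by
    funext σ; unfold sideOf; split_ifs <;> rfl
  rw [this]
  exact Measurable.ite (h2 measurableSet_Iic) (measurable_stepIn p b _) (measurable_stepIn p b _)

/-- The Markov property of the chain. Which reindexing is applied depends on the first pair alone,
and for either one the remaining noise is fresh and independent of that pair. -/
theorem map_stepIn (i : Regime) (τ : ℝ≥0) (x : ℝ) :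
    (noiseMeasure p).map (fun ω => stepIn p b i ((τ, x), ω)) =
      ((p i).firstLaw.map fun r => (τ + (move p b i x r).1, (move p b i x r).2)).prod
        (noiseMeasure p) := by
  classical
  have hmv : Measurable fun r : ℝ × ℝ => (τ + (move p b i x r).1, (move p b i x r).2) := by
    have := (measurable_move_aux p b i).comp (measurable_const (a := x).prodMk measurable_id)
    exact (measurable_const.add (measurable_fst.comp this)).prodMk (measurable_snd.comp this)
  have hks : MeasurableSet (keepsCopy p b i x) :=
    (measurable_const (a := x).prodMk measurable_id) (measurableSet_keepsCopy_aux p b i)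
  have hst : Measurable fun ω : Noise => stepIn p b i ((τ, x), ω) :=
    (measurable_stepIn p b i).comp (measurable_const.prodMk measurable_id)
  refine Measure.ext_of_lintegral _ fun Φ hΦ => ?_
  rw [lintegral_map hΦ hst, lintegral_prod _ hΦ.aemeasurable,
    lintegral_map (hΦ.lintegral_prod_right') hmv]
  let Ψ : (ℝ × ℝ) × Noise → ℝ≥0∞ := fun q =>
    Φ ((τ + (move p b i x q.1).1, (move p b i x q.1).2), q.2)
  have hΨ : Measurable Ψ :=
    hΦ.comp ((hmv.comp measurable_fst).prodMk measurable_snd)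
  -- Restricts to an event S of the first pair, so that the two reindexings can be treated
  -- separately and then added.
  have hK (S : Set (ℝ × ℝ)) (hS : MeasurableSet S) (f : Regime × ℕ × ℕ → Regime × ℕ × ℕ)
      (hf : Function.Injective f) (hf1 : ∀ q, (f q).1 = q.1) (hf0 : ∀ q, f q ≠ (i, 0, 0)) :
      ∫⁻ ω, (Prod.fst ⁻¹' S).indicator Ψ (ω.first i, ω.reindex f) ∂noiseMeasure p =
        ∫⁻ r, S.indicator (fun r => ∫⁻ ω, Ψ (r, ω) ∂noiseMeasure p) r ∂(p i).firstLaw := by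
    have hm : Measurable ((Prod.fst ⁻¹' S).indicator Ψ) := hΨ.indicator (measurable_fst hS)
    have := lintegral_map (μ := noiseMeasure p) hm
      ((Noise.measurable_first i).prodMk (Noise.measurable_reindex f))
    rw [← this, map_first_reindex p i hf hf1 hf0, lintegral_prod _ hm.aemeasurable]
    congr 1; funext r
    by_cases hr : r ∈ S
    · simp [indicator, hr]
    · simp [indicator, hr]
  have h1 := hK _ hks (dropJump i) (dropJump_injective i) (dropJump_fst i) (dropJump_ne i)
  have h2 := hK _ hks.compl dropStage dropStage_injective (fun _ => rfl)
    (fun q hq => by simp [dropStage] at hq)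
  have e : (fun ω => Φ (stepIn p b i ((τ, x), ω))) = fun ω : Noise =>
      (Prod.fst ⁻¹' keepsCopy p b i x).indicator Ψ (ω.first i, ω.reindex (dropJump i)) +
      (Prod.fst ⁻¹' (keepsCopy p b i x)ᶜ).indicator Ψ (ω.first i, ω.reindex dropStage) := by
    funext ω
    by_cases hω : ω.first i ∈ keepsCopy p b i x
    · simp [stepIn, indicator, hω, Ψ]
    · simp [stepIn, indicator, hω, Ψ]
  have hm1 : Measurable fun r => ∫⁻ ω, Ψ (r, ω) ∂noiseMeasure p := hΨ.lintegral_prod_right'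
  rw [e, lintegral_add_left, h1, h2, ← lintegral_add_left (hm1.indicator hks)]
  · congr 1; funext r
    exact congrFun (indicator_self_add_compl (keepsCopy p b i x)
      (fun r => ∫⁻ ω, Ψ (r, ω) ∂noiseMeasure p)) r
  · exact (hΨ.indicator (measurable_fst hks)).comp
      ((Noise.measurable_first i).prodMk (Noise.measurable_reindex _))

end Chain

/-! ### Invariant expectations along the chain, and its termination -/

section ChainExpectation

variable (p : Regime → CompoundPoisson) (B b : ℝ)

theorem measurable_iterate_chainStep (n : ℕ) : Measurable (chainStep p B b)^[n] :=
  (measurable_chainStep p B b).iterate n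

theorem measurable_move (i : Regime) (x : ℝ) : Measurable (move p b i x) :=
  (measurable_move_aux p b i).comp (measurable_const.prodMk measurable_id)

theorem integral_chainStep {E : Type*} [NormedAddCommGroup E] [NormedSpace ℝ E]
    {g : ChainState → E} (hg : StronglyMeasurable g) {M : ℝ} (hM : ∀ σ, ‖g σ‖ ≤ M) (τ : ℝ≥0)
    {x : ℝ} (hx : x ∈ Ioc 0 B) :
    ∫ ω, g (chainStep p B b ((τ, x), ω)) ∂noiseMeasure p =
      ∫ r, (∫ ω, g ((τ + (move p b (sideOf b x) x r).1, (move p b (sideOf b x) x r).2), ω)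
        ∂noiseMeasure p) ∂(p (sideOf b x)).firstLaw := by
  have h1 : (fun ω => g (chainStep p B b ((τ, x), ω))) =
      fun ω => g (stepIn p b (sideOf b x) ((τ, x), ω)) := by
    funext ω; rw [chainStep, if_pos hx]
  have hst : Measurable fun ω : Noise => stepIn p b (sideOf b x) ((τ, x), ω) :=
    (measurable_stepIn p b _).comp (measurable_const.prodMk measurable_id)
  have hmv : Measurable fun r : ℝ × ℝ =>
      (τ + (move p b (sideOf b x) x r).1, (move p b (sideOf b x) x r).2) := by
    have := measurable_move p b (sideOf b x) x
    exact (measurable_const.add (measurable_fst.comp this)).prodMk (measurable_snd.comp this)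
  have := Measure.isProbabilityMeasure_map (μ := (p (sideOf b x)).firstLaw) hmv.aemeasurable
  rw [h1, ← integral_map (φ := fun ω => stepIn p b (sideOf b x) ((τ, x), ω)) hst.aemeasurable
    hg.aestronglyMeasurable, map_stepIn, integral_prod _ (Integrable.of_bound
    hg.aestronglyMeasurable M (ae_of_all _ hM)), integral_map hmv.aemeasurable]
  exact hg.integral_prod_right'.aestronglyMeasurable

/-- A function preserved by one discounted move is preserved by any number of moves. Outside (0, B]
the chain stands still, so nothing is required there. -/
theorem integral_iterate_chainStep {s : ℝ} (hs : 0 ≤ s) {u : ℝ → ℂ} (hu : Measurable u) {M : ℝ}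
    (hM : ∀ x, ‖u x‖ ≤ M)
    (hstep : ∀ x ∈ Ioc 0 B, ∫ r, Complex.exp (-s * ((move p b (sideOf b x) x r).1 : ℝ)) *
      u (move p b (sideOf b x) x r).2 ∂(p (sideOf b x)).firstLaw = u x) (n : ℕ) (τ : ℝ≥0) (x : ℝ) :
    ∫ ω, Complex.exp (-s * (((chainStep p B b)^[n] ((τ, x), ω)).1.1 : ℝ)) *
      u ((chainStep p B b)^[n] ((τ, x), ω)).1.2 ∂noiseMeasure p =
      Complex.exp (-s * (τ : ℝ)) * u x := by
  let f : ChainState → ℂ := fun σ => Complex.exp (-s * (σ.1.1 : ℝ)) * u σ.1.2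
  have hf : Measurable f := by
    refine Measurable.mul ?_ (hu.comp (measurable_snd.comp measurable_fst))
    have : Measurable fun σ : ChainState => (σ.1.1 : ℝ) :=
      measurable_coe_nnreal_real.comp (measurable_fst.comp measurable_fst)
    fun_prop
  have hfM : ∀ σ, ‖f σ‖ ≤ M := fun σ => by
    have h1 : ‖Complex.exp (-s * (σ.1.1 : ℝ))‖ ≤ 1 := by
      rw [Complex.norm_exp]; simp; positivity
    calc ‖f σ‖ = ‖Complex.exp (-s * (σ.1.1 : ℝ))‖ * ‖u σ.1.2‖ := norm_mul _ _
      _ ≤ 1 * M := mul_le_mul h1 (hM _) (norm_nonneg _) zero_le_one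
      _ = M := one_mul M
  change ∫ ω, f ((chainStep p B b)^[n] ((τ, x), ω)) ∂noiseMeasure p = _
  induction n generalizing τ x with
  | zero => simp [f]
  | succ n ih =>
    simp only [Function.iterate_succ_apply]
    by_cases hx : x ∈ Ioc 0 B
    · rw [integral_chainStep p B b (g := fun σ => f ((chainStep p B b)^[n] σ))
        (hf.comp (measurable_iterate_chainStep p B b n)).stronglyMeasurable (fun σ => hfM _) τ hx]
      simp only [ih]
      rw [← hstep x hx, ← integral_const_mul]
      congr 1; funext r
      rw [← mul_assoc, ← Complex.exp_add]
      congr 2; push_cast; ring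
    · have : ∀ ω, chainStep p B b ((τ, x), ω) = ((τ, x), ω) := fun ω => by
        rw [chainStep, if_neg hx]
      simp only [this]
      exact ih τ x

/-- A bounded function of the position that the chain contracts until it stops. -/
theorem exists_contraction (hB : 0 < B) (hb : b ∈ Icc 0 B) :
    ∃ θ : ℝ → ℝ, Measurable θ ∧ (∀ x, 0 ≤ θ x ∧ θ x ≤ 2) ∧ (∀ x ∈ Ioc 0 B, 1 ≤ θ x) ∧
      ∃ ρ, 0 ≤ ρ ∧ ρ < 1 ∧ ∀ x, (x ∈ Ioc 0 B → ∫ r, θ (move p b (sideOf b x) x r).2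
        ∂(p (sideOf b x)).firstLaw ≤ ρ * θ x) ∧ (x ∉ Ioc 0 B → θ x = 0) := by
  classical
  -- the probability that a jump occurs before a passage through the distance `B`
  let ρ' : Regime → ℝ := fun i => 1 - Real.exp (-((p i).rate * (B / (p i).a)))
  have hρ0 : ∀ i, 0 ≤ ρ' i := fun i => by
    have : Real.exp (-((p i).rate * (B / (p i).a))) ≤ 1 := by
      rw [Real.exp_le_one_iff]
      have := (p i).rate_pos; have := (p i).a_pos; have := hB.le
      rw [neg_nonpos]; positivity
    simp only [ρ']; linarith
  have hρ1 : ∀ i, ρ' i < 1 := fun i => by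
    simp only [ρ']; linarith [Real.exp_pos (-((p i).rate * (B / (p i).a)))]
  have hjump : ∀ i d, d ≤ B → (p i).firstLaw.real {r | ¬ d < (p i).a * r.1} ≤ ρ' i := by
    intro i d hd
    have ha := (p i).a_pos
    have h1 : {r : ℝ × ℝ | ¬ d < (p i).a * r.1} ⊆ Iic (B / (p i).a) ×ˢ univ := by
      rintro r hr
      have hr : (p i).a * r.1 ≤ d := not_lt.1 hr
      refine ⟨?_, mem_univ _⟩
      rw [mem_Iic, le_div_iff₀' ha]; linarith
    refine (measureReal_mono h1).trans ?_
    rw [CompoundPoisson.firstLaw, measureReal_prod_prod, probReal_univ, mul_one,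
      expMeasure_real_Iic (p i).rate_pos (div_nonneg hB.le ha.le)]
  set δ := 1 - ρ' .lower with hδ
  have hδ0 : 0 < δ := by have := hρ1 .lower; linarith
  have hδ1 : δ ≤ 1 := by have := hρ0 .lower; linarith
  -- A jump may lead from below b to above it, while a passage from above leads to b; the weight 1 +
  -- δ above b makes that passage a strict gain. The choice δ = exp(-λ₁B/a₁), a lower bound for the
  -- probability of drifting to 0 before a jump, keeps the possible loss below b in check.
  let θ : ℝ → ℝ := fun x => if x ≤ 0 then 0 else if x ≤ b then 1 else if x ≤ B then 1 + δ else 0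
  have hθm : Measurable θ :=
    Measurable.ite measurableSet_Iic measurable_const (Measurable.ite measurableSet_Iic
      measurable_const (Measurable.ite measurableSet_Iic measurable_const measurable_const))
  have hθ : ∀ x, 0 ≤ θ x ∧ θ x ≤ 1 + δ := fun x => by
    simp only [θ]; split_ifs <;> constructor <;> linarith
  have hint : ∀ (i : Regime) (x c : ℝ), 0 ≤ c → θ (floorLevel b i) ≤ c →
      x - floorLevel b i ≤ B → ∫ r, θ (move p b i x r).2 ∂(p i).firstLaw ≤
        c + (1 + δ - c) * (p i).firstLaw.real {r | ¬ x - floorLevel b i < (p i).a * r.1} := by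
    intro i x c hc0 hc hxB
    set S := {r : ℝ × ℝ | ¬ x - floorLevel b i < (p i).a * r.1} with hS
    have hSm : MeasurableSet S := by
      have : MeasurableSet {r : ℝ × ℝ | x - floorLevel b i < (p i).a * r.1} :=
        measurableSet_lt measurable_const (by fun_prop)
      exact this.compl
    have hle : ∀ r, θ (move p b i x r).2 ≤ c + S.indicator (fun _ => 1 + δ - c) r := fun r => by
      by_cases hr : r ∈ S
      · rw [indicator_of_mem hr]; linarith [(hθ (move p b i x r).2).2]
      · rw [indicator_of_notMem hr, add_zero, move, if_pos (not_not.1 hr)]; exact hc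
    have hi : Integrable (fun r => c + S.indicator (fun _ => 1 + δ - c) r) (p i).firstLaw :=
      (integrable_const _).add ((integrable_const _).indicator hSm)
    refine (integral_mono (Integrable.of_bound (C := 1 + δ)
      (hθm.comp (measurable_snd.comp (measurable_move p b i x))).aestronglyMeasurable
      (ae_of_all _ fun r => ?_)) hi hle).trans (le_of_eq ?_)
    · rw [Function.comp_apply, Real.norm_of_nonneg (hθ _).1]; exact (hθ _).2
    · rw [integral_add (integrable_const _) ((integrable_const _).indicator hSm),
        integral_indicator_const _ hSm]
      simp [mul_comm]
  -- At or below b the passage leads to θ = 0, giving the factor (1 + δ)(1 - δ). Above b it leads to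
  -- θ ≤ 1, giving (1 + δρ'₂)/(1 + δ), where ρ'₂ = ρ' .upper. Both are less than 1.
  set ρ := max ((1 + δ) * ρ' .lower) ((1 + δ * ρ' .upper) / (1 + δ)) with hρ
  refine ⟨θ, hθm, fun x => ⟨(hθ x).1, (hθ x).2.trans (by linarith)⟩, fun x hx => ?_, ρ, ?_, ?_,
    fun x => ⟨fun hx => ?_, fun hx => ?_⟩⟩
  · simp only [θ, if_neg (not_le.2 hx.1), if_pos hx.2]
    split_ifs <;> linarith
  · exact le_max_of_le_left (mul_nonneg (by linarith) (hρ0 _))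
  · refine max_lt ?_ ?_
    · have : ρ' .lower = 1 - δ := by rw [hδ]; ring
      rw [this]; nlinarith
    · rw [div_lt_one (by linarith)]
      nlinarith [hρ1 .upper]
  · by_cases hxb : x ≤ b
    · have hside : sideOf b x = .lower := if_pos hxb
      have hθx : θ x = 1 := by simp only [θ, if_neg (not_le.2 hx.1), if_pos hxb]
      rw [hside, hθx, mul_one]
      refine (hint .lower x 0 le_rfl (by simp [θ, floorLevel])
        (by simp [floorLevel]; exact hx.2)).trans ?_
      rw [zero_add, sub_zero]
      refine le_trans ?_ (le_max_left _ _)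
      gcongr
      exact hjump _ _ (by simp [floorLevel]; exact hx.2)
    · have hside : sideOf b x = .upper := if_neg hxb
      have hθx : θ x = 1 + δ := by
        simp only [θ, if_neg (not_le.2 hx.1), if_neg hxb, if_pos hx.2]
      rw [hside, hθx]
      refine (hint .upper x 1 zero_le_one ?_ (by simp [floorLevel]; linarith [hx.2, hb.1])).trans ?_
      · simp only [θ, floorLevel]; split_ifs <;> linarith
      · have h1 : (1 + δ * ρ' .upper) / (1 + δ) * (1 + δ) ≤ ρ * (1 + δ) := by
          gcongr; exact le_max_right _ _
        rw [div_mul_cancel₀ _ (by linarith)] at h1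
        refine le_trans ?_ h1
        rw [add_sub_cancel_left]
        gcongr
        exact hjump _ _ (by simp [floorLevel]; linarith [hx.2, hb.1])
  · simp only [θ]
    split_ifs with h1 h2 h3
    · rfl
    · exact absurd ⟨not_le.1 h1, h2.trans hb.2⟩ hx
    · exact absurd ⟨not_le.1 h1, h3⟩ hx
    · rfl

/-- The chain stops almost surely. -/
theorem ae_chain_stops (hB : 0 < B) (hb : b ∈ Icc 0 B) (τ : ℝ≥0) (x : ℝ) :
    ∀ᵐ ω ∂noiseMeasure p, ∃ n, ((chainStep p B b)^[n] ((τ, x), ω)).1.2 ∉ Ioc 0 B := by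
  obtain ⟨θ, hθm, hθ, hθ1, ρ, hρ0, hρ1, hρ⟩ := exists_contraction p B b hB hb
  let g : ChainState → ℝ := fun σ => θ σ.1.2
  have hg : Measurable g := hθm.comp (measurable_snd.comp measurable_fst)
  have hgn : ∀ σ, ‖g σ‖ ≤ 2 := fun σ => by
    rw [Real.norm_of_nonneg (hθ _).1]; exact (hθ _).2
  have key : ∀ n τ x, ∫ ω, g ((chainStep p B b)^[n] ((τ, x), ω)) ∂noiseMeasure p ≤
      ρ ^ n * θ x := by
    intro n
    induction n with
    | zero => intro τ x; simp [g]
    | succ n ih =>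
      intro τ x
      simp only [Function.iterate_succ_apply]
      by_cases hx : x ∈ Ioc 0 B
      · rw [integral_chainStep p B b (g := fun σ => g ((chainStep p B b)^[n] σ))
          (hg.comp (measurable_iterate_chainStep p B b n)).stronglyMeasurable (fun σ => hgn _) τ hx]
        have hi : Integrable (fun r => θ (move p b (sideOf b x) x r).2)
            (p (sideOf b x)).firstLaw :=
          Integrable.of_bound (C := 2)
            (hθm.comp (measurable_snd.comp (measurable_move p b _ x))).aestronglyMeasurable
            (ae_of_all _ fun r => by rw [Real.norm_of_nonneg (hθ _).1]; exact (hθ _).2)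
        refine (integral_mono_of_nonneg (ae_of_all _ fun r => integral_nonneg fun ω => (hθ _).1)
          (hi.const_mul (ρ ^ n)) (ae_of_all _ fun r => ih _ _)).trans ?_
        rw [integral_const_mul, pow_succ, mul_assoc]
        gcongr
        exact (hρ x).1 hx
      · have : ∀ ω, chainStep p B b ((τ, x), ω) = ((τ, x), ω) := fun ω => by
          rw [chainStep, if_neg hx]
        simp only [this]
        refine (ih τ x).trans ?_
        rw [(hρ x).2 hx, mul_zero, mul_zero]
  let A : Set Noise := {ω | ∀ n, ((chainStep p B b)^[n] ((τ, x), ω)).1.2 ∈ Ioc 0 B}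
  -- Markov's inequality: θ ≥ 1 on (0, B], so the probability of not having stopped within n moves
  -- is at most 2ρⁿ.
  have hA : ∀ n, (noiseMeasure p).real A ≤ ρ ^ n * 2 := fun n => by
    let An : Set Noise := {ω | ((chainStep p B b)^[n] ((τ, x), ω)).1.2 ∈ Ioc 0 B}
    have hmeas : Measurable fun ω : Noise => (chainStep p B b)^[n] ((τ, x), ω) :=
      (measurable_iterate_chainStep p B b n).comp (measurable_const.prodMk measurable_id)
    have hAn : MeasurableSet An :=
      (measurable_snd.comp (measurable_fst.comp hmeas)) measurableSet_Ioc
    calc (noiseMeasure p).real A ≤ (noiseMeasure p).real An :=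
          measureReal_mono fun ω hω => hω n
      _ = ∫ ω, An.indicator (fun _ => (1 : ℝ)) ω ∂noiseMeasure p := by
          rw [integral_indicator_const _ hAn]; simp
      _ ≤ ∫ ω, g ((chainStep p B b)^[n] ((τ, x), ω)) ∂noiseMeasure p := by
          refine integral_mono ((integrable_const _).indicator hAn) (Integrable.of_bound (C := 2)
            (hg.comp hmeas).aestronglyMeasurable (ae_of_all _ fun ω => hgn _)) fun ω => ?_
          by_cases hω : ω ∈ An
          · rw [indicator_of_mem hω]; exact hθ1 _ hω
          · rw [indicator_of_notMem hω]; exact (hθ _).1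
      _ ≤ ρ ^ n * θ x := key n τ x
      _ ≤ ρ ^ n * 2 := by gcongr; exact (hθ x).2
  have h0 : (noiseMeasure p).real A = 0 := by
    have hlim := (tendsto_pow_atTop_nhds_zero_of_lt_one hρ0 hρ1).mul_const 2
    rw [zero_mul] at hlim
    exact le_antisymm (ge_of_tendsto' hlim hA) measureReal_nonneg
  rw [ae_iff]
  rw [measureReal_eq_zero_iff] at h0
  convert h0 using 2
  ext ω; simp [A]

end ChainExpectation

/-! ### Compound Poisson paths restarted at the first jump -/

section Paths

/-- Interarrival times that are positive and sum up to infinity. -/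
structure RegularClock (T : ℕ → ℝ) : Prop where
  pos : ∀ k, 0 < T k
  tendsto : Tendsto (fun n => ∑ k ∈ Finset.range n, T k) atTop atTop

theorem RegularClock.succ {T : ℕ → ℝ} (hT : RegularClock T) :
    RegularClock fun k => T (k + 1) where
  pos k := hT.pos _
  tendsto := by
    have h := (hT.tendsto.comp (tendsto_add_atTop_nat 1))
    have : (fun n => ∑ k ∈ Finset.range n, T (k + 1)) =
        fun n => -T 0 + ((fun n => ∑ k ∈ Finset.range n, T k) ∘ fun a => a + 1) n := by
      funext n
      simp only [Function.comp, Finset.sum_range_succ']; ring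
    rw [this]
    exact tendsto_atTop_add_const_left _ _ h

theorem countingPath_of_lt {T : ℕ → ℝ} (hT : RegularClock T) {t : ℝ≥0} (ht : (t : ℝ) < T 0) :
    countingPath T t = 0 := by
  have : {k : ℕ | ∑ j ∈ Finset.range (k + 1), T j ≤ t} = ∅ := by
    ext k
    simp only [mem_ofPred_eq, mem_empty_iff_false, iff_false, not_le]
    refine ht.trans_le ?_
    rw [Finset.sum_range_succ']
    have : 0 ≤ ∑ j ∈ Finset.range k, T (j + 1) := Finset.sum_nonneg fun j _ => (hT.pos _).le
    linarith
  rw [countingPath, this, ncard_empty]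

theorem countingPath_add {T : ℕ → ℝ} (hT : RegularClock T) {t₀ : ℝ≥0} (h0 : (t₀ : ℝ) = T 0)
    (r : ℝ≥0) : countingPath T (t₀ + r) = countingPath (fun k => T (k + 1)) r + 1 := by
  have hset : {k : ℕ | ∑ j ∈ Finset.range (k + 1), T j ≤ (t₀ + r : ℝ≥0)} =
      insert 0 (Nat.succ '' {k : ℕ | ∑ j ∈ Finset.range (k + 1), T (j + 1) ≤ r}) := by
    ext k
    cases k with
    | zero => simp [h0]
    | succ k =>
      simp only [mem_ofPred_eq, mem_insert_iff, mem_image, Nat.succ_eq_add_one,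
        Nat.add_eq_zero_iff, one_ne_zero, and_false, false_or, Nat.add_right_cancel_iff,
        exists_eq_right]
      rw [Finset.sum_range_succ' _ (k + 1), NNReal.coe_add, h0]
      constructor <;> intro h <;> linarith
  -- `Set.ncard` gives an infinite set the value 0, so the shift by one needs finiteness; it comes
  -- from the divergence of the clock.
  have hfin : {k : ℕ | ∑ j ∈ Finset.range (k + 1), T (j + 1) ≤ r}.Finite := by
    obtain ⟨N, hN⟩ := (hT.succ.tendsto.eventually_gt_atTop (r : ℝ)).exists_forall_of_atTop
    refine (finite_lt_nat N).subset fun k hk => ?_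
    by_contra hkN
    exact absurd (hN (k + 1) (by simp at hkN; omega)) (not_lt.2 hk)
  rw [countingPath, hset, ncard_insert_of_notMem (by simp) (hfin.image _),
    ncard_image_of_injective _ Nat.succ_injective, countingPath]

theorem compoundPath_of_lt {a : ℝ} {T J : ℕ → ℝ} (hT : RegularClock T) {t : ℝ≥0}
    (ht : (t : ℝ) < T 0) : compoundPath a T J t = -(a * t) := by
  rw [compoundPath, countingPath_of_lt hT ht]; simp

theorem compoundPath_zero {a : ℝ} {T J : ℕ → ℝ} (hT : RegularClock T) :
    compoundPath a T J 0 = 0 := by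
  rw [compoundPath_of_lt hT (by simpa using hT.pos 0)]; simp

theorem compoundPath_add {a : ℝ} {T J : ℕ → ℝ} (hT : RegularClock T) {t₀ : ℝ≥0}
    (h0 : (t₀ : ℝ) = T 0) (r : ℝ≥0) :
    compoundPath a T J (t₀ + r) =
      -(a * T 0) + J 0 + compoundPath a (fun k => T (k + 1)) (fun k => J (k + 1)) r := by
  rw [compoundPath, compoundPath, countingPath_add hT h0, Finset.sum_range_succ', NNReal.coe_add,
    h0]
  ring

theorem hitTime_le {w : ℝ≥0 → ℝ} {A : Set ℝ} {t : ℝ≥0} (h : w t ∈ A) : hitTime w A ≤ t :=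
  iInf₂_le t h

theorem le_hitTime {w : ℝ≥0 → ℝ} {A : Set ℝ} {t₀ : ℝ≥0} (h : ∀ t < t₀, w t ∉ A) :
    (t₀ : ℝ≥0∞) ≤ hitTime w A :=
  le_iInf₂ fun t ht => by
    by_contra hlt
    exact h t (by exact_mod_cast not_le.1 hlt) ht

theorem hitTime_eq {w : ℝ≥0 → ℝ} {A : Set ℝ} {t₀ : ℝ≥0} (h : ∀ t < t₀, w t ∉ A)
    (h0 : w t₀ ∈ A) : hitTime w A = t₀ :=
  le_antisymm (hitTime_le h0) (le_hitTime h)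

theorem hitTime_add {w : ℝ≥0 → ℝ} {A : Set ℝ} {t₀ : ℝ≥0} (h : ∀ t < t₀, w t ∉ A) :
    hitTime w A = t₀ + hitTime (fun r => w (t₀ + r)) A := by
  refine le_antisymm ?_ (le_iInf₂ fun t ht => ?_)
  · simp only [hitTime, ENNReal.add_iInf]
    refine le_iInf₂ fun r hr => ?_
    rw [← ENNReal.coe_add]
    exact iInf₂_le (t₀ + r) hr
  · have hle : t₀ ≤ t := by
      by_contra hlt
      exact h t (not_le.1 hlt) ht
    obtain ⟨r, rfl⟩ := exists_add_of_le hle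
    rw [ENNReal.coe_add]
    gcongr
    exact hitTime_le (w := fun r => w (t₀ + r)) ht

section Passage

variable {a : ℝ} {T J : ℕ → ℝ} {d : ℝ}

theorem tauMinus_of_lt (ha : 0 < a) (hT : RegularClock T) (hd : 0 ≤ d) (h : d < a * T 0) :
    tauMinus (compoundPath a T J) d = (d / a).toNNReal := by
  have hda : 0 ≤ d / a := div_nonneg hd ha.le
  have hlt : d / a < T 0 := by rwa [div_lt_iff₀' ha]
  refine hitTime_eq (fun t ht => ?_) ?_
  · have ht' : (t : ℝ) < d / a := by
      rw [← Real.coe_toNNReal _ hda]; exact_mod_cast ht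
    rw [compoundPath_of_lt hT (ht'.trans hlt)]
    rw [lt_div_iff₀' ha] at ht'
    simp only [mem_Iic, not_le]; linarith
  · rw [compoundPath_of_lt hT (by rwa [Real.coe_toNNReal _ hda]), Real.coe_toNNReal _ hda,
      mul_div_cancel₀ _ ha.ne']
    exact self_mem_Iic

/-- Equality is included: if the first jump falls exactly when the drift would reach the level, then
the path has already jumped at that time and has not reached it. -/
theorem tauMinus_of_ge (ha : 0 < a) (hT : RegularClock T) {t₀ : ℝ≥0} (h0 : (t₀ : ℝ) = T 0)
    (h : a * T 0 ≤ d) :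
    tauMinus (compoundPath a T J) d = t₀ +
      tauMinus (compoundPath a (fun k => T (k + 1)) fun k => J (k + 1)) (d - a * T 0 + J 0) := by
  rw [tauMinus, hitTime_add (t₀ := t₀)]
  · simp only [compoundPath_add hT h0, tauMinus, hitTime, mem_Iic]
    congr 1
    refine iInf_congr fun t => iInf_congr_Prop ?_ fun _ => rfl
    constructor <;> intro h <;> linarith
  · intro t ht
    have ht' : (t : ℝ) < T 0 := by rw [← h0]; exact_mod_cast ht
    rw [compoundPath_of_lt hT ht', mem_Iic, not_le]
    nlinarith

/-- Before the first jump the path only descends from 0, so it cannot exceed a level d ≥ 0. -/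
theorem tauPlus_eq (ha : 0 < a) (hT : RegularClock T) {t₀ : ℝ≥0} (h0 : (t₀ : ℝ) = T 0)
    (hd : 0 ≤ d) :
    tauPlus (compoundPath a T J) d = t₀ +
      tauPlus (compoundPath a (fun k => T (k + 1)) fun k => J (k + 1)) (d + a * T 0 - J 0) := by
  rw [tauPlus, hitTime_add (t₀ := t₀)]
  · simp only [compoundPath_add hT h0, tauPlus, hitTime, mem_Ioi]
    congr 1
    refine iInf_congr fun t => iInf_congr_Prop ?_ fun _ => rfl
    constructor <;> intro h <;> linarith
  · intro t ht
    have ht' : (t : ℝ) < T 0 := by rw [← h0]; exact_mod_cast ht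
    rw [compoundPath_of_lt hT ht', mem_Ioi, not_lt]
    have : 0 ≤ a * (t : ℝ) := mul_nonneg ha.le t.2
    linarith

theorem tauPlus_of_neg (hT : RegularClock T) (hd : d < 0) :
    tauPlus (compoundPath a T J) d = 0 := by
  have := hitTime_le (w := compoundPath a T J) (A := Ioi d) (t := 0)
    (by rw [compoundPath_zero hT]; exact hd)
  simpa [tauPlus] using this

end Passage

end Paths

/-! ### Restarting the oscillating path -/

section Oscillating

variable (w : Regime → ℕ → ℝ≥0 → ℝ) (b x : ℝ)

/-- The recursion defining the stages peels off the last one; restarting the path requires peeling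
off the first. -/
theorem stage_succ (n : ℕ) : stage w b x (n + 1) =
    ((stage w b x 1).1 + (stage (fun i n => w i (n + 1)) b (stage w b x 1).2 n).1,
      (stage (fun i n => w i (n + 1)) b (stage w b x 1).2 n).2) := by
  induction n with
  | zero => simp [stage]
  | succ n ih =>
    rw [stage, ih]
    generalize stage w b x 1 = σ
    simp only
    conv_rhs => rw [stage]
    split_ifs <;> simp only [add_assoc]

/-- The time `t` is reached by some stage of the oscillating path. -/
def Reached (t : ℝ≥0) : Prop := ∃ n, (t : ℝ≥0∞) < (stage w b x (n + 1)).1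

variable {w b x}

theorem oscPath_of_lt {t : ℝ≥0} (ht : (t : ℝ≥0∞) < (stage w b x 1).1) :
    oscPath w b x t = x + w (sideOf b x) 0 t := by
  have h0 : sInf {n : ℕ | (t : ℝ≥0∞) < (stage w b x (n + 1)).1} = 0 :=
    Nat.sInf_eq_zero.2 (Or.inl ht)
  rw [oscPath]
  simp only [h0]
  simp only [stage, ENNReal.toNNReal_zero, tsub_zero]
  by_cases hx : b < x
  · rw [if_pos hx, sideOf, if_neg (not_le.2 hx)]
  · rw [if_neg hx, sideOf, if_pos (not_lt.1 hx)]

theorem Reached.mono {t r : ℝ≥0} (h : Reached w b x t) (hr : r ≤ t) : Reached w b x r := by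
  obtain ⟨n, hn⟩ := h
  exact ⟨n, lt_of_le_of_lt (by exact_mod_cast hr) hn⟩

theorem oscPath_eq_of_sInf {t : ℝ≥0} {n : ℕ}
    (h : sInf {n : ℕ | (t : ℝ≥0∞) < (stage w b x (n + 1)).1} = n) :
    oscPath w b x t = (stage w b x n).2 +
      w (sideOf b (stage w b x n).2) n (t - (stage w b x n).1.toNNReal) := by
  rw [oscPath]
  simp only [h]
  by_cases hx : b < (stage w b x n).2
  · rw [if_pos hx, sideOf, if_neg (not_le.2 hx)]
  · rw [if_neg hx, sideOf, if_pos (not_lt.1 hx)]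

/-- After the end of the stage `0` the path starts afresh. -/
theorem oscPath_next {y : ℝ} {t₁ r : ℝ≥0} (h1 : stage w b x 1 = (↑t₁, y))
    (hr : Reached (fun i n => w i (n + 1)) b y r) :
    Reached w b x (t₁ + r) ∧ oscPath w b x (t₁ + r) = oscPath (fun i n => w i (n + 1)) b y r := by
  have hst : ∀ n, stage w b x (n + 1) = (t₁ + (stage (fun i n => w i (n + 1)) b y n).1,
      (stage (fun i n => w i (n + 1)) b y n).2) := fun n => by rw [stage_succ, h1]
  have hiff : ∀ n, ((t₁ + r : ℝ≥0) : ℝ≥0∞) < (stage w b x (n + 1 + 1)).1 ↔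
      (r : ℝ≥0∞) < (stage (fun i n => w i (n + 1)) b y (n + 1)).1 := fun n => by
    rw [hst, ENNReal.coe_add]
    exact ENNReal.add_lt_add_iff_left ENNReal.coe_ne_top
  have h0 : ¬ ((t₁ + r : ℝ≥0) : ℝ≥0∞) < (stage w b x (0 + 1)).1 := by
    rw [zero_add, h1, not_lt]; simp
  obtain ⟨n, hn⟩ := hr
  refine ⟨⟨n + 1, (hiff n).2 hn⟩, ?_⟩
  set m := sInf {n : ℕ | (r : ℝ≥0∞) < (stage (fun i n => w i (n + 1)) b y (n + 1)).1} with hm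
  have hmem : (r : ℝ≥0∞) < (stage (fun i n => w i (n + 1)) b y (m + 1)).1 :=
    Nat.sInf_mem (s := {n : ℕ | (r : ℝ≥0∞) < (stage (fun i n => w i (n + 1)) b y (n + 1)).1})
      ⟨n, hn⟩
  have hS : sInf {n : ℕ | ((t₁ + r : ℝ≥0) : ℝ≥0∞) < (stage w b x (n + 1)).1} = m + 1 := by
    refine le_antisymm (Nat.sInf_le ((hiff m).2 hmem)) ?_
    refine le_csInf ⟨n + 1, (hiff n).2 hn⟩ fun k hk => ?_
    cases k with
    | zero => exact absurd hk h0
    | succ k => exact Nat.succ_le_succ (Nat.sInf_le ((hiff k).1 hk))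
  have hfin : (stage (fun i n => w i (n + 1)) b y m).1 ≤ r := by
    cases hk : m with
    | zero => simp [stage]
    | succ k =>
      by_contra hlt
      have : m ≤ k := Nat.sInf_le (not_le.1 hlt)
      omega
  rw [oscPath_eq_of_sInf hS, oscPath_eq_of_sInf hm.symm, hst]
  congr 2
  rw [ENNReal.toNNReal_add ENNReal.coe_ne_top (hfin.trans_lt ENNReal.coe_lt_top).ne,
    ENNReal.toNNReal_coe, add_tsub_add_eq_tsub_left]

/-- The path after the first jump, when the jump does not end the stage `0`. -/
theorem oscPath_same {w' : Regime → ℕ → ℝ≥0 → ℝ} {x' : ℝ} {t₀ r : ℝ≥0}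
    (hw : ∀ i n, w i (n + 1) = w' i (n + 1)) (hside : sideOf b x = sideOf b x')
    (h0 : ∀ r, x + w (sideOf b x) 0 (t₀ + r) = x' + w' (sideOf b x) 0 r)
    (h1 : (stage w b x 1).1 = t₀ + (stage w' b x' 1).1)
    (h2 : (stage w' b x' 1).1 ≠ ∞ → (stage w b x 1).2 = (stage w' b x' 1).2)
    (hr : Reached w' b x' r) :
    Reached w b x (t₀ + r) ∧ oscPath w b x (t₀ + r) = oscPath w' b x' r := by
  have hlt : (r : ℝ≥0∞) < (stage w' b x' 1).1 →
      ((t₀ + r : ℝ≥0) : ℝ≥0∞) < (stage w b x 1).1 := fun h => by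
    rw [h1, ENNReal.coe_add]
    exact (ENNReal.add_lt_add_iff_left ENNReal.coe_ne_top).2 h
  by_cases h : (r : ℝ≥0∞) < (stage w' b x' 1).1
  · refine ⟨⟨0, hlt h⟩, ?_⟩
    rw [oscPath_of_lt (hlt h), oscPath_of_lt h, h0, hside]
  · have hle := not_lt.1 h
    obtain ⟨s, hs⟩ : ∃ s : ℝ≥0, (stage w' b x' 1).1 = s :=
      ⟨_, (ENNReal.coe_toNNReal (hle.trans_lt ENNReal.coe_lt_top).ne).symm⟩
    rw [hs] at hle
    obtain ⟨q, rfl⟩ := exists_add_of_le (ENNReal.coe_le_coe.1 hle)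
    have hw' : (fun i n => w i (n + 1)) = fun i n => w' i (n + 1) :=
      funext fun i => funext fun n => hw i n
    have hq : Reached (fun i n => w' i (n + 1)) b (stage w' b x' 1).2 q := by
      obtain ⟨n, hn⟩ := hr
      cases n with
      | zero => exact absurd hn h
      | succ n =>
        refine ⟨n, ?_⟩
        rw [stage_succ, hs, ENNReal.coe_add] at hn
        exact (ENNReal.add_lt_add_iff_left ENNReal.coe_ne_top).1 hn
    have e1 : stage w b x 1 = (((t₀ + s : ℝ≥0) : ℝ≥0∞), (stage w' b x' 1).2) := by
      refine Prod.ext ?_ (h2 (by rw [hs]; exact ENNReal.coe_ne_top))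
      rw [h1, hs, ENNReal.coe_add]
    have e2 : stage w' b x' 1 = ((s : ℝ≥0∞), (stage w' b x' 1).2) := Prod.ext hs rfl
    rw [← add_assoc]
    have := oscPath_next e1 (r := q) (by rw [hw']; exact hq)
    refine ⟨this.1, ?_⟩
    rw [this.2, (oscPath_next e2 hq).2, hw']

variable (w b x)

/-- The oscillating path leaves `[0, B]` at the time `τ`, at the position `y`: through a jump
over `B`, or continuously through `0`. -/
structure ExitAt (B : ℝ) (τ : ℝ≥0) (y : ℝ) : Prop where
  reached : Reached w b x τ
  mem : ∀ t < τ, oscPath w b x t ∈ Icc 0 B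
  eq : oscPath w b x τ = y
  exits : B < y ∨ y = 0 ∧ ∀ δ > τ, ∃ t, τ < t ∧ t < δ ∧ oscPath w b x t < 0

variable {w b x}

/-- Carries an exit of the restarted path back to the original one. Only reached times are compared,
because the path has a default value at times that no stage reaches. -/
theorem ExitAt.transfer {w' : Regime → ℕ → ℝ≥0 → ℝ} {x' B : ℝ} {t₀ τ : ℝ≥0} {y : ℝ}
    (h : ExitAt w' b x' B τ y)
    (htr : ∀ r, Reached w' b x' r →
      Reached w b x (t₀ + r) ∧ oscPath w b x (t₀ + r) = oscPath w' b x' r)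
    (hmem : ∀ t < t₀, oscPath w b x t ∈ Icc 0 B) : ExitAt w b x B (t₀ + τ) y where
  reached := (htr τ h.reached).1
  mem t ht := by
    rcases lt_or_ge t t₀ with hlt | hge
    · exact hmem t hlt
    · obtain ⟨r, rfl⟩ := exists_add_of_le hge
      have hr : r < τ := lt_of_add_lt_add_left ht
      rw [(htr r (h.reached.mono hr.le)).2]
      exact h.mem r hr
  eq := by rw [(htr τ h.reached).2, h.eq]
  exits := by
    refine h.exits.imp id fun ⟨hy, hex⟩ => ⟨hy, fun δ hδ => ?_⟩
    obtain ⟨n, hn⟩ := h.reached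
    obtain ⟨q, hq1, hq2⟩ := ENNReal.lt_iff_exists_nnreal_btwn.1 hn
    have hq1 : τ < q := by exact_mod_cast hq1
    have hδ' : τ < δ - t₀ := lt_tsub_iff_left.2 hδ
    -- The bound q keeps the witness within the reached times, where the two paths agree.
    obtain ⟨t, ht1, ht2, ht3⟩ := hex (min q (δ - t₀)) (lt_min hq1 hδ')
    refine ⟨t₀ + t, by gcongr, lt_tsub_iff_left.1 (ht2.trans_le (min_le_right _ _)), ?_⟩
    have hre : Reached w' b x' t :=
      ⟨n, lt_trans (by exact_mod_cast ht2.trans_le (min_le_left _ _)) hq2⟩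
    rw [(htr t hre).2]; exact ht3

/-- At a lower exit the path stands at 0, still inside [0, B]; the infimum is not attained but
approached by the negative values immediately afterwards. -/
theorem ExitAt.hitTime_eq {B : ℝ} {τ : ℝ≥0} {y : ℝ} (h : ExitAt w b x B τ y) :
    hitTime (oscPath w b x) (Icc 0 B)ᶜ = τ := by
  refine le_antisymm ?_ (le_hitTime fun t ht hmem => hmem (h.mem t ht))
  rcases h.exits with hB | ⟨-, hex⟩
  · refine hitTime_le fun hmem => ?_
    rw [h.eq] at hmem
    exact absurd hmem.2 (not_le.2 hB)
  · refine le_of_forall_gt fun c hc => ?_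
    obtain ⟨q, hq1, hq2⟩ := ENNReal.lt_iff_exists_nnreal_btwn.1 hc
    obtain ⟨t, -, ht2, ht3⟩ := hex q (by exact_mod_cast hq1)
    refine lt_of_le_of_lt (hitTime_le (t := t) fun hmem => ?_) (lt_trans (by exact_mod_cast ht2) hq2)
    exact absurd hmem.1 (not_le.2 ht3)

end Oscillating

/-! ### The chain reads off the exit from the path -/

section ExitOfChain

variable (p : Regime → CompoundPoisson)

/-- The paths of the copies of the two processes that are driven by the noise. -/
def noisePath (ω : Noise) (i : Regime) (n : ℕ) : ℝ≥0 → ℝ :=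
  compoundPath (p i).a (fun k => ω (.inl (i, n, k))) fun k => ω (.inr (i, n, k))

/-- The noise consists of regular clocks and of positive jumps. -/
structure RegularNoise (ω : Noise) : Prop where
  clock : ∀ i n, RegularClock fun k => ω (.inl (i, n, k))
  jump : ∀ q, 0 < ω (.inr q)

theorem RegularNoise.dropStage {ω : Noise} (h : RegularNoise ω) :
    RegularNoise (ω.reindex dropStage) where
  clock i n := h.clock i (n + 1)
  jump _ := h.jump _

theorem RegularNoise.dropJump {ω : Noise} (h : RegularNoise ω) (i : Regime) :
    RegularNoise (ω.reindex (dropJump i)) where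
  clock j n := by
    have h0 := (h.clock j 0).succ
    have h1 := h.clock j n
    cases i <;> cases j <;> cases n <;> first | exact h0 | exact h1
  jump _ := h.jump _

theorem noisePath_dropJump_succ (ω : Noise) (i j : Regime) (n : ℕ) :
    noisePath p (ω.reindex (dropJump i)) j (n + 1) = noisePath p ω j (n + 1) := by
  simp only [noisePath, Noise.reindex, Sum.map_inl, Sum.map_inr, dropJump_succ]

theorem noisePath_dropJump_zero (ω : Noise) (i : Regime) :
    noisePath p (ω.reindex (dropJump i)) i 0 =
      compoundPath (p i).a (fun k => ω (.inl (i, 0, k + 1))) fun k => ω (.inr (i, 0, k + 1)) := by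
  simp only [noisePath, Noise.reindex, Sum.map_inl, Sum.map_inr, dropJump_zero]

theorem stage_one_of_le {w : Regime → ℕ → ℝ≥0 → ℝ} {b x : ℝ} (hx : x ≤ b) : stage w b x 1 =
    (tauPlus (w .lower 0) (b - x), b + overshootPlus (w .lower 0) (b - x)) := by
  simp [stage, not_lt.2 hx]

theorem stage_one_of_lt {w : Regime → ℕ → ℝ≥0 → ℝ} {b x : ℝ} (hx : b < x) : stage w b x 1 =
    (tauMinus (w .upper 0) (x - b), b) := by
  simp [stage, hx]

variable {p} {B b x : ℝ} {ω : Noise}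

theorem RegularNoise.coe_first (h : RegularNoise ω) (i : Regime) :
    ((ω.first i).1.toNNReal : ℝ) = (ω.first i).1 :=
  Real.coe_toNNReal _ ((h.clock i 0).pos 0).le

/-- Below the switching level the stage `0` lasts until the first jump. -/
theorem oscPath_lower (h : RegularNoise ω) (hx : x ≤ b) {t : ℝ≥0}
    (ht : t < (ω.first .lower).1.toNNReal) :
    (t : ℝ≥0∞) < (stage (noisePath p ω) b x 1).1 ∧
      oscPath (noisePath p ω) b x t = x - (p .lower).a * t := by
  have hT := h.clock .lower 0
  have hlt : (t : ℝ≥0∞) < (stage (noisePath p ω) b x 1).1 := by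
    rw [stage_one_of_le hx, noisePath, tauPlus_eq (p .lower).a_pos hT (h.coe_first .lower)
      (sub_nonneg.2 hx)]
    exact lt_of_lt_of_le (by exact_mod_cast ht) le_self_add
  refine ⟨hlt, ?_⟩
  rw [oscPath_of_lt hlt, sideOf, if_pos hx, noisePath, compoundPath_of_lt hT]
  · ring
  · rw [← NNReal.coe_lt_coe, h.coe_first] at ht; exact ht

/-- Above the switching level the stage `0` lasts until the first jump or the passage through
the level. -/
theorem oscPath_upper (h : RegularNoise ω) (hx : b < x) {t : ℝ≥0}
    (ht : t < (ω.first .upper).1.toNNReal) (hta : (p .upper).a * t < x - b) :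
    (t : ℝ≥0∞) < (stage (noisePath p ω) b x 1).1 ∧
      oscPath (noisePath p ω) b x t = x - (p .upper).a * t := by
  have hT := h.clock .upper 0
  have ha := (p .upper).a_pos
  have hlt : (t : ℝ≥0∞) < (stage (noisePath p ω) b x 1).1 := by
    rw [stage_one_of_lt hx]
    rcases lt_or_ge (x - b) ((p .upper).a * (ω.first .upper).1) with hd | hd
    · simp only [noisePath]
      rw [tauMinus_of_lt ha hT (sub_pos.2 hx).le hd, ENNReal.coe_lt_coe, Real.lt_toNNReal_iff_coe_lt,
        lt_div_iff₀' ha]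
      exact hta
    · simp only [noisePath]
      rw [tauMinus_of_ge ha hT (h.coe_first .upper) hd]
      exact lt_of_lt_of_le (by exact_mod_cast ht) le_self_add
  refine ⟨hlt, ?_⟩
  rw [oscPath_of_lt hlt, sideOf, if_neg (not_le.2 hx), noisePath, compoundPath_of_lt hT]
  · ring
  · rw [← NNReal.coe_lt_coe, h.coe_first] at ht; exact ht

theorem exitAt_of_gt (h : RegularNoise ω) (hb : b ≤ B) (hx : B < x) :
    ExitAt (noisePath p ω) b x B 0 x := by
  have hbx := hb.trans_lt hx
  obtain ⟨h1, h2⟩ := oscPath_upper (p := p) (t := 0) h hbx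
    (Real.toNNReal_pos.2 ((h.clock .upper 0).pos 0)) (by simpa using hbx)
  refine ⟨⟨0, h1⟩, fun t ht => absurd ht not_lt_zero, ?_, Or.inl hx⟩
  rw [h2]; simp

theorem exitAt_of_passage (h : RegularNoise ω) (hb : b ≤ B) (hx0 : 0 ≤ x) (hx : x ≤ b)
    (hp : x < (p .lower).a * (ω.first .lower).1) :
    ExitAt (noisePath p ω) b x B (x / (p .lower).a).toNNReal 0 := by
  have ha := (p .lower).a_pos
  have hτ : ((x / (p .lower).a).toNNReal : ℝ) = x / (p .lower).a :=
    Real.coe_toNNReal _ (div_nonneg hx0 ha.le)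
  have hlt : (x / (p .lower).a).toNNReal < (ω.first .lower).1.toNNReal := by
    rw [← NNReal.coe_lt_coe, hτ, h.coe_first, div_lt_iff₀' ha]; exact hp
  obtain ⟨h1, h2⟩ := oscPath_lower (p := p) h hx hlt
  refine ⟨⟨0, h1⟩, fun t ht => ?_, ?_, Or.inr ⟨rfl, fun δ hδ => ?_⟩⟩
  · rw [(oscPath_lower h hx (ht.trans hlt)).2]
    rw [← NNReal.coe_lt_coe, hτ, lt_div_iff₀' ha] at ht
    have : 0 ≤ (p .lower).a * (t : ℝ) := by positivity
    constructor <;> linarith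
  · rw [h2, hτ, mul_div_cancel₀ _ ha.ne', sub_self]
  · obtain ⟨t, ht1, ht2⟩ := exists_between (lt_min hδ hlt)
    refine ⟨t, ht1, ht2.trans_le (min_le_left _ _), ?_⟩
    rw [(oscPath_lower h hx (ht2.trans_le (min_le_right _ _))).2]
    rw [← NNReal.coe_lt_coe, hτ, div_lt_iff₀' ha] at ht1
    linarith

/-- If the jump stays at or below b, stage 0 continues with the rest of the same copy. If it crosses
b, the passage happens at the jump itself with overshoot x' - b, and the next stage uses new copies.
-/
theorem ExitAt.of_lower_jump (h : RegularNoise ω) (hb : b ≤ B) (hx : x ≤ b)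
    (hp : (p .lower).a * (ω.first .lower).1 ≤ x) {δ : ℝ≥0} {x' y : ℝ}
    (hx' : x' = x - (p .lower).a * (ω.first .lower).1 + (ω.first .lower).2)
    (hex : ExitAt (noisePath p (if x' ≤ b then ω.reindex (dropJump .lower) else
      ω.reindex dropStage)) b x' B δ y) :
    ExitAt (noisePath p ω) b x B ((ω.first .lower).1.toNNReal + δ) y := by
  have ha := (p .lower).a_pos
  have hT := h.clock .lower 0
  have h0 := h.coe_first .lower
  have hd : b - x + (p .lower).a * ω (.inl (.lower, 0, 0)) - ω (.inr (.lower, 0, 0)) = b - x' := by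
    rw [hx']; simp only [Noise.first]; ring
  have hst1 : (stage (noisePath p ω) b x 1).1 = (ω.first .lower).1.toNNReal +
      tauPlus (noisePath p (ω.reindex (dropJump .lower)) .lower 0) (b - x') := by
    rw [stage_one_of_le hx, noisePath_dropJump_zero]
    simp only [noisePath]
    rw [tauPlus_eq ha hT h0 (sub_nonneg.2 hx), hd]
  have hpath : ∀ r, x + noisePath p ω .lower 0 ((ω.first .lower).1.toNNReal + r) =
      x' + noisePath p (ω.reindex (dropJump .lower)) .lower 0 r := fun r => by
    rw [noisePath_dropJump_zero, noisePath, compoundPath_add hT h0, hx']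
    simp only [Noise.first]; ring
  have hmem : ∀ t < (ω.first .lower).1.toNNReal, oscPath (noisePath p ω) b x t ∈ Icc 0 B := by
    intro t ht
    rw [(oscPath_lower h hx ht).2]
    rw [← NNReal.coe_lt_coe, h0] at ht
    have h1 : 0 ≤ (p .lower).a * (t : ℝ) := by positivity
    have h2 := mul_lt_mul_of_pos_left ht ha
    constructor <;> linarith
  refine hex.transfer (fun r hr => ?_) hmem
  by_cases hxb : x' ≤ b
  · rw [if_pos hxb] at hr ⊢
    have hside : sideOf b x = .lower := if_pos hx
    refine oscPath_same (fun i n => (noisePath_dropJump_succ p ω _ i n).symm)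
      (hside.trans (if_pos hxb).symm) (by rwa [hside]) ?_ (fun hne => ?_) hr
    · rw [hst1, stage_one_of_le hxb]
    · rw [stage_one_of_le hxb] at hne ⊢
      have hst2 := hst1
      rw [stage_one_of_le hx] at hst2 ⊢
      simp only at hst2 hne ⊢
      -- The overshoot is read at the real value of the passage time, which respects the sum only
      -- for finite passage times; an infinite stage has no successor to be compared.
      rw [overshootPlus, overshootPlus, hst2, ENNReal.toNNReal_add ENNReal.coe_ne_top hne,
        ENNReal.toNNReal_coe]
      have := hpath (tauPlus (noisePath p (ω.reindex (dropJump .lower)) .lower 0)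
        (b - x')).toNNReal
      linarith
  · rw [if_neg hxb] at hr ⊢
    rw [noisePath_dropJump_zero, tauPlus_of_neg hT.succ (by linarith), add_zero] at hst1
    refine oscPath_next (Prod.ext hst1 ?_) hr
    have hst2 := hst1
    rw [stage_one_of_le hx] at hst2 ⊢
    simp only at hst2 ⊢
    have := hpath 0
    rw [add_zero, noisePath_dropJump_zero, compoundPath_zero hT.succ] at this
    rw [overshootPlus, hst2, ENNReal.toNNReal_coe]
    linarith

theorem ExitAt.of_upper_passage (h : RegularNoise ω) (hb0 : 0 ≤ b) (hx : b < x) (hxB : x ≤ B)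
    (hp : x - b < (p .upper).a * (ω.first .upper).1) {δ : ℝ≥0} {y : ℝ}
    (hex : ExitAt (noisePath p (ω.reindex dropStage)) b b B δ y) :
    ExitAt (noisePath p ω) b x B (((x - b) / (p .upper).a).toNNReal + δ) y := by
  have ha := (p .upper).a_pos
  have hτ : (((x - b) / (p .upper).a).toNNReal : ℝ) = (x - b) / (p .upper).a :=
    Real.coe_toNNReal _ (div_nonneg (sub_pos.2 hx).le ha.le)
  have hlt : ((x - b) / (p .upper).a).toNNReal < (ω.first .upper).1.toNNReal := by
    rw [← NNReal.coe_lt_coe, hτ, h.coe_first, div_lt_iff₀' ha]; exact hp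
  refine hex.transfer (fun r hr => oscPath_next ?_ hr) fun t ht => ?_
  · rw [stage_one_of_lt hx]
    simp only [noisePath]
    rw [tauMinus_of_lt ha (h.clock .upper 0) (sub_pos.2 hx).le hp]
  · have ht' := ht
    rw [← NNReal.coe_lt_coe, hτ, lt_div_iff₀' ha] at ht'
    rw [(oscPath_upper h hx (ht.trans hlt) ht').2]
    have h1 : 0 ≤ (p .upper).a * (t : ℝ) := by positivity
    constructor <;> linarith

/-- Before the jump the path stays at or above b and the jump is positive, so the process is still
above b and stage 0 goes on with the same copy. -/
theorem ExitAt.of_upper_jump (h : RegularNoise ω) (hb0 : 0 ≤ b) (hx : b < x) (hxB : x ≤ B)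
    (hp : (p .upper).a * (ω.first .upper).1 ≤ x - b) {δ : ℝ≥0} {x' y : ℝ}
    (hx' : x' = x - (p .upper).a * (ω.first .upper).1 + (ω.first .upper).2)
    (hex : ExitAt (noisePath p (ω.reindex (dropJump .upper))) b x' B δ y) :
    ExitAt (noisePath p ω) b x B ((ω.first .upper).1.toNNReal + δ) y := by
  have ha := (p .upper).a_pos
  have hT := h.clock .upper 0
  have h0 := h.coe_first .upper
  have hxb : b < x' := by
    have : 0 < (ω.first .upper).2 := h.jump _
    rw [hx']; linarith
  have hd : x - b - (p .upper).a * ω (.inl (.upper, 0, 0)) + ω (.inr (.upper, 0, 0)) = x' - b := by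
    rw [hx']; simp only [Noise.first]; ring
  have hside : sideOf b x = .upper := if_neg (not_le.2 hx)
  refine hex.transfer (fun r hr => ?_) fun t ht => ?_
  · refine oscPath_same (fun i n => (noisePath_dropJump_succ p ω _ i n).symm)
      (hside.trans (if_neg (not_le.2 hxb)).symm) (fun r => ?_) ?_ (fun hne => ?_) hr
    · rw [hside, noisePath_dropJump_zero, noisePath, compoundPath_add hT h0, hx']
      simp only [Noise.first]; ring
    · rw [stage_one_of_lt hx, stage_one_of_lt hxb, noisePath_dropJump_zero]
      simp only [noisePath]
      rw [tauMinus_of_ge ha hT h0 hp, hd]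
    · rw [stage_one_of_lt hx, stage_one_of_lt hxb]
  · have ht' := ht
    rw [← NNReal.coe_lt_coe, h0] at ht'
    have h2 := mul_lt_mul_of_pos_left ht' ha
    rw [(oscPath_upper h hx ht (by linarith)).2]
    have h1 : 0 ≤ (p .upper).a * (t : ℝ) := by positivity
    constructor <;> linarith

/-- When the chain has stopped, it shows the exit time and the exit position of the path. -/
theorem exitAt_of_iterate_chainStep (hb : b ∈ Icc 0 B) (n : ℕ) (h : RegularNoise ω) (τ : ℝ≥0)
    (hx0 : 0 ≤ x) (hn : ((chainStep p B b)^[n] ((τ, x), ω)).1.2 ∉ Ioc 0 B) :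
    ∃ δ, ((chainStep p B b)^[n] ((τ, x), ω)).1.1 = τ + δ ∧
      ExitAt (noisePath p ω) b x B δ ((chainStep p B b)^[n] ((τ, x), ω)).1.2 := by
  have hfixed : ∀ n (τ : ℝ≥0) (x : ℝ) (ω : Noise), x ∉ Ioc 0 B →
      (chainStep p B b)^[n] ((τ, x), ω) = ((τ, x), ω) := fun n τ x ω hx =>
    Function.iterate_fixed (by rw [chainStep, if_neg hx]) n
  induction n generalizing τ x ω with
  | zero =>
    refine ⟨0, (add_zero _).symm, ?_⟩
    simp only [Function.iterate_zero, id_eq] at hn ⊢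
    -- A stopped position is either 0, from which the drift leads out at once, or above B.
    rcases hx0.eq_or_lt with rfl | hx0
    · have := exitAt_of_passage (p := p) h hb.2 le_rfl hb.1
        (mul_pos (p .lower).a_pos ((h.clock .lower 0).pos 0))
      simpa using this
    · exact exitAt_of_gt h hb.2 (not_le.1 fun hxB => hn ⟨hx0, hxB⟩)
  | succ n ih =>
    by_cases hx : x ∈ Ioc 0 B
    swap
    · rw [hfixed _ _ _ _ hx] at hn ⊢
      have := ih (ω := ω) (x := x) h τ hx0 (by rwa [hfixed _ _ _ _ hx])
      rwa [hfixed _ _ _ _ hx] at this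
    rw [Function.iterate_succ_apply, chainStep, if_pos hx] at hn ⊢
    by_cases hxb : x ≤ b
    · rw [sideOf, if_pos hxb] at hn ⊢
      by_cases hp : x < (p .lower).a * (ω.first .lower).1
      · have hm : move p b .lower x (ω.first .lower) = ((x / (p .lower).a).toNNReal, 0) := by
          simp [move, floorLevel, hp]
        have hfix : (0 : ℝ) ∉ Ioc 0 B := fun h0 => lt_irrefl _ h0.1
        rw [stepIn, hm] at hn ⊢
        rw [hfixed _ _ _ _ hfix]
        exact ⟨_, rfl, exitAt_of_passage h hb.2 hx0 hxb hp⟩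
      · have hm : move p b .lower x (ω.first .lower) = ((ω.first .lower).1.toNNReal,
            x - (p .lower).a * (ω.first .lower).1 + (ω.first .lower).2) := by
          simp [move, floorLevel, hp]
        have hj : 0 < (ω.first .lower).2 := h.jump _
        set x' := x - (p .lower).a * (ω.first .lower).1 + (ω.first .lower).2 with hx'
        have hk : ω.first .lower ∈ keepsCopy p b .lower x ↔ x' ≤ b := by
          simp [keepsCopy, floorLevel, not_lt.1 hp, hxb, hx']
        rw [stepIn, hm] at hn ⊢
        simp only [hk] at hn ⊢
        obtain ⟨δ, h1, h2⟩ := ih (ω := if x' ≤ b then ω.reindex (dropJump .lower) else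
          ω.reindex dropStage) (x := x')
          (by split_ifs; exacts [h.dropJump _, h.dropStage]) _
          (by have := not_lt.1 hp; linarith) hn
        refine ⟨(ω.first .lower).1.toNNReal + δ, by rw [h1, add_assoc], ?_⟩
        exact h2.of_lower_jump h hb.2 hxb (not_lt.1 hp) hx'
    · rw [sideOf, if_neg hxb] at hn ⊢
      have hbx := not_le.1 hxb
      by_cases hp : x - b < (p .upper).a * (ω.first .upper).1
      · have hm : move p b .upper x (ω.first .upper) =
            (((x - b) / (p .upper).a).toNNReal, b) := by
          simp [move, floorLevel, hp]
        have hk : ω.first .upper ∉ keepsCopy p b .upper x := fun hk => hk.1 hp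
        rw [stepIn, hm] at hn ⊢
        simp only [hk, if_false] at hn ⊢
        obtain ⟨δ, h1, h2⟩ := ih h.dropStage _ hb.1 hn
        refine ⟨((x - b) / (p .upper).a).toNNReal + δ, by rw [h1, add_assoc], ?_⟩
        exact h2.of_upper_passage h hb.1 hbx hx.2 hp
      · have hm : move p b .upper x (ω.first .upper) = ((ω.first .upper).1.toNNReal,
            x - (p .upper).a * (ω.first .upper).1 + (ω.first .upper).2) := by
          simp [move, floorLevel, hp]
        have hj : 0 < (ω.first .upper).2 := h.jump _
        set x' := x - (p .upper).a * (ω.first .upper).1 + (ω.first .upper).2 with hx'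
        have hbx' : b < x' := by have := not_lt.1 hp; linarith
        have hk : ω.first .upper ∈ keepsCopy p b .upper x :=
          ⟨hp, iff_of_false hxb (not_le.2 hbx')⟩
        rw [stepIn, hm] at hn ⊢
        simp only [hk, if_true] at hn ⊢
        obtain ⟨δ, h1, h2⟩ := ih (h.dropJump _) _ (hb.1.trans hbx'.le) hn
        refine ⟨(ω.first .upper).1.toNNReal + δ, by rw [h1, add_assoc], ?_⟩
        exact h2.of_upper_jump h hb.1 hbx hx.2 (not_lt.1 hp) hx'

end ExitOfChain

/-! ### Almost sure regularity of the noise -/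

section RegularNoise

instance : Countable Regime :=
  Function.Injective.countable (f := fun i : Regime => match i with
    | .lower => 0
    | .upper => (1 : ℕ)) fun i j h => by cases i <;> cases j <;> simp_all

variable (p : Regime → CompoundPoisson)

theorem ae_noise_eval (q : NoiseIndex) {S : ℝ → Prop} (h : ∀ᵐ t ∂noiseLaw p q, S t) :
    ∀ᵐ ω ∂noiseMeasure p, S (ω q) := by
  rw [← Measure.infinitePi_map_eval (noiseLaw p) q] at h
  exact ae_of_ae_map (measurable_pi_apply q).aemeasurable h

/-- Infinitely many of the interarrival times of a copy exceed `1`. -/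
theorem ae_frequently_one_le (i : Regime) (n : ℕ) :
    ∀ᵐ ω ∂noiseMeasure p, ∃ᶠ k in atTop, 1 ≤ ω (.inl (i, n, k)) := by
  let E : ℕ → Set Noise := fun k => (fun ω : Noise => ω (.inl (i, n, k))) ⁻¹' Ici 1
  have hE : ∀ k, MeasurableSet (E k) := fun k => measurable_pi_apply _ measurableSet_Ici
  have hprob : ∀ k, noiseMeasure p (E k) = expMeasure (p i).rate (Ici 1) := fun k => by
    rw [← Measure.map_apply (measurable_pi_apply _) measurableSet_Ici, noiseMeasure,
      Measure.infinitePi_map_eval]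
    rfl
  have hpos : expMeasure (p i).rate (Ici 1) ≠ 0 := by
    intro h0
    have h1 : (expMeasure (p i).rate).real (Iic 1) = 1 := by
      rw [measureReal_def, (prob_compl_eq_zero_iff measurableSet_Iic).1
        (measure_mono_null (fun t ht => le_of_lt (not_le.1 ht)) h0), ENNReal.toReal_one]
    rw [expMeasure_real_Iic (p i).rate_pos zero_le_one] at h1
    linarith [Real.exp_pos (-((p i).rate * 1))]
  have hind0 : iIndepFun (fun (q : NoiseIndex) (ω : Noise) => ω q) (noiseMeasure p) :=
    iIndepFun_infinitePi (X := fun _ ω => ω) (by fun_prop)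
  have hind : iIndepSet E (noiseMeasure p) := by
    refine (iIndepSet_iff_meas_biInter hE).2 fun S => ?_
    exact (hind0.precomp (g := fun k : ℕ => (.inl (i, n, k) : NoiseIndex))
      fun k l h => by simpa using h).measure_inter_preimage_eq_mul S
      (sets := fun _ => Ici 1) fun _ _ => measurableSet_Ici
  -- The second Borel–Cantelli lemma: independent events of one and the same positive probability.
  have h1 := measure_limsup_eq_one hE hind (by
    simp only [hprob]; exact ENNReal.tsum_const_eq_top_of_ne_zero hpos)
  have h2 : ∀ᵐ ω ∂noiseMeasure p, ω ∈ limsup E atTop :=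
    (prob_compl_eq_zero_iff (MeasurableSet.measurableSet_limsup hE)).2 h1
  filter_upwards [h2] with ω hω
  exact mem_limsup_iff_frequently_mem.1 hω

theorem ae_regularNoise : ∀ᵐ ω ∂noiseMeasure p, RegularNoise ω := by
  have h1 : ∀ᵐ ω ∂noiseMeasure p, ∀ j : Regime × ℕ × ℕ, 0 < ω (.inl j) :=
    ae_all_iff.2 fun j => ae_noise_eval p _ (ae_expMeasure_pos (p j.1).rate_pos)
  have h2 : ∀ᵐ ω ∂noiseMeasure p, ∀ j : Regime × ℕ × ℕ, 0 < ω (.inr j) :=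
    ae_all_iff.2 fun j => ae_noise_eval p _ (p j.1).ae_jump_pos
  have h3 : ∀ᵐ ω ∂noiseMeasure p, ∀ j : Regime × ℕ,
      ∃ᶠ k in atTop, 1 ≤ ω (.inl (j.1, j.2, k)) :=
    ae_all_iff.2 fun j => ae_frequently_one_le p j.1 j.2
  filter_upwards [h1, h2, h3] with ω h1 h2 h3
  refine ⟨fun i n => ⟨fun k => h1 _, ?_⟩, h2⟩
  -- Convergence of the series would force the interarrival times to 0, although infinitely many of
  -- them are at least 1.
  refine (not_summable_iff_tendsto_nat_atTop_of_nonneg fun k => (h1 _).le).1 fun hs => ?_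
  exact h3 (i, n) ((hs.tendsto_atTop_zero.eventually_lt_const one_pos).mono fun k => not_le.2)

end RegularNoise

/-! ### Transfer to an arbitrary probability space, and optional stopping -/

section DrivenProcess

variable {Ω : Type*} [MeasurableSpace Ω] {P : Measure Ω}
  {p : Regime → CompoundPoisson} {T J : Regime → ℕ → ℕ → Ω → ℝ} {B b x : ℝ}

/-- The noise as a random element of the space of its values. -/
def noiseOf (T J : Regime → ℕ → ℕ → Ω → ℝ) (ω : Ω) : Noise := fun q =>
  Sum.elim (fun j => T j.1 j.2.1 j.2.2) (fun j => J j.1 j.2.1 j.2.2) q ω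

theorem IsDrivingNoise.hasLaw (h : IsDrivingNoise P p T J) (q : NoiseIndex) :
    HasLaw (fun ω => noiseOf T J ω q) (noiseLaw p q) P := by
  rcases q with j | j
  · exact h.hasLaw_T _ _ _
  · exact h.hasLaw_J _ _ _

variable [IsProbabilityMeasure P]

/-- Independence with prescribed marginals determines the joint law, so almost sure statements and
expectations may be computed under the product measure. -/
theorem IsDrivingNoise.hasLaw_noiseOf (h : IsDrivingNoise P p T J) :
    HasLaw (noiseOf T J) (noiseMeasure p) P where
  aemeasurable := aemeasurable_pi_iff.2 fun q => (h.hasLaw q).aemeasurable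
  map_eq := by
    have := (iIndepFun_iff_map_fun_eq_infinitePi_map₀'
      (X := fun q ω => noiseOf T J ω q) fun q => (h.hasLaw q).aemeasurable).1 h.indep
    simp only [(h.hasLaw _).map_eq] at this
    exact this

/-- The clock and the position of the chain that is driven by the noise. -/
def chainAt (p : Regime → CompoundPoisson) (T J : Regime → ℕ → ℕ → Ω → ℝ) (B b x : ℝ) (n : ℕ)
    (ω : Ω) : ℝ≥0 × ℝ :=
  ((chainStep p B b)^[n] ((0, x), noiseOf T J ω)).1

theorem aemeasurable_chainAt (h : IsDrivingNoise P p T J) (n : ℕ) :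
    AEMeasurable (chainAt p T J B b x n) P :=
  (measurable_fst.comp ((measurable_iterate_chainStep p B b n).comp
    (measurable_const.prodMk measurable_id))).comp_aemeasurable h.hasLaw_noiseOf.aemeasurable

/-- The chain stops at the exit of the oscillating process. -/
theorem ae_chainAt_eq (h : IsDrivingNoise P p T J) (hB : 0 < B) (hb : b ∈ Icc 0 B) (hx : 0 ≤ x) :
    ∀ᵐ ω ∂P, ∃ δ : ℝ≥0, ∃ y : ℝ, exitTime (oscProcess p T J b x) B ω = δ ∧
      exitPos (oscProcess p T J b x) B ω = y ∧ (B < y ∨ y = 0) ∧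
      ∀ᶠ n in atTop, chainAt p T J B b x n ω = (δ, y) := by
  have h0 := h.hasLaw_noiseOf
  have h1 : ∀ᵐ ω ∂P, RegularNoise (noiseOf T J ω) :=
    ae_of_ae_map h0.aemeasurable (by rw [h0.map_eq]; exact ae_regularNoise p)
  have h2 : ∀ᵐ ω ∂P, ∃ n, ((chainStep p B b)^[n] ((0, x), noiseOf T J ω)).1.2 ∉ Ioc 0 B :=
    ae_of_ae_map (p := fun ω => ∃ n, ((chainStep p B b)^[n] ((0, x), ω)).1.2 ∉ Ioc 0 B)
      h0.aemeasurable (by rw [h0.map_eq]; exact ae_chain_stops p B b hB hb 0 x)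
  filter_upwards [h1, h2] with ω h1 ⟨n, hn⟩
  obtain ⟨δ, hδ, hex⟩ := exitAt_of_iterate_chainStep hb n h1 0 hx hn
  rw [zero_add] at hδ
  have ht : exitTime (oscProcess p T J b x) B ω = δ := hex.hitTime_eq
  refine ⟨δ, _, ht, ?_, hex.exits.imp id And.left, ?_⟩
  · rw [exitPos, ht, ENNReal.toNNReal_coe]; exact hex.eq
  · refine eventually_atTop.2 ⟨n, fun m hm => ?_⟩
    obtain ⟨k, rfl⟩ := exists_add_of_le hm
    have hfix : chainStep p B b ((chainStep p B b)^[n] ((0, x), noiseOf T J ω)) =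
        (chainStep p B b)^[n] ((0, x), noiseOf T J ω) := by rw [chainStep, if_neg hn]
    rw [chainAt, add_comm, Function.iterate_add_apply, Function.iterate_fixed hfix]
    exact Prod.ext hδ rfl

/-- The clocks of the chain are almost everywhere measurable and eventually equal the exit time
almost surely, which avoids any study of path regularity on the exceptional set. -/
theorem aemeasurable_exitTime (h : IsDrivingNoise P p T J) (hB : 0 < B) (hb : b ∈ Icc 0 B)
    (hx : 0 ≤ x) : AEMeasurable (exitTime (oscProcess p T J b x) B) P := by
  refine aemeasurable_of_tendsto_metrizable_ae atTop
    (f := fun n ω => ((chainAt p T J B b x n ω).1 : ℝ≥0∞))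
    (fun n => (aemeasurable_chainAt h n).fst.coe_nnreal_ennreal) ?_
  filter_upwards [ae_chainAt_eq h hB hb hx] with ω ⟨δ, y, h1, _, _, h2⟩
  rw [h1]
  exact tendsto_const_nhds.congr' (h2.mono fun n hn => by simp only [hn])

theorem aemeasurable_exitPos (h : IsDrivingNoise P p T J) (hB : 0 < B) (hb : b ∈ Icc 0 B)
    (hx : 0 ≤ x) : AEMeasurable (exitPos (oscProcess p T J b x) B) P := by
  refine aemeasurable_of_tendsto_metrizable_ae atTop
    (f := fun n ω => (chainAt p T J B b x n ω).2)
    (fun n => (aemeasurable_chainAt h n).snd) ?_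
  filter_upwards [ae_chainAt_eq h hB hb hx] with ω ⟨δ, y, _, h1, _, h2⟩
  rw [h1]
  exact tendsto_const_nhds.congr' (h2.mono fun n hn => by simp only [hn])

/-- The expectation at the exit of a function that is harmonic for the chain. -/
theorem integral_exit (h : IsDrivingNoise P p T J) (hB : 0 < B) (hb : b ∈ Icc 0 B) (hx : 0 ≤ x)
    {s : ℝ} (hs : 0 ≤ s) {u : ℝ → ℂ} (hu : Measurable u) {M : ℝ} (hM : ∀ x, ‖u x‖ ≤ M)
    (hstep : ∀ x ∈ Ioc 0 B, ∫ r, Complex.exp (-s * ((move p b (sideOf b x) x r).1 : ℝ)) *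
      u (move p b (sideOf b x) x r).2 ∂(p (sideOf b x)).firstLaw = u x) :
    Integrable (fun ω => Complex.exp (-s * (exitTime (oscProcess p T J b x) B ω).toReal) *
      u (exitPos (oscProcess p T J b x) B ω)) P ∧
    ∫ ω, Complex.exp (-s * (exitTime (oscProcess p T J b x) B ω).toReal) *
      u (exitPos (oscProcess p T J b x) B ω) ∂P = u x := by
  let f : ℝ≥0 × ℝ → ℂ := fun q => Complex.exp (-s * (q.1 : ℝ)) * u q.2
  have hf : Measurable f := by
    refine Measurable.mul ?_ (hu.comp measurable_snd)
    have : Measurable fun q : ℝ≥0 × ℝ => (q.1 : ℝ) := measurable_coe_nnreal_real.comp measurable_fst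
    fun_prop
  have hexp : ∀ t : ℝ, 0 ≤ t → ‖Complex.exp (-s * t)‖ ≤ 1 := fun t ht => by
    rw [Complex.norm_exp]; simp; positivity
  have hnorm : ∀ (t : ℝ) (y : ℝ), 0 ≤ t → ‖Complex.exp (-s * t) * u y‖ ≤ M := fun t y ht => by
    rw [norm_mul]
    calc ‖Complex.exp (-s * t)‖ * ‖u y‖ ≤ 1 * M :=
          mul_le_mul (hexp t ht) (hM _) (norm_nonneg _) zero_le_one
      _ = M := one_mul M
  have hmeas : ∀ n, AEStronglyMeasurable (fun ω => f (chainAt p T J B b x n ω)) P := fun n =>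
    (hf.comp_aemeasurable (aemeasurable_chainAt h n)).aestronglyMeasurable
  have hint : ∀ n, ∫ ω, f (chainAt p T J B b x n ω) ∂P = u x := fun n => by
    have h0 := h.hasLaw_noiseOf
    have hm : Measurable fun ω : Noise => f ((chainStep p B b)^[n] ((0, x), ω)).1 :=
      hf.comp (measurable_fst.comp ((measurable_iterate_chainStep p B b n).comp
        (measurable_const.prodMk measurable_id)))
    have h1 := integral_iterate_chainStep p B b hs hu hM hstep n 0 x
    rw [← h0.map_eq, integral_map h0.aemeasurable hm.aestronglyMeasurable] at h1
    refine h1.trans ?_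
    simp
  constructor
  · refine Integrable.of_bound (C := M) (AEMeasurable.aestronglyMeasurable ?_)
      (ae_of_all _ fun ω => hnorm _ _ ENNReal.toReal_nonneg)
    refine AEMeasurable.mul ?_ (hu.comp_aemeasurable (aemeasurable_exitPos h hB hb hx))
    have := (aemeasurable_exitTime h hB hb hx).ennreal_toReal
    fun_prop
  -- For almost every ω the integrand along the chain is eventually constant, and it is bounded by
  -- M, while its expectation is u x for every n.
  · have hlim := tendsto_integral_of_dominated_convergence (μ := P)
      (F := fun n ω => f (chainAt p T J B b x n ω))
      (f := fun ω => Complex.exp (-s * (exitTime (oscProcess p T J b x) B ω).toReal) *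
        u (exitPos (oscProcess p T J b x) B ω)) (fun _ => M) hmeas (integrable_const _)
      (fun n => ae_of_all _ fun ω => hnorm _ _ NNReal.zero_le_coe) (by
        filter_upwards [ae_chainAt_eq h hB hb hx] with ω ⟨δ, y, h1, h2, _, h3⟩
        rw [h1, h2, ENNReal.coe_toReal]
        exact tendsto_const_nhds.congr' (h3.mono fun n hn => by simp only [hn, f]))
    simp only [hint] at hlim
    exact tendsto_nhds_unique tendsto_const_nhds hlim |>.symm

end DrivenProcess

theorem upperJointTransform_zero {Ω : Type*} [MeasurableSpace Ω] (P : Measure Ω) (X : ℝ≥0 → Ω → ℝ)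
    (B s : ℝ) :
    upperJointTransform X B P 0 s = upperTransform X B P s := by
  rw [upperJointTransform, upperTransform, ← integral_complex_ofReal]
  congr 1; funext ω
  by_cases hω : ω ∈ exitUpper X B
  · rw [indicator_of_mem hω, indicator_of_mem hω]; push_cast; simp
  · rw [indicator_of_notMem hω, indicator_of_notMem hω, Complex.ofReal_zero]

/-! ### The exit identity and the theorem -/

section ExitIdentity

variable (p : Regime → CompoundPoisson) (B b : ℝ) {s : ℝ} {h : ℝ → ℂ}

open Classical in
/-- The function of the position that a function `h`, harmonic for the upper process, gives rise
to. -/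
def exitValue (s : ℝ) (h : ℝ → ℂ) (x : ℝ) : ℂ :=
  if 0 ≤ x then (p .lower).ext s h (B - b) (b - x) else 0

variable {B b}

/-- At x = b the extension takes the value h(B - b), so the two pieces agree where an upper stage
hands over to a lower one. -/
theorem exitValue_of_ge (hs : 0 ≤ s) (hb : 0 ≤ b) {x : ℝ} (hx : b ≤ x) :
    exitValue p B b s h x = h (B - x) := by
  rw [exitValue, if_pos (hb.trans hx)]
  rcases hx.eq_or_lt with rfl | hx
  · rw [sub_self, CompoundPoisson.ext_zero _ hs]
  · rw [CompoundPoisson.ext, if_pos (by linarith)]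
    congr 1; ring

theorem harmonic_ext_lower (hs : 0 ≤ s) (hh : (p .upper).Harmonic s h) :
    (p .lower).Harmonic s ((p .lower).ext s h (B - b)) := by
  obtain ⟨M, hM⟩ := hh.bounded (B - b)
  exact (p .lower).harmonic_ext hs hh.measurable hM

theorem measurable_exitValue (hs : 0 ≤ s) (hh : (p .upper).Harmonic s h) :
    Measurable (exitValue p B b s h) :=
  Measurable.ite measurableSet_Ici
    ((harmonic_ext_lower p hs hh).measurable.comp (by fun_prop)) measurable_const

/-- Harmonic functions are bounded only on left half-lines. Positions x ≥ 0 keep the argument b - x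
at most b, and the value 0 assigned to x < 0, which the chain never visits from x ≥ 0, makes the
bound global. -/
theorem exists_norm_exitValue_le (hs : 0 ≤ s) (hh : (p .upper).Harmonic s h) :
    ∃ M, ∀ x, ‖exitValue p B b s h x‖ ≤ M := by
  obtain ⟨M, hM⟩ := (harmonic_ext_lower p (B := B) (b := b) hs hh).bounded b
  have hM0 : 0 ≤ M := (norm_nonneg _).trans (hM b le_rfl)
  refine ⟨M, fun x => ?_⟩
  rw [exitValue]
  split_ifs with hx
  · exact hM _ (by linarith)
  · rwa [norm_zero]

/-- The first-step identity in each regime: below, at distance b - x with drift x down to 0; above,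
at distance B - x with drift x - b down to b. A jump up by r lowers either distance by r, possibly
into the region of boundary values. -/
theorem integral_exitValue_move (hs : 0 ≤ s) (hb : b ∈ Icc 0 B) (hh : (p .upper).Harmonic s h)
    {x : ℝ} (hx : x ∈ Ioc 0 B) :
    ∫ r, Complex.exp (-s * ((move p b (sideOf b x) x r).1 : ℝ)) *
      exitValue p B b s h (move p b (sideOf b x) x r).2 ∂(p (sideOf b x)).firstLaw =
      exitValue p B b s h x := by
  by_cases hxb : x ≤ b
  · have ha := (p .lower).a_pos
    rw [sideOf, if_pos hxb]
    have key := (harmonic_ext_lower p (B := B) (b := b) hs hh).integral_firstLaw _ hs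
      (sub_nonneg.2 hxb) hx.1.le
    rw [exitValue, if_pos hx.1.le, ← key]
    refine integral_congr_ae ?_
    filter_upwards [(p .lower).ae_firstLaw_pos] with r hr
    simp only [move, floorLevel, sub_zero]
    by_cases hd : x < (p .lower).a * r.1
    · rw [if_pos hd, if_pos hd, Real.coe_toNNReal _ (div_nonneg hx.1.le ha.le), exitValue,
        if_pos le_rfl, sub_zero, sub_add_cancel]
    · have := not_lt.1 hd
      rw [if_neg hd, if_neg hd, Real.coe_toNNReal _ hr.1.le, exitValue, if_pos (by linarith [hr.2])]
      congr 2; ring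
  · have ha := (p .upper).a_pos
    have hbx := not_le.1 hxb
    rw [sideOf, if_neg hxb]
    have key := hh.integral_firstLaw _ hs (sub_nonneg.2 hx.2) (sub_pos.2 hbx).le
    rw [exitValue_of_ge p hs hb.1 hbx.le, ← key]
    refine integral_congr_ae ?_
    filter_upwards [(p .upper).ae_firstLaw_pos] with r hr
    by_cases hd : x - b < (p .upper).a * r.1
    · have hm : move p b .upper x r = (((x - b) / (p .upper).a).toNNReal, b) := if_pos hd
      rw [hm, if_pos hd, Real.coe_toNNReal _ (div_nonneg (sub_pos.2 hbx).le ha.le),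
        exitValue_of_ge p hs hb.1 le_rfl]
      congr 2; ring
    · have := not_lt.1 hd
      have hm : move p b .upper x r = (r.1.toNNReal, x - (p .upper).a * r.1 + r.2) := if_neg hd
      rw [hm, if_neg hd, Real.coe_toNNReal _ hr.1.le,
        exitValue_of_ge p hs hb.1 (by linarith [hr.2])]
      congr 2; ring

variable {p} {Ω : Type*} [MeasurableSpace Ω] {P : Measure Ω} [IsProbabilityMeasure P]
  {T J : Regime → ℕ → ℕ → Ω → ℝ} {x : ℝ}

/-- The exit through the lower boundary is continuous, so that a function `h` that is harmonic
for the upper process yields one linear relation between the transforms at the two boundaries. -/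
theorem exit_identity (hn : IsDrivingNoise P p T J) (hB : 0 < B) (hb : b ∈ Icc 0 B)
    (hx : x ∈ Icc 0 B) (hs : 0 ≤ s) (hh : (p .upper).Harmonic s h) :
    (p .lower).ext s h (B - b) b * lowerTransform (oscProcess p T J b x) B P s +
      ∫ ω, (exitUpper (oscProcess p T J b x) B).indicator (fun ω =>
        Complex.exp (-s * (exitTime (oscProcess p T J b x) B ω).toReal) *
          h (B - exitPos (oscProcess p T J b x) B ω)) ω ∂P =
      (p .lower).ext s h (B - b) (b - x) := by
  obtain ⟨M, hM⟩ := exists_norm_exitValue_le p (B := B) (b := b) hs hh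
  obtain ⟨hi, he⟩ := integral_exit hn hB hb hx.1 hs (measurable_exitValue p hs hh) hM
    fun y hy => integral_exitValue_move p hs hb hh hy
  have hcase := ae_chainAt_eq hn hB hb hx.1
  have hpos := aemeasurable_exitPos hn hB hb hx.1
  have hL : NullMeasurableSet {ω | exitPos (oscProcess p T J b x) B ω ≤ 0} P :=
    hpos.nullMeasurableSet_preimage measurableSet_Iic
  have hU : NullMeasurableSet {ω | B < exitPos (oscProcess p T J b x) B ω} P :=
    hpos.nullMeasurableSet_preimage measurableSet_Ioi
  generalize hX : oscProcess p T J b x = X at *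
  have h1 : ((p .lower).ext s h (B - b) b * lowerTransform X B P s : ℂ) =
      ∫ ω, {ω | exitPos X B ω ≤ 0}.indicator (fun ω =>
        Complex.exp (-s * (exitTime X B ω).toReal) * exitValue p B b s h (exitPos X B ω)) ω ∂P := by
    rw [lowerTransform, ← integral_complex_ofReal, ← integral_const_mul]
    refine integral_congr_ae ?_
    filter_upwards [hcase] with ω ⟨δ, y, ht, hy, hc, _⟩
    have hfin : exitTime X B ω < ∞ := ht ▸ ENNReal.coe_lt_top
    rcases hc with hc | hc
    · have e1 : ω ∉ exitLower X B := fun hω => absurd hω.2 (by rw [hy]; linarith)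
      have e2 : ω ∉ {ω | exitPos X B ω ≤ 0} := fun hω => absurd hω (by
        change ¬ exitPos X B ω ≤ 0
        rw [hy]; linarith)
      rw [indicator_of_notMem e1, indicator_of_notMem e2, Complex.ofReal_zero, mul_zero]
    · have e2 : ω ∈ {ω | exitPos X B ω ≤ 0} := by
        change exitPos X B ω ≤ 0
        rw [hy, hc]
      have e1 : ω ∈ exitLower X B := ⟨hfin, e2⟩
      rw [indicator_of_mem e1, indicator_of_mem e2, hy, hc, exitValue, if_pos le_rfl, sub_zero,
        mul_comm]
      push_cast; rfl
  have h2 : ∫ ω, (exitUpper X B).indicator (fun ω =>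
        Complex.exp (-s * (exitTime X B ω).toReal) * h (B - exitPos X B ω)) ω ∂P =
      ∫ ω, {ω | B < exitPos X B ω}.indicator (fun ω =>
        Complex.exp (-s * (exitTime X B ω).toReal) * exitValue p B b s h (exitPos X B ω)) ω ∂P := by
    refine integral_congr_ae ?_
    filter_upwards [hcase] with ω ⟨δ, y, ht, hy, hc, _⟩
    have hfin : exitTime X B ω < ∞ := ht ▸ ENNReal.coe_lt_top
    by_cases e2 : ω ∈ {ω | B < exitPos X B ω}
    · rw [indicator_of_mem (show ω ∈ exitUpper X B from ⟨hfin, e2⟩), indicator_of_mem e2,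
        exitValue_of_ge p hs hb.1 (hb.2.trans (le_of_lt e2))]
    · rw [indicator_of_notMem (fun hω => e2 hω.2), indicator_of_notMem e2]
  have h3 : (p .lower).ext s h (B - b) (b - x) = exitValue p B b s h x := by
    rw [exitValue, if_pos hx.1]
  rw [h1, h2, h3, ← he, ← integral_add (hi.indicator₀ hL) (hi.indicator₀ hU)]
  refine integral_congr_ae ?_
  filter_upwards [hcase] with ω ⟨δ, y, ht, hy, hc, _⟩
  have hd : Disjoint {ω | exitPos X B ω ≤ 0} {ω | B < exitPos X B ω} :=
    disjoint_left.2 fun ω' h1 h2 => absurd (lt_of_lt_of_le h2 h1) (not_lt.2 hB.le)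
  refine (congrFun (indicator_union_of_disjoint hd _) ω).symm.trans (indicator_of_mem ?_ _)
  rcases hc with hc | hc
  · exact Or.inr (show B < exitPos X B ω by rwa [hy])
  · exact Or.inl (show exitPos X B ω ≤ 0 by rw [hy, hc])

/-- The choice h = R_2: at an upper exit the argument B - ξ(χ) is negative, where R_2 vanishes. -/
theorem kFunction_mul_lowerTransform (hn : IsDrivingNoise P p T J) (hB : 0 < B)
    (hb : b ∈ Icc 0 B) (hx : x ∈ Icc 0 B) (hs : 0 ≤ s) :
    kFunction p s b (B - b) * lowerTransform (oscProcess p T J b x) B P s =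
      kFunction p s (b - x) (B - b) := by
  have h := exit_identity hn hB hb hx hs ((p .upper).harmonic_res hs)
  have h0 : ∀ ω, (exitUpper (oscProcess p T J b x) B).indicator (fun ω =>
      Complex.exp (-s * (exitTime (oscProcess p T J b x) B ω).toReal) *
        (p .upper).res s (B - exitPos (oscProcess p T J b x) B ω)) ω = 0 := fun ω => by
    refine indicator_apply_eq_zero.2 fun hω => ?_
    rw [((p .upper).laplaceClass_res hs).eq_zero _ (sub_neg.2 hω.2), mul_zero]
  simp only [h0, integral_zero, add_zero, ← kFunction_eq_ext p hs] at h
  exact_mod_cast h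

/-- Starting at x = B the right-hand side of the preceding relation is R_2(0) = 1/a_2, so neither
factor on the left can vanish. -/
theorem kFunction_ne_zero (hn : IsDrivingNoise P p T J) (hB : 0 < B) (hb : b ∈ Icc 0 B)
    (hs : 0 ≤ s) : kFunction p s b (B - b) ≠ 0 := by
  intro h0
  have h := kFunction_mul_lowerTransform hn hB hb (right_mem_Icc.2 hB.le) hs
  rw [h0, zero_mul] at h
  have h1 := kFunction_eq_ext p hs (b - B) (B - b)
  have h2 := exitValue_of_ge p (B := B) (h := (p .upper).res s) hs hb.1 hb.2
  rw [exitValue, if_pos hB.le, sub_self, (p .upper).res_zero hs] at h2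
  rw [← h, h2, Complex.ofReal_zero] at h1
  exact one_div_ne_zero (Complex.ofReal_ne_zero.2 (p .upper).a_pos.ne') h1.symm

/-- The choice h(y) = C_2^y(z, s), which is e^{zy} for y < 0: at an upper exit it equals e^{-zT}, T
being the overshoot. -/
theorem frakKJoint_mul_lowerTransform (hn : IsDrivingNoise P p T J) (hB : 0 < B)
    (hb : b ∈ Icc 0 B) (hx : x ∈ Icc 0 B) (hs : 0 ≤ s) {z : ℂ} (hz : 0 ≤ z.re) :
    frakKJoint p b (B - b) z s * lowerTransform (oscProcess p T J b x) B P s +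
      upperJointTransform (oscProcess p T J b x) B P z s = frakKJoint p (b - x) (B - b) z s := by
  have h := exit_identity hn hB hb hx hs ((p .upper).harmonic_cFunction hs hz)
  rw [← frakKJoint_eq_ext p hs hz (sub_nonneg.2 hb.2),
    ← frakKJoint_eq_ext p hs hz (sub_nonneg.2 hb.2)] at h
  rw [← h, upperJointTransform]
  congr 2; funext ω
  refine congrFun (indicator_congr fun ω hω => ?_) ω
  rw [cFunction, if_pos (sub_neg.2 hω.2), exitOvershoot, indicator_of_mem hω, ← Complex.exp_add]
  congr 1; push_cast; ring

end ExitIdentity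

theorem theorem2 {Ω : Type*} [MeasurableSpace Ω] (P : Measure Ω) [IsProbabilityMeasure P]
    (p : Regime → CompoundPoisson) (T J : Regime → ℕ → ℕ → Ω → ℝ)
    (hnoise : IsDrivingNoise P p T J)
    (B b x s : ℝ) (hB : 0 < B) (hb : b ∈ Icc 0 B) (hx : x ∈ Icc 0 B) (hs : 0 ≤ s) :
    -- the functions in the formulas are well defined
    (∃! R, IsResolvent (p .lower) s R) ∧
    (∀ y, ∃! K, IsKFunction p s y K) ∧
    kFunction p s b (B - b) ≠ 0 ∧
    -- the exit time and the exit position are random variables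
    AEMeasurable (exitTime (oscProcess p T J b x) B) P ∧
    AEMeasurable (exitPos (oscProcess p T J b x) B) P ∧
    -- the three Laplace transforms
    lowerTransform (oscProcess p T J b x) B P s =
      kFunction p s (b - x) (B - b) / kFunction p s b (B - b) ∧
    upperTransform (oscProcess p T J b x) B P s =
      frakK p (b - x) (B - b) s -
        kFunction p s (b - x) (B - b) / kFunction p s b (B - b) * frakK p b (B - b) s ∧
    ∀ z : ℂ, 0 ≤ z.re →
      upperJointTransform (oscProcess p T J b x) B P z s =
        frakKJoint p (b - x) (B - b) z s -
          kFunction p s (b - x) (B - b) / kFunction p s b (B - b) *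
            frakKJoint p b (B - b) z s := by
  have hK := kFunction_ne_zero hnoise hB hb hs
  have hlow : lowerTransform (oscProcess p T J b x) B P s =
      kFunction p s (b - x) (B - b) / kFunction p s b (B - b) := by
    rw [eq_div_iff hK, mul_comm]
    exact kFunction_mul_lowerTransform hnoise hB hb hx hs
  have hup : ∀ z : ℂ, 0 ≤ z.re → upperJointTransform (oscProcess p T J b x) B P z s =
      frakKJoint p (b - x) (B - b) z s - kFunction p s (b - x) (B - b) /
        kFunction p s b (B - b) * frakKJoint p b (B - b) z s := fun z hz => by
    have h := frakKJoint_mul_lowerTransform hnoise hB hb hx hs hz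
    rw [hlow] at h
    rw [← h]; push_cast; ring
  refine ⟨(p .lower).existsUnique_isResolvent hs, existsUnique_isKFunction p hs, hK,
    aemeasurable_exitTime hnoise hB hb hx.1, aemeasurable_exitPos hnoise hB hb hx.1, hlow, ?_, hup⟩
  -- At z = 0 the overshoot drops out and the joint transform becomes the transform of the exit time
  -- alone.
  have h := hup 0 le_rfl
  rw [upperJointTransform_zero, frakKJoint_zero p hs, frakKJoint_zero p hs] at h
  exact_mod_cast h

end
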